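/- Let $G=(V,E)$ be a finite tree with $V=\{0,\dots,m-1\}$, $m\ge 1$, and let $n\ge 1$ agents share one utility function $u:2^V\to\mathbb{R}_{\ge 0}$ that is additive, i.e. $u(X)=\sum_{v\in X}u(\{v\})$ for all $X\subseteq V$. A connected allocation is a tuple $(A_1,\dots,A_n)$ of pairwise disjoint subsets of $V$ with union $V$, each of which is empty or induces a connected subgraph of $G$. Let $$\mathrm{MMS}(V)=\max_{A}\ \min_{1\le i\le n}u(A_i),$$ the maximum being over all connected allocations $A$. A connected allocation $A$ is strongly MMS (SMMS) if $u(A_i)\ge \mathrm{MMS}(V)$ for all $i$ and, among all connected allocations with this property, $A$ minimizes the number of agents $i$ with $u(A_i)=\mathrm{MMS}(V)$. Theorem. An SMMS connected allocation can be found in polynomial time. Precisely: there is a single random access program (while-programs over finitely many arrays of natural numbers and of utility values, indirectly addressed by natural numbers, whose only operations are copying, addition, subtraction and comparison, and which contains no nonzero constants among the utility values) and there are polynomials $p,q$ such that the program, given $m$, $n$, the adjacency matrix of $G$ and the values $u(\{v\})$ for $v\in V$ of any instance as above, halts with an SMMS connected allocation in memory (as the list of the agents that receive the vertices $0,\dots,m-1$),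 and 1. for real utilities, the number of operations executed is at most $p(m+n)$; 2. for rational utilities, the total bit cost of the run, in which producing a number in one operation costs the binary length of that number, is at most $q\bigl(m+n+\sum_{v\in V}\ell(u(\{v\}))\bigr)$, where $\ell(x)$ is the binary length of the rational number $x$ (numerator plus denominator in lowest terms, plus one). -/

import Mathlib

namespace GraphFairDivision

/-! ### Connected allocations and the maximin share -/

section Fairness

variable {V R : Type*}

/-- The set function `u` is additive: `u X = ∑ v ∈ X, u {v}` for every bundle `X`. -/
def IsAdditive [AddCommMonoid R] (u : Finset V → R) : Prop :=
  ∀ X : Finset V, u X = ∑ v ∈ X, u {v}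

/-- A bundle is connected if it induces a connected subgraph. The empty bundle is allowed. -/
def IsConnectedBundle (G : SimpleGraph V) (X : Finset V) : Prop :=
  (G.induce (X : Set V)).Preconnected

/-- `A` is a connected allocation of the vertices of `G`: its bundles are pairwise disjoint,
cover all vertices, and are connected. -/
def IsConnectedAllocation (G : SimpleGraph V) {n : ℕ} (A : Fin n → Finset V) : Prop :=
  (∀ v, ∃ i, v ∈ A i) ∧ (∀ i j, i ≠ j → Disjoint (A i) (A j)) ∧ ∀ i, IsConnectedBundle G (A i)

/-- `μ = MMS(V)`: the maximum, over all connected allocations to `n` agents, of the minimum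
utility of a bundle. -/
def IsMaximinShare [LinearOrder R] (G : SimpleGraph V) (n : ℕ) (u : Finset V → R) (μ : R) : Prop :=
  IsGreatest
    {x | ∃ A : Fin n → Finset V, IsConnectedAllocation G A ∧
      IsLeast (Set.range fun i => u (A i)) x} μ

/-- The number of losers of `A`, the agents that receive exactly `μ`. -/
def loserCount [LinearOrder R] {n : ℕ} (u : Finset V → R) (μ : R) (A : Fin n → Finset V) : ℕ :=
  (Finset.univ.filter fun i => u (A i) = μ).card

/-- `A` is a strongly maximin share (SMMS) connected allocation for agents with the common utility
`u`: every agent receives at least `μ = MMS(V)`, and no connected allocation that gives every agent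
at least `μ` has fewer losers. The maximin share is unique, so `∃ μ` only names it. -/
def IsSMMS [LinearOrder R] (G : SimpleGraph V) {n : ℕ} (u : Finset V → R)
    (A : Fin n → Finset V) : Prop :=
  ∃ μ : R, IsMaximinShare G n u μ ∧ IsConnectedAllocation G A ∧ (∀ i, μ ≤ u (A i)) ∧
    ∀ B : Fin n → Finset V, IsConnectedAllocation G B → (∀ i, μ ≤ u (B i)) →
      loserCount u μ A ≤ loserCount u μ B

end Fairness

/-! ### Random access programs

Programs work on finitely many named arrays of natural numbers (used for counters, indices and
pointers) and finitely many named arrays of numbers from `R` (used for utilities). The only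
arithmetic is addition and subtraction, the only test is comparison; there is no multiplication
and there are no constants in `R` other than `0`. A program does not depend on `R`. -/

/-- Memory contents: `nat a k` and `val a k` are the entries with index `k` of the arrays named `a`
of natural numbers and of elements of `R`. -/
structure Memory (R : Type) where
  nat : ℕ → ℕ → ℕ
  val : ℕ → ℕ → R

/-- Expressions with values in `ℕ`; `sub` is truncated subtraction. -/
inductive NatExp : Type
  | const (c : ℕ)
  | read (a : ℕ) (idx : NatExp)
  | add (e f : NatExp)
  | sub (e f : NatExp)

/-- Expressions with values in `R`. -/
inductive ValExp : Type
  | zero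
  | read (a : ℕ) (idx : NatExp)
  | add (e f : ValExp)
  | sub (e f : ValExp)

/-- Tests. -/
inductive Test : Type
  | natLe (e f : NatExp)
  | valLe (e f : ValExp)
  | not (b : Test)
  | and (b c : Test)

/-- Programs. -/
inductive Prog : Type
  | skip
  | setNat (a : ℕ) (idx e : NatExp)
  | setVal (a : ℕ) (idx : NatExp) (e : ValExp)
  | seq (P Q : Prog)
  | ite (b : Test) (P Q : Prog)
  | while (b : Test) (P : Prog)

/-- What it costs to produce a natural number or an element of `R` in one operation. -/
structure CostModel (R : Type) where
  nat : ℕ → ℕ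
  val : R → ℕ

/-- Uniform cost: every operation costs `1`. -/
def unitCost (R : Type) : CostModel R := ⟨fun _ => 1, fun _ => 1⟩

/-- The binary length of a rational number (numerator and denominator in lowest terms). -/
def ratBits (x : ℚ) : ℕ := 1 + Nat.size x.num.natAbs + Nat.size x.den

/-- Logarithmic (bit) cost: an operation costs the binary length of its result. Operands and
addresses are themselves results of operations and are charged for as such. -/
def bitCost : CostModel ℚ := ⟨fun k => 1 + Nat.size k, ratBits⟩

section Semantics

variable {R : Type}

/-- Overwrite one entry of an array of natural numbers. -/
def Memory.setNat (s : Memory R) (a k x : ℕ) : Memory R :=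
  { s with nat := Function.update s.nat a (Function.update (s.nat a) k x) }

/-- Overwrite one entry of an array of elements of `R`. -/
def Memory.setVal (s : Memory R) (a k : ℕ) (x : R) : Memory R :=
  { s with val := Function.update s.val a (Function.update (s.val a) k x) }

def NatExp.eval (s : Memory R) : NatExp → ℕ
  | .const c => c
  | .read a idx => s.nat a (idx.eval s)
  | .add e f => e.eval s + f.eval s
  | .sub e f => e.eval s - f.eval s

def NatExp.cost (C : CostModel R) (s : Memory R) : NatExp → ℕ
  | .const c => C.nat c
  | .read a idx => C.nat (s.nat a (idx.eval s)) + idx.cost C s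
  | .add e f => C.nat (e.eval s + f.eval s) + e.cost C s + f.cost C s
  | .sub e f => C.nat (e.eval s - f.eval s) + e.cost C s + f.cost C s

variable [Zero R] [Add R] [Sub R]

def ValExp.eval (s : Memory R) : ValExp → R
  | .zero => 0
  | .read a idx => s.val a (idx.eval s)
  | .add e f => e.eval s + f.eval s
  | .sub e f => e.eval s - f.eval s

def ValExp.cost (C : CostModel R) (s : Memory R) : ValExp → ℕ
  | .zero => C.val 0
  | .read a idx => C.val (s.val a (idx.eval s)) + idx.cost C s
  | .add e f => C.val (e.eval s + f.eval s) + e.cost C s + f.cost C s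
  | .sub e f => C.val (e.eval s - f.eval s) + e.cost C s + f.cost C s

def Test.holds [LE R] (s : Memory R) : Test → Prop
  | .natLe e f => e.eval s ≤ f.eval s
  | .valLe e f => e.eval s ≤ f.eval s
  | .not b => ¬ b.holds s
  | .and b c => b.holds s ∧ c.holds s

def Test.cost (C : CostModel R) (s : Memory R) : Test → ℕ
  | .natLe e f => 1 + e.cost C s + f.cost C s
  | .valLe e f => 1 + e.cost C s + f.cost C s
  | .not b => 1 + b.cost C s
  | .and b c => 1 + b.cost C s + c.cost C s

/-- `Exec C P s t s'`: started in memory `s`, the program `P` halts in memory `s'`, and the total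
cost of the run under the cost model `C` is `t`. -/
inductive Exec [LE R] (C : CostModel R) : Prog → Memory R → ℕ → Memory R → Prop
  | skip (s : Memory R) : Exec C .skip s 1 s
  | setNat (s : Memory R) (a : ℕ) (idx e : NatExp) :
      Exec C (.setNat a idx e) s (1 + idx.cost C s + e.cost C s)
        (s.setNat a (idx.eval s) (e.eval s))
  | setVal (s : Memory R) (a : ℕ) (idx : NatExp) (e : ValExp) :
      Exec C (.setVal a idx e) s (1 + idx.cost C s + e.cost C s)
        (s.setVal a (idx.eval s) (e.eval s))
  | seq {P Q : Prog} {s s' s'' : Memory R} {t t' : ℕ} :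
      Exec C P s t s' → Exec C Q s' t' s'' → Exec C (.seq P Q) s (t + t') s''
  | iteTrue {b : Test} {P Q : Prog} {s s' : Memory R} {t : ℕ} :
      b.holds s → Exec C P s t s' → Exec C (.ite b P Q) s (1 + b.cost C s + t) s'
  | iteFalse {b : Test} {P Q : Prog} {s s' : Memory R} {t : ℕ} :
      ¬ b.holds s → Exec C Q s t s' → Exec C (.ite b P Q) s (1 + b.cost C s + t) s'
  | whileTrue {b : Test} {P : Prog} {s s' s'' : Memory R} {t t' : ℕ} :
      b.holds s → Exec C P s t s' → Exec C (.while b P) s' t' s'' →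
        Exec C (.while b P) s (1 + b.cost C s + t + t') s''
  | whileFalse {b : Test} {P : Prog} {s : Memory R} :
      ¬ b.holds s → Exec C (.while b P) s (1 + b.cost C s) s

end Semantics

/-! ### Input and output -/

open Classical in
/-- The initial memory for a graph `G` on `m` vertices, `n` agents and a utility function `u`.
The natural-number array `0` starts with `m, n`; the natural-number array `1` holds the adjacency
matrix row by row; the array `0` over `R` holds the utilities `u {v}` of the single vertices. All
other entries are `0`. -/
noncomputable def inputMemory {R : Type} [Zero R] {m : ℕ} (G : SimpleGraph (Fin m)) (n : ℕ)
    (u : Finset (Fin m) → R) : Memory R where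
  nat a k :=
    if a = 0 then (if k = 0 then m else if k = 1 then n else 0)
    else if a = 1 then (if ∃ i j : Fin m, k = i * m + j ∧ G.Adj i j then 1 else 0)
    else 0
  val a k := if a = 0 then (if h : k < m then u {⟨k, h⟩} else 0) else 0

/-- The allocation written in memory: the entry `v` of the natural-number array `2` is the agent
who receives the vertex `v`. -/
def outputAllocation {R : Type} (m n : ℕ) (s : Memory R) : Fin n → Finset (Fin m) :=
  fun i => Finset.univ.filter fun v : Fin m => s.nat 2 v = i

end GraphFairDivision

/-! Root the tree and number its vertices so that parents have smaller numbers. A connected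
allocation is then described by cuts: each bundle of positive value is cut off above its top vertex.
For a threshold `μ` and a budget `l` of losers, a dynamic program over the numbered vertices
computes at each vertex the lexicographically largest pair of the number of finished parts of weight
at least `μ`, at most `l` of them equal to `μ`, and the weight collected at the vertex. Keeping one
pair is enough, because collected weight can save at most one cut at the next vertex, so an
additional finished part always compensates for less of it (`merge_lexLe_merge`). Hence the table
dominates every admissible set of cuts (`IsTable.lexLe`) and is attained by the cuts traced back
from it (`IsTraceback.eq_table`). `IsTable.card_le` and `IsAssignment` translate between cuts and
allocations.

The maximin share is found by comparisons only, so that real utilities are covered. The threshold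
starts at `0`, which is feasible. As long as `n` parts of weight strictly above `μ` exist, `μ` is
raised to the least weight of a finished part above it; the parts just found show that the new
threshold is feasible. Each raise lowers the sum of all part counts (`potential_lt`), which is at
most `m * m`, so polynomially many raises lead to a feasible `μ` that no allocation exceeds for all
agents. This `μ` is the maximin share.

If `μ > 0`, the least budget for which the table has `n` parts is the least number of losers. If `μ
= 0`, the losers are the worthless bundles, and the table with budget `0` maximises the number of
the others. Both cases are settled in `isSMMS_of_table`.

The program consists of loops of `M = m + n + 1` rounds, so its number of operations is bounded by a
polynomial read off from its text (`LoopProg.exec_compile`). As there is no multiplication, `t`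
operations add at most `t` bits to numbers over a common denominator, so the bit cost is polynomial
as well (`Exec.bitCost_of_unitCost`). -/

namespace GraphFairDivision

/-! ### Bit cost in terms of uniform cost

One operation at most doubles the absolute values of the numbers in memory and keeps a common
denominator. So a run of `t` steps handles numbers with at most `t` more bits than the input has,
and its bit cost is polynomial in `t` and the size of the input. -/

/-- The uniform cost of evaluating an expression. -/
def NatExp.size : NatExp → ℕ
  | .const _ => 1
  | .read _ idx => 1 + idx.size
  | .add e f => 1 + e.size + f.size
  | .sub e f => 1 + e.size + f.size

/-- The uniform cost of evaluating an expression. -/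
def ValExp.size : ValExp → ℕ
  | .zero => 1
  | .read _ idx => 1 + idx.size
  | .add e f => 1 + e.size + f.size
  | .sub e f => 1 + e.size + f.size

/-- The uniform cost of evaluating a test. -/
def Test.size : Test → ℕ
  | .natLe e f => 1 + e.size + f.size
  | .valLe e f => 1 + e.size + f.size
  | .not b => 1 + b.size
  | .and b c => 1 + b.size + c.size

/-- The sum of all constants in an expression. -/
def NatExp.constSum : NatExp → ℕ
  | .const c => c
  | .read _ idx => idx.constSum
  | .add e f => e.constSum + f.constSum
  | .sub e f => e.constSum + f.constSum

/-- The sum of all constants in an expression. -/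
def ValExp.constSum : ValExp → ℕ
  | .zero => 0
  | .read _ idx => idx.constSum
  | .add e f => e.constSum + f.constSum
  | .sub e f => e.constSum + f.constSum

/-- The sum of all constants in a test. -/
def Test.constSum : Test → ℕ
  | .natLe e f => e.constSum + f.constSum
  | .valLe e f => e.constSum + f.constSum
  | .not b => b.constSum
  | .and b c => b.constSum + c.constSum

/-- The sum of all constants in a program. -/
def Prog.constSum : Prog → ℕ
  | .skip => 0
  | .setNat _ idx e => idx.constSum + e.constSum
  | .setVal _ idx e => idx.constSum + e.constSum
  | .seq P Q => P.constSum + Q.constSum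
  | .ite b P Q => b.constSum + P.constSum + Q.constSum
  | .while b P => b.constSum + P.constSum

section UnitCost

variable {R : Type}

theorem NatExp.cost_unitCost (s : Memory R) (e : NatExp) : e.cost (unitCost R) s = e.size := by
  induction e <;> simp [NatExp.cost, NatExp.size, unitCost] at * <;> omega

variable [Zero R] [Add R] [Sub R]

theorem ValExp.cost_unitCost (s : Memory R) (e : ValExp) : e.cost (unitCost R) s = e.size := by
  induction e with
  | read a idx =>
    simp only [ValExp.cost, ValExp.size, NatExp.cost_unitCost]
    rfl
  | _ => simp [ValExp.cost, ValExp.size, unitCost] at * <;> omega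

theorem Test.cost_unitCost (s : Memory R) (b : Test) : b.cost (unitCost R) s = b.size := by
  induction b <;>
    simp [Test.cost, Test.size, NatExp.cost_unitCost, ValExp.cost_unitCost] at * <;> omega

end UnitCost

/-- `x` has denominator dividing `D` and numerator over `D` of at most `k` bits. -/
def BoundedRat (D k : ℕ) (x : ℚ) : Prop :=
  ∃ z : ℤ, x * D = z ∧ z.natAbs < 2 ^ k

/-- All natural numbers in memory have at most `k` bits, and all rational numbers have
denominator dividing `D` and numerator over `D` of at most `k` bits. -/
structure Memory.Bounded (D k : ℕ) (s : Memory ℚ) : Prop where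
  nat : ∀ a i, s.nat a i < 2 ^ k
  val : ∀ a i, BoundedRat D k (s.val a i)

theorem BoundedRat.mono {D k l : ℕ} {x : ℚ} (h : BoundedRat D k x) (hkl : k ≤ l) :
    BoundedRat D l x := by
  obtain ⟨z, hz, hz'⟩ := h
  exact ⟨z, hz, hz'.trans_le (Nat.pow_le_pow_right (by norm_num) hkl)⟩

theorem Memory.Bounded.mono {D k l : ℕ} {s : Memory ℚ} (h : s.Bounded D k) (hkl : k ≤ l) :
    s.Bounded D l :=
  ⟨fun a i => (h.nat a i).trans_le (Nat.pow_le_pow_right (by norm_num) hkl),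
    fun a i => (h.val a i).mono hkl⟩

theorem BoundedRat.zero (D k : ℕ) : BoundedRat D k 0 :=
  ⟨0, by simp, by simp⟩

theorem BoundedRat.add {D k : ℕ} {x y : ℚ} (hx : BoundedRat D k x) (hy : BoundedRat D k y) :
    BoundedRat D (k + 1) (x + y) := by
  obtain ⟨z, hz, hz'⟩ := hx
  obtain ⟨w, hw, hw'⟩ := hy
  refine ⟨z + w, by push_cast; linarith, ?_⟩
  rw [pow_succ]
  omega

theorem BoundedRat.sub {D k : ℕ} {x y : ℚ} (hx : BoundedRat D k x) (hy : BoundedRat D k y) :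
    BoundedRat D (k + 1) (x - y) := by
  obtain ⟨z, hz, hz'⟩ := hx
  obtain ⟨w, hw, hw'⟩ := hy
  refine ⟨z - w, by push_cast; linarith, ?_⟩
  rw [pow_succ]
  omega

/-- Reduction to lowest terms only shrinks the fraction `z / D`: its denominator divides `D` and its
numerator divides `z`. This allows all sizes to be measured over one common denominator. -/
theorem BoundedRat.ratBits_le {D k : ℕ} {x : ℚ} (hx : BoundedRat D k x) (hD : 0 < D)
    (hDk : D < 2 ^ k) : ratBits x ≤ 2 * k + 1 := by
  obtain ⟨z, hz, hz'⟩ := hx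
  have hx : x = Rat.divInt z D := by
    rw [Rat.divInt_eq_div, Int.cast_natCast, eq_div_iff (by positivity), hz]
  have hden : x.den ≤ D :=
    Nat.le_of_dvd hD (by exact_mod_cast hx ▸ Rat.den_dvd z D)
  have hnum : x.num.natAbs ≤ z.natAbs := by
    by_cases h0 : z = 0
    · simp [hx, h0]
    · exact Nat.le_of_dvd (by omega)
        (Int.natAbs_dvd_natAbs.2 (hx ▸ Rat.num_dvd z (by omega : (D : ℤ) ≠ 0)))
  have h1 : Nat.size x.num.natAbs ≤ k := Nat.size_le.2 (hnum.trans_lt hz')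
  have h2 : Nat.size x.den ≤ k := Nat.size_le.2 (hden.trans_lt hDk)
  unfold ratBits
  omega

/-- A bound for the bit cost of one operation that produces a number of at most `k` bits. -/
def opBits (k : ℕ) : ℕ := 2 * k + 1

theorem opBits_mono {k l : ℕ} (h : k ≤ l) : opBits k ≤ opBits l := by
  unfold opBits; omega

theorem one_le_opBits (k : ℕ) : 1 ≤ opBits k := by
  unfold opBits; omega

theorem bitCost_nat_le {x k : ℕ} (h : x < 2 ^ k) : bitCost.nat x ≤ opBits (k + 1) := by
  have := Nat.size_le.2 h
  simp only [bitCost, opBits]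
  omega

theorem two_pow_le_two_pow {k l : ℕ} (h : k ≤ l) : 2 ^ k ≤ 2 ^ l :=
  Nat.pow_le_pow_right (by norm_num) h

theorem sum_mul_opBits_le {a b k l j : ℕ} (hk : k ≤ j) (hl : l ≤ j) :
    a * opBits k + b * opBits l ≤ (a + b) * opBits j := by
  rw [add_mul]
  exact add_le_add (Nat.mul_le_mul_left _ (opBits_mono hk)) (Nat.mul_le_mul_left _ (opBits_mono hl))

section BitCost

variable {D k : ℕ} {s : Memory ℚ}

/-- Each operation adds at most one bit: a sum at most doubles, a truncated difference does not
grow, and a constant `c ≤ k` is below `2 ^ k`. -/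
theorem NatExp.eval_lt (hs : s.Bounded D k) {e : NatExp} (he : e.constSum ≤ k) :
    e.eval s < 2 ^ (k + e.size) := by
  induction e with
  | const c => exact (he.trans_lt Nat.lt_two_pow_self).trans_le (two_pow_le_two_pow (by omega))
  | read a idx ih => exact (hs.nat _ _).trans_le (two_pow_le_two_pow (by omega))
  | add e f ihe ihf =>
    simp only [NatExp.constSum] at he
    have h1 := (ihe (by omega)).trans_le (two_pow_le_two_pow (l := k + e.size + f.size) (by omega))
    have h2 := (ihf (by omega)).trans_le (two_pow_le_two_pow (l := k + e.size + f.size) (by omega))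
    have h3 : 2 ^ (k + (1 + e.size + f.size)) = 2 ^ (k + e.size + f.size) * 2 := by
      rw [← pow_succ]; congr 1; omega
    simp only [NatExp.eval, NatExp.size]
    omega
  | sub e f ihe ihf =>
    simp only [NatExp.constSum] at he
    have h1 := (ihe (by omega)).trans_le
      (two_pow_le_two_pow (l := k + (1 + e.size + f.size)) (by omega))
    simp only [NatExp.eval, NatExp.size]
    omega

theorem NatExp.cost_bitCost_le (hs : s.Bounded D k) {e : NatExp} (he : e.constSum ≤ k) :
    e.cost bitCost s ≤ e.size * opBits (k + e.size + 1) := by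
  -- `key` bounds the outermost operation. It mentions `e`, so the induction hypotheses take it as a
  -- premise for the subexpressions.
  have key := bitCost_nat_le (NatExp.eval_lt hs he)
  induction e with
  | const c => simpa [NatExp.cost, NatExp.size, NatExp.eval] using key
  | read a idx ih =>
    have := ih he (bitCost_nat_le (NatExp.eval_lt hs he))
    simp only [NatExp.cost, NatExp.size, NatExp.eval] at *
    have := sum_mul_opBits_le (a := 1) (b := idx.size) (k := k + (1 + idx.size) + 1)
      (l := k + idx.size + 1) (j := k + (1 + idx.size) + 1) le_rfl (by omega)
    omega
  | add e f ihe ihf =>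
    simp only [NatExp.constSum] at he
    have h1 := ihe (by omega) (bitCost_nat_le (NatExp.eval_lt hs (by omega)))
    have h2 := ihf (by omega) (bitCost_nat_le (NatExp.eval_lt hs (by omega)))
    simp only [NatExp.cost, NatExp.size, NatExp.eval] at *
    have h3 := sum_mul_opBits_le (a := 1) (b := e.size) (k := k + (1 + e.size + f.size) + 1)
      (l := k + e.size + 1) (j := k + (1 + e.size + f.size) + 1) le_rfl (by omega)
    have h4 := sum_mul_opBits_le (a := 1 + e.size) (b := f.size)
      (k := k + (1 + e.size + f.size) + 1)
      (l := k + f.size + 1) (j := k + (1 + e.size + f.size) + 1) le_rfl (by omega)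
    omega
  | sub e f ihe ihf =>
    simp only [NatExp.constSum] at he
    have h1 := ihe (by omega) (bitCost_nat_le (NatExp.eval_lt hs (by omega)))
    have h2 := ihf (by omega) (bitCost_nat_le (NatExp.eval_lt hs (by omega)))
    simp only [NatExp.cost, NatExp.size, NatExp.eval] at *
    have h3 := sum_mul_opBits_le (a := 1) (b := e.size) (k := k + (1 + e.size + f.size) + 1)
      (l := k + e.size + 1) (j := k + (1 + e.size + f.size) + 1) le_rfl (by omega)
    have h4 := sum_mul_opBits_le (a := 1 + e.size) (b := f.size)
      (k := k + (1 + e.size + f.size) + 1)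
      (l := k + f.size + 1) (j := k + (1 + e.size + f.size) + 1) le_rfl (by omega)
    omega

theorem ValExp.eval_bounded (hs : s.Bounded D k) (e : ValExp) :
    BoundedRat D (k + e.size) (e.eval s) := by
  induction e with
  | zero => exact BoundedRat.zero _ _
  | read a idx => exact (hs.val _ _).mono (by omega)
  | add e f ihe ihf =>
    exact ((ihe.mono (by omega)).add (ihf.mono (by omega))).mono (k := k + e.size + f.size + 1)
      (by simp only [ValExp.size]; omega)
  | sub e f ihe ihf =>
    exact ((ihe.mono (by omega)).sub (ihf.mono (by omega))).mono (k := k + e.size + f.size + 1)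
      (by simp only [ValExp.size]; omega)

variable (hD : 0 < D) (hDk : D < 2 ^ k)
include hD hDk

theorem bitCost_val_le {x : ℚ} {l : ℕ} (hx : BoundedRat D l x) (hkl : k ≤ l) :
    bitCost.val x ≤ opBits (l + 1) :=
  (hx.ratBits_le hD (hDk.trans_le (two_pow_le_two_pow hkl))).trans (by simp [opBits])

theorem ValExp.cost_bitCost_le (hs : s.Bounded D k) {e : ValExp} (he : e.constSum ≤ k) :
    e.cost bitCost s ≤ e.size * opBits (k + e.size + 1) := by
  have key := bitCost_val_le hD hDk (ValExp.eval_bounded hs e) (by omega)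
  induction e with
  | zero => simpa [ValExp.cost, ValExp.size, ValExp.eval] using key
  | read a idx =>
    have := NatExp.cost_bitCost_le hs he
    simp only [ValExp.cost, ValExp.size, ValExp.eval] at *
    have := sum_mul_opBits_le (a := 1) (b := idx.size) (k := k + (1 + idx.size) + 1)
      (l := k + idx.size + 1) (j := k + (1 + idx.size) + 1) le_rfl (by omega)
    omega
  | add e f ihe ihf =>
    simp only [ValExp.constSum] at he
    have h1 := ihe (by omega) (bitCost_val_le hD hDk (ValExp.eval_bounded hs e) (by omega))
    have h2 := ihf (by omega) (bitCost_val_le hD hDk (ValExp.eval_bounded hs f) (by omega))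
    simp only [ValExp.cost, ValExp.size, ValExp.eval] at *
    have h3 := sum_mul_opBits_le (a := 1) (b := e.size) (k := k + (1 + e.size + f.size) + 1)
      (l := k + e.size + 1) (j := k + (1 + e.size + f.size) + 1) le_rfl (by omega)
    have h4 := sum_mul_opBits_le (a := 1 + e.size) (b := f.size)
      (k := k + (1 + e.size + f.size) + 1)
      (l := k + f.size + 1) (j := k + (1 + e.size + f.size) + 1) le_rfl (by omega)
    omega
  | sub e f ihe ihf =>
    simp only [ValExp.constSum] at he
    have h1 := ihe (by omega) (bitCost_val_le hD hDk (ValExp.eval_bounded hs e) (by omega))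
    have h2 := ihf (by omega) (bitCost_val_le hD hDk (ValExp.eval_bounded hs f) (by omega))
    simp only [ValExp.cost, ValExp.size, ValExp.eval] at *
    have h3 := sum_mul_opBits_le (a := 1) (b := e.size) (k := k + (1 + e.size + f.size) + 1)
      (l := k + e.size + 1) (j := k + (1 + e.size + f.size) + 1) le_rfl (by omega)
    have h4 := sum_mul_opBits_le (a := 1 + e.size) (b := f.size)
      (k := k + (1 + e.size + f.size) + 1)
      (l := k + f.size + 1) (j := k + (1 + e.size + f.size) + 1) le_rfl (by omega)
    omega

omit hD hDk in
-- The accounting shared by all nodes: `1` for the node itself, then its subterms at the larger bit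
-- bound. The equations for `j` and `K` are hypotheses so that `rfl` can match them with the sizes.
theorem one_add_mul_opBits_le {x y a b j K : ℕ} (hx : x ≤ a * opBits (k + a + 1))
    (hy : y ≤ b * opBits (k + b + 1)) (hj : j = k + (1 + a + b) + 1) (hK : K = 1 + a + b) :
    1 + x + y ≤ K * opBits j := by
  have h3 := sum_mul_opBits_le (a := a) (b := b) (k := k + a + 1)
      (l := k + b + 1) (j := j) (by omega) (by omega)
  have := one_le_opBits j
  have : K * opBits j = opBits j + (a + b) * opBits j := by subst hK; ring
  omega

theorem Test.cost_bitCost_le (hs : s.Bounded D k) {b : Test} (hb : b.constSum ≤ k) :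
    b.cost bitCost s ≤ b.size * opBits (k + b.size + 1) := by
  induction b with
  | natLe e f =>
    simp only [Test.constSum] at hb
    exact one_add_mul_opBits_le (NatExp.cost_bitCost_le hs (by omega))
      (NatExp.cost_bitCost_le hs (by omega)) rfl rfl
  | valLe e f =>
    simp only [Test.constSum] at hb
    exact one_add_mul_opBits_le (ValExp.cost_bitCost_le hD hDk hs (by omega))
      (ValExp.cost_bitCost_le hD hDk hs (by omega)) rfl rfl
  | not b ih =>
    exact one_add_mul_opBits_le (ih hb) (b := 0) (y := 0) (by simp) rfl rfl
  | and b c ihb ihc =>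
    simp only [Test.constSum] at hb
    exact one_add_mul_opBits_le (ihb (by omega)) (ihc (by omega)) rfl rfl

omit hD hDk in
theorem Memory.Bounded.setNat (hs : s.Bounded D k) {a i x : ℕ} (hx : x < 2 ^ k) :
    (s.setNat a i x).Bounded D k := by
  refine ⟨fun b j => ?_, hs.val⟩
  simp only [Memory.setNat, Function.update_apply]
  split_ifs
  · simp only [Function.update_apply]
    split_ifs
    exacts [hx, hs.nat _ _]
  · exact hs.nat _ _

omit hD hDk in
theorem Memory.Bounded.setVal (hs : s.Bounded D k) {a i : ℕ} {x : ℚ} (hx : BoundedRat D k x) :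
    (s.setVal a i x).Bounded D k := by
  refine ⟨hs.nat, fun b j => ?_⟩
  simp only [Memory.setVal, Function.update_apply]
  split_ifs
  · simp only [Function.update_apply]
    split_ifs
    exacts [hx, hs.val _ _]
  · exact hs.val _ _

end BitCost

/-- Both cost models charge for the same run. A run of uniform cost `t` adds at most `t` bits to the
numbers, so none of its operations costs more than `opBits (k + t + 1)`. The bound `k` is quantified
inside because the second half of a run starts from a memory with a larger bound. -/
theorem Exec.bitCost_of_unitCost {D : ℕ} (hD : 0 < D) {P : Prog} {s s' : Memory ℚ} {t : ℕ}
    (h : Exec (unitCost ℚ) P s t s') :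
    ∀ {k : ℕ}, D < 2 ^ k → s.Bounded D k → P.constSum ≤ k →
      ∃ t', Exec bitCost P s t' s' ∧ t' ≤ t * opBits (k + t + 1) ∧ s'.Bounded D (k + t) := by
  have hpow : ∀ {k : ℕ} (j : ℕ), D < 2 ^ k → D < 2 ^ (k + j) :=
    fun j h => h.trans_le (two_pow_le_two_pow (by omega))
  induction h with
  | skip s =>
    intro k _ hs _
    exact ⟨1, .skip s, by simpa using one_le_opBits _, hs.mono (by omega)⟩
  | setNat s a idx e =>
    intro k hk hs hP
    simp only [Prog.constSum] at hP
    refine ⟨_, .setNat s a idx e, ?_, ?_⟩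
    · simp only [NatExp.cost_unitCost]
      exact one_add_mul_opBits_le (NatExp.cost_bitCost_le hs (by omega))
        (NatExp.cost_bitCost_le hs (by omega)) rfl rfl
    · simp only [NatExp.cost_unitCost]
      exact (hs.mono (by omega)).setNat
        ((NatExp.eval_lt hs (by omega)).trans_le (two_pow_le_two_pow (by omega)))
  | setVal s a idx e =>
    intro k hk hs hP
    simp only [Prog.constSum] at hP
    refine ⟨_, .setVal s a idx e, ?_, ?_⟩
    · simp only [NatExp.cost_unitCost, ValExp.cost_unitCost]
      exact one_add_mul_opBits_le (NatExp.cost_bitCost_le hs (by omega))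
        (ValExp.cost_bitCost_le hD hk hs (by omega)) rfl rfl
    · simp only [NatExp.cost_unitCost, ValExp.cost_unitCost]
      exact (hs.mono (by omega)).setVal ((ValExp.eval_bounded hs e).mono (by omega))
  | seq _ _ ih1 ih2 =>
    rename_i P Q s0 s1 s2 t1 t2 _ _
    intro k hk hs hP
    simp only [Prog.constSum] at hP
    obtain ⟨a, ha, hat, hb⟩ := ih1 hk hs (by omega)
    obtain ⟨c, hc, hct, hd⟩ := ih2 (hpow t1 hk) hb (by omega)
    refine ⟨_, .seq ha hc, ?_, hd.mono (by omega)⟩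
    have := sum_mul_opBits_le (a := t1) (b := t2) (k := k + t1 + 1) (l := k + t1 + t2 + 1)
      (j := k + (t1 + t2) + 1) (by omega) (by omega)
    omega
  | iteTrue hb _ ih =>
    rename_i b P Q s0 s1 t _
    intro k hk hs hP
    simp only [Prog.constSum] at hP
    obtain ⟨a, ha, hat, hc⟩ := ih hk hs (by omega)
    refine ⟨_, .iteTrue hb ha, ?_, hc.mono (by omega)⟩
    simp only [Test.cost_unitCost]
    exact one_add_mul_opBits_le (Test.cost_bitCost_le hD hk hs (by omega)) hat rfl rfl
  | iteFalse hb _ ih =>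
    rename_i b P Q s0 s1 t _
    intro k hk hs hP
    simp only [Prog.constSum] at hP
    obtain ⟨a, ha, hat, hc⟩ := ih hk hs (by omega)
    refine ⟨_, .iteFalse hb ha, ?_, hc.mono (by omega)⟩
    simp only [Test.cost_unitCost]
    exact one_add_mul_opBits_le (Test.cost_bitCost_le hD hk hs (by omega)) hat rfl rfl
  | whileTrue hb _ _ ih1 ih2 =>
    rename_i b P s0 s1 s2 t1 t2 _ _
    intro k hk hs hP
    simp only [Prog.constSum] at hP
    obtain ⟨a, ha, hat, hc⟩ := ih1 hk hs (by omega)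
    obtain ⟨d, hd, hdt, he⟩ := ih2 (hpow t1 hk) hc (by simp only [Prog.constSum]; omega)
    refine ⟨_, .whileTrue hb ha hd, ?_, he.mono (by omega)⟩
    simp only [Test.cost_unitCost]
    have h1 := one_add_mul_opBits_le (Test.cost_bitCost_le hD hk hs (b := b) (by omega)) hat
      rfl rfl
    have h2 := sum_mul_opBits_le (a := 1 + b.size + t1) (b := t2)
      (k := k + (1 + b.size + t1) + 1) (l := k + t1 + t2 + 1)
      (j := k + (1 + b.size + t1 + t2) + 1) (by omega) (by omega)
    omega
  | whileFalse hb =>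
    rename_i b P s
    intro k hk hs hP
    simp only [Prog.constSum] at hP
    refine ⟨_, .whileFalse hb, ?_, hs.mono (by omega)⟩
    simp only [Test.cost_unitCost]
    exact one_add_mul_opBits_le (Test.cost_bitCost_le hD hk hs (by omega)) (b := 0) (y := 0)
      (by simp) rfl rfl

/-! ### Programs with bounded loops

The programs below are built from loops that are executed `M` times, where `M` is the entry `0` of
the array `3` of natural numbers. Such a program denotes a total function on memories, and its
uniform cost is bounded by a polynomial in `M` that can be read off from the program. -/

/-- Programs with bounded loops. `loop c P` executes `P` with the values `0, …, M - 1` of the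
counter that is stored at the entry `0` of the array `c` of natural numbers. -/
inductive LoopProg : Type
  | setNat (a : ℕ) (idx e : NatExp)
  | setVal (a : ℕ) (idx : NatExp) (e : ValExp)
  | seq (P Q : LoopProg)
  | when (b : Test) (P : LoopProg)
  | loop (c : ℕ) (P : LoopProg)

namespace LoopProg

/-- The while-program of a program with bounded loops. -/
def compile : LoopProg → Prog
  | .setNat a idx e => .setNat a idx e
  | .setVal a idx e => .setVal a idx e
  | .seq P Q => .seq P.compile Q.compile
  | .when b P => .ite b P.compile .skip
  | .loop c P => .seq (.setNat c (.const 0) (.const 0))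
      (.while (.not (.natLe (.read 3 (.const 0)) (.read c (.const 0))))
        (.seq P.compile (.setNat c (.const 0) (.add (.read c (.const 0)) (.const 1)))))

/-- The arrays of natural numbers that a program may write to. -/
def natWrites : LoopProg → List ℕ
  | .setNat a _ _ => [a]
  | .setVal _ _ _ => []
  | .seq P Q => P.natWrites ++ Q.natWrites
  | .when _ P => P.natWrites
  | .loop c P => c :: P.natWrites

/-- The arrays of elements of `R` that a program may write to. -/
def valWrites : LoopProg → List ℕ
  | .setNat _ _ _ => []
  | .setVal a _ _ => [a]
  | .seq P Q => P.valWrites ++ Q.valWrites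
  | .when _ P => P.valWrites
  | .loop _ P => P.valWrites

/-- No loop body writes to the counter of its loop, and nothing writes to the array `3`. -/
def WellFormed : LoopProg → Prop
  | .setNat a _ _ => a ≠ 3
  | .setVal _ _ _ => True
  | .seq P Q => P.WellFormed ∧ Q.WellFormed
  | .when _ P => P.WellFormed
  | .loop c P => c ≠ 3 ∧ c ∉ P.natWrites ∧ P.WellFormed

/-- A bound for the uniform cost, as a polynomial in the number of iterations of the loops. -/
noncomputable def costPoly : LoopProg → Polynomial ℕ
  | .setNat _ idx e => .C (1 + idx.size + e.size)
  | .setVal _ idx e => .C (1 + idx.size + e.size)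
  | .seq P Q => P.costPoly + Q.costPoly
  | .when b P => .C (2 + b.size) + P.costPoly
  | .loop _ P => .C 10 + .X * (P.costPoly + .C 13)

end LoopProg

/-! ### Memory after a write -/

section Reads

variable {R : Type} (s : Memory R)

@[simp] theorem Memory.setNat_val (a k x : ℕ) : (s.setNat a k x).val = s.val := rfl

@[simp] theorem Memory.setVal_nat (a k : ℕ) (x : R) : (s.setVal a k x).nat = s.nat := rfl

@[simp] theorem Memory.setNat_nat_apply (a k x b j : ℕ) :
    (s.setNat a k x).nat b j = if b = a ∧ j = k then x else s.nat b j := by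
  by_cases h : b = a
  · subst h; simp [Memory.setNat, Function.update_apply]
  · simp [Memory.setNat, h]

@[simp] theorem Memory.setVal_val_apply (a k : ℕ) (x : R) (b j : ℕ) :
    (s.setVal a k x).val b j = if b = a ∧ j = k then x else s.val b j := by
  by_cases h : b = a
  · subst h; simp [Memory.setVal, Function.update_apply]
  · simp [Memory.setVal, h]

theorem Memory.setNat_nat_of_ne {a b : ℕ} (k x : ℕ) (h : b ≠ a) :
    (s.setNat a k x).nat b = s.nat b := by
  simp [Memory.setNat, h]

theorem Memory.setVal_val_of_ne {a b : ℕ} (k : ℕ) (x : R) (h : b ≠ a) :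
    (s.setVal a k x).val b = s.val b := by
  simp [Memory.setVal, h]

end Reads

/-! ### Semantics and cost of bounded loops -/

namespace LoopProg

variable {R : Type} [Zero R] [Add R] [Sub R] [LE R]

/-- Increase the counter `c`. -/
def _root_.GraphFairDivision.Memory.incr (s : Memory R) (c : ℕ) : Memory R :=
  s.setNat c 0 (s.nat c 0 + 1)

open Classical in
/-- The memory after a run of a program with bounded loops. -/
noncomputable def run : LoopProg → Memory R → Memory R
  | .setNat a idx e, s => s.setNat a (idx.eval s) (e.eval s)
  | .setVal a idx e, s => s.setVal a (idx.eval s) (e.eval s)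
  | .seq P Q, s => Q.run (P.run s)
  | .when b P, s => if b.holds s then P.run s else s
  | .loop c P, s => (fun s' => (P.run s').incr c)^[s.nat 3 0] (s.setNat c 0 0)

/-- The frame rule. Together with `run_val_of_notMem` it carries the facts about untouched arrays
through the whole verification. -/
theorem run_nat_of_notMem {P : LoopProg} {a : ℕ} (h : a ∉ P.natWrites) (s : Memory R) :
    (P.run s).nat a = s.nat a := by
  induction P generalizing s with
  | setNat b idx e =>
    simp only [natWrites, List.mem_singleton] at h
    exact s.setNat_nat_of_ne _ _ h
  | setVal => rfl
  | seq P Q ihP ihQ =>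
    simp only [natWrites, List.mem_append, not_or] at h
    rw [run, ihQ h.2, ihP h.1]
  | when b P ih =>
    rw [run]
    split_ifs
    exacts [ih h s, rfl]
  | loop c P ih =>
    simp only [natWrites, List.mem_cons, not_or] at h
    have (k : ℕ) : ((fun s' => (P.run s').incr c)^[k] (s.setNat c 0 0)).nat a = s.nat a := by
      induction k with
      | zero => exact s.setNat_nat_of_ne _ _ h.1
      | succ k ihk =>
        rw [Function.iterate_succ_apply', Memory.incr, Memory.setNat_nat_of_ne _ _ _ h.1, ih h.2,
          ihk]
    exact this _

theorem run_val_of_notMem {P : LoopProg} {a : ℕ} (h : a ∉ P.valWrites) (s : Memory R) :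
    (P.run s).val a = s.val a := by
  induction P generalizing s with
  | setNat b idx e => rfl
  | setVal b idx e =>
    simp only [valWrites, List.mem_singleton] at h
    exact s.setVal_val_of_ne _ _ h
  | seq P Q ihP ihQ =>
    simp only [valWrites, List.mem_append, not_or] at h
    rw [run, ihQ h.2, ihP h.1]
  | when b P ih =>
    rw [run]
    split_ifs
    exacts [ih h s, rfl]
  | loop c P ih =>
    have (k : ℕ) : ((fun s' => (P.run s').incr c)^[k] (s.setNat c 0 0)).val a = s.val a := by
      induction k with
      | zero => rfl
      | succ k ihk => rw [Function.iterate_succ_apply', Memory.incr, Memory.setNat_val, ih h, ihk]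
    exact this _

theorem WellFormed.three_notMem {P : LoopProg} (h : P.WellFormed) : 3 ∉ P.natWrites := by
  induction P with
  | setNat a idx e => exact fun h' => h (List.mem_singleton.1 h').symm
  | setVal => simp [natWrites]
  | seq P Q ihP ihQ => simp [natWrites, ihP h.1, ihQ h.2]
  | when b P ih => exact ih h
  | loop c P ih => simp [natWrites, ih h.2.2, h.1.symm]

/-- A bounded loop establishes at its end what it establishes after each iteration. The invariant
may be combined with what is known about the arrays that the loop does not write to. -/
theorem loop_induction {c : ℕ} {P : LoopProg} {s : Memory R} (hP : (loop c P).WellFormed)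
    (I : ℕ → Memory R → Prop) (hI : ∀ k s' x, I k s' → I k (s'.setNat c 0 x))
    (zero : I 0 s)
    (succ : ∀ k s', k < s.nat 3 0 → (∀ a, a ∉ (loop c P).natWrites → s'.nat a = s.nat a) →
      (∀ a, a ∉ P.valWrites → s'.val a = s.val a) → s'.nat c 0 = k → I k s' → I (k + 1) (P.run s')) :
    I (s.nat 3 0) ((loop c P).run s) := by
  -- The frame facts and the value of the counter are proved along with the invariant, since `succ`
  -- may use them. `hI` is needed because the loop itself writes the counter, at its start and after
  -- each round.
  have (k : ℕ) (hk : k ≤ s.nat 3 0) :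
      (∀ a, a ∉ (loop c P).natWrites →
        ((fun s' => (P.run s').incr c)^[k] (s.setNat c 0 0)).nat a = s.nat a) ∧
      (∀ a, a ∉ P.valWrites →
        ((fun s' => (P.run s').incr c)^[k] (s.setNat c 0 0)).val a = s.val a) ∧
      ((fun s' => (P.run s').incr c)^[k] (s.setNat c 0 0)).nat c 0 = k ∧
      I k ((fun s' => (P.run s').incr c)^[k] (s.setNat c 0 0)) := by
    induction k with
    | zero =>
      refine ⟨fun a ha => ?_, fun a _ => rfl, by simp, hI _ _ _ zero⟩
      simp only [natWrites, List.mem_cons, not_or] at ha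
      exact s.setNat_nat_of_ne _ _ ha.1
    | succ k ih =>
      obtain ⟨h1, h2, h3, h4⟩ := ih (by omega)
      rw [Function.iterate_succ_apply', Memory.incr]
      refine ⟨fun a ha => ?_, fun a ha => ?_, ?_, hI _ _ _ (succ k _ hk h1 h2 h3 h4)⟩
      · have ha' := ha
        simp only [natWrites, List.mem_cons, not_or] at ha
        rw [Memory.setNat_nat_of_ne _ _ _ ha.1, run_nat_of_notMem ha.2, h1 a ha']
      · rw [Memory.setNat_val, run_val_of_notMem ha, h2 a ha]
      · simp [run_nat_of_notMem hP.2.1, h3]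
  exact (this _ le_rfl).2.2.2

/-- Nothing writes to the array `3`, and the body does not touch the counter, so the compiled
while-loop makes exactly `M` rounds. -/
theorem exec_compile {P : LoopProg} (hP : P.WellFormed) (s : Memory R) :
    ∃ t, Exec (unitCost R) P.compile s t (P.run s) ∧ t ≤ P.costPoly.eval (s.nat 3 0) := by
  induction P generalizing s with
  | setNat a idx e =>
    exact ⟨_, .setNat s a idx e, by simp [costPoly, NatExp.cost_unitCost]⟩
  | setVal a idx e =>
    exact ⟨_, .setVal s a idx e, by simp [costPoly, NatExp.cost_unitCost, ValExp.cost_unitCost]⟩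
  | seq P Q ihP ihQ =>
    obtain ⟨t, ht, ht'⟩ := ihP hP.1 s
    obtain ⟨r, hr, hr'⟩ := ihQ hP.2 (P.run s)
    rw [run_nat_of_notMem hP.1.three_notMem] at hr'
    exact ⟨_, .seq ht hr, by simp only [costPoly, Polynomial.eval_add]; omega⟩
  | when b P ih =>
    rw [run]
    split_ifs with hb
    · obtain ⟨t, ht, ht'⟩ := ih hP s
      refine ⟨_, .iteTrue hb ht, ?_⟩
      simp only [costPoly, Polynomial.eval_add, Polynomial.eval_C, Test.cost_unitCost]
      omega
    · refine ⟨_, .iteFalse hb (.skip s), ?_⟩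
      simp only [costPoly, Polynomial.eval_add, Polynomial.eval_C, Test.cost_unitCost]
      omega
  | loop c P ih =>
    obtain ⟨hc, hcP, hP⟩ := hP
    set M := s.nat 3 0 with hM
    -- `k` is the number of remaining rounds. Besides the body, a round costs `7` for the test and
    -- `6` for the increment; the final test costs `7` and the initial reset `3`. This gives the
    -- `13` and `10` of `costPoly`.
    have key (k : ℕ) : ∀ s' : Memory R, s'.nat 3 0 = M → s'.nat c 0 + k = M →
        ∃ t, Exec (unitCost R)
          (.while (.not (.natLe (.read 3 (.const 0)) (.read c (.const 0))))
            (.seq P.compile (.setNat c (.const 0) (.add (.read c (.const 0)) (.const 1))))) s' t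
            ((fun s' => (P.run s').incr c)^[k] s') ∧
          t ≤ 7 + k * (P.costPoly.eval M + 13) := by
      induction k with
      | zero =>
        intro s' h3 hk
        refine ⟨_, .whileFalse ?_, ?_⟩
        · simp [Test.holds, NatExp.eval, h3, ← hk]
        · simp [Test.cost_unitCost, Test.size, NatExp.size]
      | succ k ihk =>
        intro s' h3 hk
        obtain ⟨t, ht, ht'⟩ := ih hP s'
        have h3' : ((P.run s').incr c).nat 3 0 = M := by
          rw [Memory.incr, Memory.setNat_nat_of_ne _ _ _ hc.symm,
            run_nat_of_notMem hP.three_notMem, h3]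
        obtain ⟨r, hr, hr'⟩ := ihk ((P.run s').incr c) h3' (by
          simp only [Memory.incr, Memory.setNat_nat_apply, run_nat_of_notMem hcP]
          simp only [and_self, if_true]
          omega)
        refine ⟨_, .whileTrue ?_ (.seq ht (.setNat _ _ _ _)) hr, ?_⟩
        · simp only [Test.holds, NatExp.eval, h3]
          omega
        · rw [h3] at ht'
          simp only [Test.cost_unitCost, Test.size, NatExp.size, NatExp.cost_unitCost]
          have : (k + 1) * (P.costPoly.eval M + 13)
              = k * (P.costPoly.eval M + 13) + P.costPoly.eval M + 13 := by ring
          omega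
    obtain ⟨t, ht, ht'⟩ := key M (s.setNat c 0 0)
      (by rw [Memory.setNat_nat_of_ne _ _ _ hc.symm]) (by simp)
    refine ⟨_, .seq (.setNat _ _ _ _) ht, ?_⟩
    simp only [costPoly, NatExp.cost_unitCost, NatExp.size, Polynomial.eval_add, Polynomial.eval_C,
      Polynomial.eval_mul, Polynomial.eval_X]
    omega

end LoopProg

/-! ### Cutting a rooted tree

The vertices of the tree are numbered `1, …, m` such that the parent `par t` of `t` is smaller than
`t`; the number `0` stands for a virtual parent of the root, of weight `0`. The vertices are
processed in the order `m, …, 1`. A set `C` of cuts splits the tree: when `t` is processed, the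
weight that has been collected at `t` is either split off as a finished part, if `t` is in `C`, or
handed over to the parent of `t`. -/

section Cuts

variable {R : Type} [AddCommGroup R] [LinearOrder R] [IsOrderedAddMonoid R]

open Classical in
/-- The weight collected at `j` when the `k` last vertices have been processed. -/
noncomputable def collected (m : ℕ) (par : ℕ → ℕ) (w : ℕ → R) (C : ℕ → Prop) : ℕ → ℕ → R
  | 0, j => w j
  | k + 1, j =>
    if j = par (m - k) ∧ ¬ C (m - k) then
      collected m par w C k j + collected m par w C k (m - k)
    else collected m par w C k j

/-- The sum of `f` over the processed vertices below `j` when the `k` last vertices have been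
processed. -/
def below (m : ℕ) (par : ℕ → ℕ) (f : ℕ → ℕ) : ℕ → ℕ → ℕ
  | 0, _ => 0
  | k + 1, j =>
    if j = par (m - k) then below m par f k j + below m par f k (m - k) + f (m - k)
    else below m par f k j

open Classical in
/-- The vertex at which the weight of `i` is when the `k` last vertices have been processed. -/
noncomputable def location (m : ℕ) (par : ℕ → ℕ) (C : ℕ → Prop) : ℕ → ℕ → ℕ
  | 0, i => i
  | k + 1, i =>
    if location m par C k i = m - k ∧ ¬ C (m - k) then par (m - k) else location m par C k i

/-- The parent of a vertex is smaller than the vertex. -/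
def IsParent (m : ℕ) (par : ℕ → ℕ) : Prop :=
  ∀ t, 1 ≤ t → t ≤ m → par t < t

variable {m : ℕ} {par : ℕ → ℕ} {w : ℕ → R} {C : ℕ → Prop}

omit [LinearOrder R] [IsOrderedAddMonoid R] in
-- After `m - t` steps all vertices with numbers larger than `t` have been processed. The later
-- steps send weight only to parents of vertices numbered at most `t`, and these parents are smaller
-- than `t`.
theorem collected_eq_of_le (hpar : IsParent m par) {k t : ℕ} (ht : t ≤ m) (hk : m - t ≤ k)
    (hkm : k ≤ m) : collected m par w C k t = collected m par w C m t := by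
  have (d : ℕ) (hd : m - t + d ≤ m) :
      collected m par w C (m - t + d) t = collected m par w C (m - t) t := by
    induction d with
    | zero => rfl
    | succ d ih =>
      have := hpar (m - (m - t + d)) (by omega) (by omega)
      rw [← add_assoc, collected, if_neg (by omega), ih (by omega)]
  obtain ⟨d, rfl⟩ := Nat.exists_eq_add_of_le hk
  obtain ⟨e, he⟩ := Nat.exists_eq_add_of_le (show m - t ≤ m by omega)
  have h2 := this e he.symm.le
  rw [← he] at h2
  rw [this d hkm, h2]

/-- The value of a processed vertex has been passed on to exactly one number that is not yet
processed, possibly the virtual `0`. -/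
theorem sum_below (hpar : IsParent m par) (f : ℕ → ℕ) {k : ℕ} (hk : k ≤ m) :
    ∑ j ∈ Finset.range (m - k + 1), below m par f k j = ∑ t ∈ Finset.Ioc (m - k) m, f t := by
  induction k with
  | zero => simp [below]
  | succ k ih =>
    have hp := hpar (m - k) (by omega) (by omega)
    have h1 : m - k = m - (k + 1) + 1 := by omega
    have h2 : Finset.Ioc (m - (k + 1)) m = insert (m - k) (Finset.Ioc (m - k) m) := by
      ext x; simp only [Finset.mem_Ioc, Finset.mem_insert]; omega
    rw [h2, Finset.sum_insert (by simp), ← ih (by omega), Finset.sum_range_succ _ (m - k), ← h1]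
    have h3 : ∀ j, below m par f (k + 1) j = below m par f k j +
        if j = par (m - k) then below m par f k (m - k) + f (m - k) else 0 := by
      intro j
      rw [below]
      split_ifs <;> omega
    simp only [h3, Finset.sum_add_distrib]
    rw [Finset.sum_ite_eq', if_pos (Finset.mem_range.2 hp)]
    omega

theorem below_root (hpar : IsParent m par) (f : ℕ → ℕ) :
    below m par f m 0 = ∑ t ∈ Finset.Icc 1 m, f t := by
  have := sum_below hpar f le_rfl
  rw [Nat.sub_self, Finset.sum_range_succ, Finset.sum_range_zero, zero_add] at this
  rw [this]
  rfl

theorem location_of_mem {i : ℕ} (hi : C i) (k : ℕ) : location m par C k i = i := by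
  induction k with
  | zero => rfl
  | succ k ih =>
    rw [location, ih, if_neg]
    rintro ⟨rfl, h⟩
    exact h hi

theorem location_of_le {i k : ℕ} (hk : k ≤ m) (hi : i ≤ m - k) :
    location m par C k i = i := by
  induction k with
  | zero => rfl
  | succ k ih => rw [location, ih (by omega) (by omega), if_neg (by omega)]

/-- An uncut vertex hands its weight to its parent when it is processed; from then on the two
weights travel together. -/
theorem location_of_notMem (hpar : IsParent m par) {i k : ℕ} (hk : k ≤ m) (hi : m - k < i)
    (him : i ≤ m) (hC : ¬ C i) : location m par C k i = location m par C k (par i) := by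
  induction k with
  | zero => omega
  | succ k ih =>
    rcases eq_or_ne i (m - k) with rfl | hne
    · have := hpar (m - k) (by omega) him
      rw [location, location_of_le (by omega) le_rfl, if_pos ⟨rfl, hC⟩, location,
        location_of_le (by omega) this.le, if_neg (by omega)]
    · rw [location, location, ih (by omega) (by omega)]

omit [LinearOrder R] [IsOrderedAddMonoid R] in
-- `collected` moves weights in bulk, `location` one vertex at a time. The restriction on `j`
-- excludes vertices processed without a cut: their entry in `collected` is not erased when it is
-- handed on.
theorem collected_eq_sum (hpar : IsParent m par) {k j : ℕ} (hk : k ≤ m)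
    (hj : j ≤ m - k ∨ C j) (hjm : j ≤ m) :
    collected m par w C k j =
      ∑ i ∈ Finset.range (m + 1), if location m par C k i = j then w i else 0 := by
  induction k generalizing j with
  | zero =>
    change w j = ∑ i ∈ Finset.range (m + 1), if i = j then w i else 0
    rw [Finset.sum_ite_eq', if_pos (Finset.mem_range.2 (by omega))]
  | succ k ih =>
    have hp := hpar (m - k) (by omega) (by omega)
    by_cases hC : C (m - k)
    · simp only [collected, location, hC, not_true_eq_false, and_false, if_false]
      exact ih (by omega) (hj.imp_left (by omega)) hjm
    · have hj' : j ≤ m - (k + 1) ∨ C j ∧ j ≠ m - k :=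
        hj.imp_right fun h => ⟨h, fun h' => hC (h' ▸ h)⟩
      have hjne : j ≠ m - k := hj'.elim (by omega) And.right
      rw [collected]
      simp only [location, hC, not_false_eq_true, and_true]
      rw [ih (by omega) (hj.imp_left (by omega)) hjm,
        ih (by omega) (Or.inl le_rfl) (by omega), ← Finset.sum_add_distrib]
      split_ifs with hjp
      · refine Finset.sum_congr rfl fun i _ => ?_
        by_cases h1 : location m par C k i = m - k
        · simp [h1, hjp, hp.ne']
        · simp [h1]
      · refine Finset.sum_congr rfl fun i _ => ?_
        by_cases h1 : location m par C k i = m - k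
        · simp [h1, Ne.symm hjne, Ne.symm hjp]
        · simp [h1]

end Cuts

/-! ### The tables of the dynamic program -/

section Table

variable {R : Type} [AddCommGroup R] [LinearOrder R] [IsOrderedAddMonoid R]

/-- The lexicographic order on pairs of a number of finished parts and a collected weight. -/
def LexLe (a b : ℕ × R) : Prop :=
  a.1 < b.1 ∨ a.1 = b.1 ∧ a.2 ≤ b.2

/-- A collected weight `r` is split off if it exceeds `μ`, and also if it equals `μ` and
`y = 1` losers are admitted. -/
def CutTest (μ : R) (y : ℕ) (r : R) : Prop :=
  μ < r ∨ y = 1 ∧ μ ≤ r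

open Classical in
/-- The state of a vertex with state `e` after it has taken over a child with state `f`. -/
noncomputable def merge (μ : R) (y : ℕ) (e f : ℕ × R) : ℕ × R :=
  if CutTest μ y f.2 then (e.1 + f.1 + 1, e.2) else (e.1 + f.1, e.2 + f.2)

/-- `g k j l` is the lexicographically largest pair of a number of finished parts of weight at
least `μ` below `j` and a weight collected at `j`, when the `k` last vertices have been processed and
at most `l` of the finished parts are losers, parts of weight `μ`. The maximum is attained when the
child `t` has `X t l` losers below it, `Y t l` losers are split off at `t`, and `t` is cut if and only
if `K t l = 1`. -/
structure IsTable (m : ℕ) (par : ℕ → ℕ) (w : ℕ → R) (μ : R) (L : ℕ) (g : ℕ → ℕ → ℕ → ℕ × R)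
    (X Y K : ℕ → ℕ → ℕ) : Prop where
  init : ∀ j, j ≤ m → ∀ l < L, g 0 j l = (0, w j)
  frame : ∀ k, k < m → ∀ j, j ≤ m → j ≠ par (m - k) → ∀ l < L, g (k + 1) j l = g k j l
  le : ∀ k, k < m → ∀ l < L, X (m - k) l + Y (m - k) l ≤ l
  attained : ∀ k, k < m → ∀ l < L, g (k + 1) (par (m - k)) l =
    merge μ (Y (m - k) l) (g k (par (m - k)) (l - X (m - k) l - Y (m - k) l))
      (g k (m - k) (X (m - k) l))
  cut : ∀ k, k < m → ∀ l < L,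
    (K (m - k) l = 1 ↔ CutTest μ (Y (m - k) l) (g k (m - k) (X (m - k) l)).2)
  dominates : ∀ k, k < m → ∀ l < L, ∀ x y, y ≤ 1 → x + y ≤ l →
    LexLe (merge μ y (g k (par (m - k)) (l - x - y)) (g k (m - k) x)) (g (k + 1) (par (m - k)) l)

omit [AddCommGroup R] [IsOrderedAddMonoid R] in
theorem LexLe.refl (a : ℕ × R) : LexLe a a := Or.inr ⟨rfl, le_rfl⟩

omit [AddCommGroup R] [IsOrderedAddMonoid R] in
theorem LexLe.trans {a b c : ℕ × R} (h : LexLe a b) (h' : LexLe b c) : LexLe a c := by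
  unfold LexLe at *
  rcases h with h | h <;> rcases h' with h' | h'
  · left; omega
  · left; omega
  · left; omega
  · exact Or.inr ⟨by omega, h.2.trans h'.2⟩

omit [AddCommGroup R] [IsOrderedAddMonoid R] in
theorem LexLe.total (a b : ℕ × R) : LexLe a b ∨ LexLe b a := by
  unfold LexLe
  rcases lt_trichotomy a.1 b.1 with h | h | h
  · exact Or.inl (Or.inl h)
  · exact (le_total a.2 b.2).imp (fun h' => Or.inr ⟨h, h'⟩) (fun h' => Or.inr ⟨h.symm, h'⟩)
  · exact Or.inr (Or.inl h)

omit [AddCommGroup R] [IsOrderedAddMonoid R] in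
theorem LexLe.fst_le {a b : ℕ × R} (h : LexLe a b) : a.1 ≤ b.1 := by
  rcases h with h | h <;> omega

/-- This is why the lexicographic maximum suffices. The one dangerous case is a child that is split
off for `f` but not for `f'`. Then `f'.2 < f.2`, so `f'` has at least one finished part more, which
makes up for the missing cut, and its collected weight, being nonnegative, does no harm. -/
theorem merge_lexLe_merge {μ : R} {y : ℕ} {e f e' f' : ℕ × R} (he : LexLe e e') (hf : LexLe f f')
    (hf' : 0 ≤ f'.2) : LexLe (merge μ y e f) (merge μ y e' f') := by
  obtain ⟨e1, e2⟩ := e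
  obtain ⟨f1, f2⟩ := f
  obtain ⟨e1', e2'⟩ := e'
  obtain ⟨f1', f2'⟩ := f'
  unfold LexLe at *
  simp only at he hf hf'
  have hcut : f2 ≤ f2' → CutTest μ y f2 → CutTest μ y f2' := fun h h' =>
    h'.imp (fun h1 => h1.trans_le h) (fun h1 => ⟨h1.1, h1.2.trans h⟩)
  unfold merge
  simp only
  split_ifs with h1 h2 h2
  · rcases he with he | he <;> rcases hf with hf | hf
    · left; simp only; omega
    · left; simp only; omega
    · left; simp only; omega
    · exact Or.inr ⟨by simp only; omega, he.2⟩
  · rcases hf with hf | hf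
    · rcases he with he | he
      · left; simp only; omega
      · rcases Nat.lt_or_ge (f1 + 1) f1' with h | h
        · left; simp only; omega
        · exact Or.inr ⟨by simp only; omega, by simpa using add_le_add he.2 hf'⟩
    · exact absurd (hcut hf.2 h1) h2
  · left; simp only
    rcases he with he | he <;> rcases hf with hf | hf <;> omega
  · rcases he with he | he <;> rcases hf with hf | hf
    · left; simp only; omega
    · left; simp only; omega
    · left; simp only; omega
    · exact Or.inr ⟨by simp only; omega, add_le_add he.2 hf.2⟩

variable {m : ℕ} {par : ℕ → ℕ} {w : ℕ → R} {μ : R} {L : ℕ} {g : ℕ → ℕ → ℕ → ℕ × R}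
  {X Y K : ℕ → ℕ → ℕ} {C : ℕ → Prop}

theorem IsTable.nonneg (hg : IsTable m par w μ L g X Y K) (hpar : IsParent m par)
    (hw : ∀ i, 0 ≤ w i) {k : ℕ} (hk : k ≤ m) {j l : ℕ} (hj : j ≤ m) (hl : l < L) :
    0 ≤ (g k j l).2 := by
  induction k generalizing j l with
  | zero => rw [hg.init j hj l hl]; exact hw j
  | succ k ih =>
    by_cases hjp : j = par (m - k)
    · have hp := hpar (m - k) (by omega) (by omega)
      have hle := hg.le k hk l hl
      rw [hjp, hg.attained k hk l hl, merge]
      split_ifs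
      · exact ih (by omega) (by omega) (by omega)
      · exact add_nonneg (ih (by omega) (by omega) (by omega)) (ih (by omega) (by omega) (by omega))
    · rw [hg.frame k hk j hj hjp l hl]
      exact ih (by omega) hj hl

open Classical in
/-- The indicator function of a set. -/
noncomputable def indic (C : ℕ → Prop) (t : ℕ) : ℕ := if C t then 1 else 0

/-- The cuts that split off a loser, a part of weight at most `μ`. -/
def LoserCut (m : ℕ) (par : ℕ → ℕ) (w : ℕ → R) (μ : R) (C : ℕ → Prop) (t : ℕ) : Prop :=
  C t ∧ ¬ μ < collected m par w C m t

/-- Optimality of the table, by induction over the steps: the budget is split the way `C` spends it,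
merging is monotone, and the table dominates all splits. By `hC` every cut of `C` passes `CutTest`
once its loser, if it is one, is paid for. -/
theorem IsTable.lexLe (hg : IsTable m par w μ L g X Y K) (hpar : IsParent m par)
    (hw : ∀ i, 0 ≤ w i) (hC : ∀ t, 1 ≤ t → t ≤ m → C t → μ ≤ collected m par w C m t)
    {k : ℕ} (hk : k ≤ m) {j l : ℕ} (hj : j ≤ m - k) (hl : l < L)
    (hjl : below m par (indic (LoserCut m par w μ C)) k j ≤ l) :
    LexLe (below m par (indic C) k j, collected m par w C k j) (g k j l) := by
  induction k generalizing j l with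
  | zero => rw [hg.init j hj l hl]; exact LexLe.refl _
  | succ k ih =>
    have hp := hpar (m - k) (by omega) (by omega)
    by_cases hjp : j = par (m - k)
    · subst hjp
      set y := indic (LoserCut m par w μ C) (m - k) with hy
      have hy1 : y ≤ 1 := by rw [hy, indic]; split_ifs <;> omega
      simp only [below, if_true] at hjl
      set a := below m par (indic (LoserCut m par w μ C)) k (par (m - k))
      set b := below m par (indic (LoserCut m par w μ C)) k (m - k)
      have h1 := ih (j := par (m - k)) (l := a) (by omega) (by omega) (by omega) le_rfl
      -- The parent gets exactly the `a` losers below it and the child all the rest. So the whole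
      -- budget `l` is used, and no monotonicity of the table in the budget is needed.
      have h2 := ih (j := m - k) (l := l - a - y) (by omega) le_rfl (by omega) (by omega)
      have h3 := hg.dominates k hk l hl (l - a - y) y hy1 (by omega)
      rw [show l - (l - a - y) - y = a by omega] at h3
      refine LexLe.trans (LexLe.trans ?_ (merge_lexLe_merge (μ := μ) (y := y) h1 h2
        (hg.nonneg hpar hw (by omega) (by omega) (by omega)))) h3
      have hc := collected_eq_of_le (w := w) (C := C) hpar (t := m - k) (k := k) (by omega)
        (by omega) (by omega)
      by_cases hCt : C (m - k)
      · have : CutTest μ y (collected m par w C k (m - k)) := by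
          by_cases h : μ < collected m par w C k (m - k)
          · exact Or.inl h
          · refine Or.inr ⟨?_, ?_⟩
            · rw [hy, indic, if_pos ⟨hCt, by rwa [← hc]⟩]
            · rw [hc]; exact hC _ (by omega) (by omega) hCt
        simp only [merge, this, if_true]
        simp only [below, collected, hCt, if_true, not_true_eq_false, and_false, if_false,
          indic]
        exact LexLe.refl _
      · have hcoll : collected m par w C (k + 1) (par (m - k)) =
            collected m par w C k (par (m - k)) + collected m par w C k (m - k) := by
          simp [collected, hCt]
        have hbel : below m par (indic C) (k + 1) (par (m - k)) =
            below m par (indic C) k (par (m - k)) + below m par (indic C) k (m - k) := by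
          simp [below, hCt, indic]
        rw [hcoll, hbel, merge]
        -- `C` does not cut here. If `merge` does, it gains a finished part and is strictly better.
        split_ifs
        · exact Or.inl (by simp only; omega)
        · exact LexLe.refl _
    · rw [hg.frame k hk j (by omega) hjp l hl]
      rw [below, if_neg hjp] at hjl
      have := ih (by omega) (by omega) hl hjl
      simpa [below, collected, hjp] using this

/-- `rem k j` is the number of losers that are admitted below `j` in the state after `k` steps, and
`C` is the set of cuts, if one follows the table back from its last state. -/
structure IsTraceback (m : ℕ) (par : ℕ → ℕ) (L : ℕ) (X Y K : ℕ → ℕ → ℕ) (rem : ℕ → ℕ → ℕ)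
    (C : ℕ → Prop) : Prop where
  lt : rem m 0 < L
  child : ∀ k, k < m → rem k (m - k) = X (m - k) (rem (k + 1) (par (m - k)))
  parent : ∀ k, k < m → rem k (par (m - k)) = rem (k + 1) (par (m - k)) -
    X (m - k) (rem (k + 1) (par (m - k))) - Y (m - k) (rem (k + 1) (par (m - k)))
  other : ∀ k, k < m → ∀ j, j < m - k → j ≠ par (m - k) → rem k j = rem (k + 1) j
  cut : ∀ k, k < m → (C (m - k) ↔ K (m - k) (rem (k + 1) (par (m - k))) = 1)

omit [IsOrderedAddMonoid R] in
theorem IsTraceback.rem_lt {rem : ℕ → ℕ → ℕ} (hg : IsTable m par w μ L g X Y K)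
    (h : IsTraceback m par L X Y K rem C) (hpar : IsParent m par) {k : ℕ} (hk : k ≤ m) {j : ℕ}
    (hj : j ≤ m - k) : rem k j < L := by
  obtain ⟨d, rfl⟩ := Nat.exists_eq_add_of_le hk
  -- Backwards in time: `e` is the number of vertices that are not yet processed.
  have (e : ℕ) (he : e ≤ k + d) : ∀ j, j ≤ e → rem (k + d - e) j < L := by
    induction e with
    | zero =>
      intro j hj
      obtain rfl : j = 0 := by omega
      exact h.lt
    | succ e ih =>
      intro j hj
      have hk' : k + d - (e + 1) < k + d := by omega
      have h1 := h.child _ hk'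
      have h2 := h.parent _ hk'
      have h3 := h.other _ hk' j
      rw [show k + d - (k + d - (e + 1)) = e + 1 by omega,
        show k + d - (e + 1) + 1 = k + d - e by omega] at h1 h2 h3
      have hp := hpar (e + 1) (by omega) (by omega)
      have h4 := ih (by omega) (par (e + 1)) (by omega)
      have h5 := hg.le _ hk' _ h4
      rw [show k + d - (k + d - (e + 1)) = e + 1 by omega] at h5
      by_cases hje : j = e + 1
      · subst hje
        omega
      · by_cases hjp : j = par (e + 1)
        · subst hjp
          omega
        · rw [h3 (by omega) hjp]
          exact ih (by omega) j (by omega)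
  have := this d (by omega) j (by omega)
  rwa [show k + d - d = k by omega] at this

omit [IsOrderedAddMonoid R] in
-- The counterpart of `IsTable.lexLe`: the traced cuts attain the entries. A cut made with `Y = 0`
-- has weight strictly above `μ`, so every loser cut is paid for by the budget.
theorem IsTraceback.eq_table {rem : ℕ → ℕ → ℕ} (hg : IsTable m par w μ L g X Y K)
    (h : IsTraceback m par L X Y K rem C) (hpar : IsParent m par) {k : ℕ} (hk : k ≤ m) {j : ℕ}
    (hj : j ≤ m - k) :
    g k j (rem k j) = (below m par (indic C) k j, collected m par w C k j) ∧
      below m par (indic (LoserCut m par w μ C)) k j ≤ rem k j := by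
  induction k generalizing j with
  | zero => exact ⟨hg.init j (by omega) _ (h.rem_lt hg hpar (by omega) hj), Nat.zero_le _⟩
  | succ k ih =>
    have hp := hpar (m - k) (by omega) (by omega)
    have hlt := h.rem_lt hg hpar hk hj
    by_cases hjp : j = par (m - k)
    · subst hjp
      have hle := hg.le k hk _ hlt
      have hatt := hg.attained k hk _ hlt
      have hcut := hg.cut k hk _ hlt
      rw [← h.cut k hk] at hcut
      rw [← h.parent k hk, ← h.child k hk] at hatt
      rw [← h.child k hk] at hcut
      obtain ⟨h1, h1'⟩ := ih (j := par (m - k)) (by omega) (by omega)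
      obtain ⟨h2, h2'⟩ := ih (j := m - k) (by omega) le_rfl
      rw [h2] at hcut
      rw [hatt, h1, h2, merge]
      simp only at hcut ⊢
      rw [h.parent k hk] at h1'
      rw [h.child k hk] at h2'
      have hc := collected_eq_of_le (w := w) (C := C) hpar (t := m - k) (k := k) (by omega)
        (by omega) (by omega)
      have hind : indic (LoserCut m par w μ C) (m - k) ≤
          Y (m - k) (rem (k + 1) (par (m - k))) := by
        rw [indic]
        split_ifs with h3
        · rcases hcut.1 h3.1 with h4 | h4
          · exact absurd h4 (hc ▸ h3.2)
          · omega
        · omega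
      refine ⟨?_, ?_⟩
      · by_cases hCt : C (m - k)
        · rw [if_pos (hcut.1 hCt)]
          simp [below, collected, indic, hCt]
        · rw [if_neg (fun h' => hCt (hcut.2 h'))]
          simp [below, collected, indic, hCt]
      · simp only [below, if_true]
        omega
    · obtain ⟨h1, h2⟩ := ih (j := j) (by omega) (by omega)
      rw [hg.frame k hk j (by omega) hjp _ hlt, ← h.other k hk j (by omega) hjp, h1]
      simpa [below, collected, hjp] using h2

omit [IsOrderedAddMonoid R] in
-- A traced cut has passed `CutTest`, both alternatives of which give at least `μ`, and the weight
-- at a vertex is final when the vertex is processed.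
theorem IsTraceback.le_collected {rem : ℕ → ℕ → ℕ} (hg : IsTable m par w μ L g X Y K)
    (h : IsTraceback m par L X Y K rem C) (hpar : IsParent m par) {t : ℕ} (ht : 1 ≤ t)
    (htm : t ≤ m) (hC : C t) : μ ≤ collected m par w C m t := by
  obtain ⟨k, hk, rfl⟩ : ∃ k, k < m ∧ t = m - k := ⟨m - t, by omega, by omega⟩
  have hp := hpar (m - k) (by omega) (by omega)
  have hlt := h.rem_lt hg hpar hk (j := par (m - k)) (by omega)
  have hcut := (hg.cut k hk _ hlt).1 ((h.cut k hk).1 hC)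
  rw [← h.child k hk, (h.eq_table hg hpar (by omega) le_rfl).1] at hcut
  rw [← collected_eq_of_le hpar htm (k := k) (by omega) (by omega)]
  rcases hcut with h | h
  exacts [h.le, h.2]

end Table

/-! ### Cuts and connected allocations -/

section Allocation

/-- The vertices of the tree `G` are numbered `1, …, m`, the neighbours of a vertex are its parent
and its children, and the vertex `1` is the root. -/
structure IsRooting {m : ℕ} (G : SimpleGraph (Fin m)) (pos : Fin m → ℕ) (par : ℕ → ℕ) : Prop where
  inj : Function.Injective pos
  one_le : ∀ v, 1 ≤ pos v
  le : ∀ v, pos v ≤ m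
  isParent : IsParent m par
  par_pos : ∀ t, 2 ≤ t → t ≤ m → 1 ≤ par t
  adj_iff : ∀ v w, G.Adj v w ↔ par (pos v) = pos w ∨ par (pos w) = pos v

theorem exists_pos_eq {m : ℕ} {pos : Fin m → ℕ} (inj : Function.Injective pos)
    (one_le : ∀ v, 1 ≤ pos v) (le : ∀ v, pos v ≤ m) {t : ℕ} (ht : 1 ≤ t) (htm : t ≤ m) :
    ∃ v, pos v = t := by
  have h : Finset.univ.image pos = Finset.Icc 1 m := by
    refine Finset.eq_of_subset_of_card_le (fun t ht => ?_) ?_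
    · obtain ⟨v, -, rfl⟩ := Finset.mem_image.1 ht
      exact Finset.mem_Icc.2 ⟨one_le v, le v⟩
    · simp [Finset.card_image_of_injective _ inj]
  have : t ∈ Finset.univ.image pos := h ▸ Finset.mem_Icc.2 ⟨ht, htm⟩
  obtain ⟨v, -, hv⟩ := Finset.mem_image.1 this
  exact ⟨v, hv⟩

/-- A tree has no other edges than those between children and parents. -/
theorem IsRooting.of_isTree {m : ℕ} {G : SimpleGraph (Fin m)} (hG : G.IsTree) {pos : Fin m → ℕ}
    {par : ℕ → ℕ} (inj : Function.Injective pos) (one_le : ∀ v, 1 ≤ pos v) (le : ∀ v, pos v ≤ m)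
    (isParent : IsParent m par) (par_pos : ∀ t, 2 ≤ t → t ≤ m → 1 ≤ par t)
    (adj : ∀ v w, par (pos v) = pos w → G.Adj v w) : IsRooting G pos par := by
  classical
  refine ⟨inj, one_le, le, isParent, par_pos, fun v w => ⟨fun hvw => ?_, ?_⟩⟩
  · have hpar : ∀ v : {v : Fin m // 2 ≤ pos v}, ∃ w, pos w = par (pos v) := fun v =>
      exists_pos_eq inj one_le le (par_pos _ v.2 (le _))
        ((isParent _ (one_le _) (le _)).le.trans (le _))
    choose f hf using hpar
    -- Each vertex except the root contributes the edge to its parent. Two vertices with the same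
    -- edge would be parents of each other, although parents have smaller numbers. A tree has only
    -- `m - 1` edges, so these are all of them.
    have hinj : Function.Injective fun v : {v : Fin m // 2 ≤ pos v} => s(v.1, f v) := by
      intro v v' h
      rcases Sym2.eq_iff.1 h with ⟨h, -⟩ | ⟨h, h'⟩
      · exact Subtype.ext h
      · have h1 := isParent _ (one_le v) (le _)
        have h2 := isParent _ (one_le v') (le _)
        rw [← hf] at h1 h2
        rw [h'] at h1
        rw [← h] at h2
        omega
    have hcard : m ≤ Fintype.card {v : Fin m // 2 ≤ pos v} + 1 := by
      have h1 : Fintype.card {v : Fin m // ¬ 2 ≤ pos v} ≤ 1 := by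
        refine Fintype.card_le_one_iff.2 fun a b => Subtype.ext (inj ?_)
        have := one_le a
        have := one_le b
        have := a.2
        have := b.2
        omega
      have h2 := Fintype.card_subtype_compl fun v : Fin m => 2 ≤ pos v
      rw [Fintype.card_fin] at h2
      omega
    have hedge : Finset.univ.image (fun v : {v : Fin m // 2 ≤ pos v} => s(v.1, f v)) =
        G.edgeFinset := by
      refine Finset.eq_of_subset_of_card_le (fun e he => ?_) ?_
      · obtain ⟨v, -, rfl⟩ := Finset.mem_image.1 he
        rw [SimpleGraph.mem_edgeFinset, SimpleGraph.mem_edgeSet]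
        exact adj _ _ (hf v).symm
      · have := hG.card_edgeFinset
        rw [Fintype.card_fin] at this
        rw [Finset.card_image_of_injective _ hinj, Finset.card_univ]
        omega
    have : s(v, w) ∈ G.edgeFinset := by simpa using hvw
    rw [← hedge] at this
    obtain ⟨x, -, hx⟩ := Finset.mem_image.1 this
    rcases Sym2.eq_iff.1 hx with ⟨h, h'⟩ | ⟨h, h'⟩
    · left; rw [← h, ← h', hf]
    · right; rw [← h, ← h', hf]
  · rintro (h | h)
    exacts [adj _ _ h, (adj _ _ h).symm]

theorem sum_indic (m : ℕ) (C : ℕ → Prop) [DecidablePred C] :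
    ∑ t ∈ Finset.Icc 1 m, indic C t = ((Finset.Icc 1 m).filter C).card := by
  rw [Finset.card_filter]
  refine Finset.sum_congr rfl fun t _ => ?_
  unfold indic
  split_ifs <;> rfl

variable {R : Type} [AddCommGroup R] [LinearOrder R] [IsOrderedAddMonoid R]
  {m n : ℕ} {G : SimpleGraph (Fin m)} {pos : Fin m → ℕ} {par : ℕ → ℕ} {u : Finset (Fin m) → R}
  {w : ℕ → R} {C : ℕ → Prop}

/-- The weights of the numbered vertices are the values of the additive function `u`. -/
structure IsWeight (pos : Fin m → ℕ) (u : Finset (Fin m) → R) (w : ℕ → R) : Prop where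
  isAdditive : IsAdditive u
  utility_nonneg : ∀ X, 0 ≤ u X
  eq : ∀ v, w (pos v) = u {v}
  nonneg : ∀ i, 0 ≤ w i

omit [IsOrderedAddMonoid R] in
theorem IsWeight.eq_sum (hw : IsWeight pos u w) (hr : IsRooting G pos par) (X : Finset (Fin m)) :
    u X = ∑ t ∈ X.image pos, w t := by
  rw [hw.isAdditive X, Finset.sum_image hr.inj.injOn]
  exact Finset.sum_congr rfl fun v _ => (hw.eq v).symm

/-- The cuts of an allocation are at the vertices that are not in the bundle of their parent; no
cuts are made for bundles without value. -/
def allocationCuts (pos : Fin m → ℕ) (par : ℕ → ℕ) (u : Finset (Fin m) → R)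
    (B : Fin n → Finset (Fin m)) (t : ℕ) : Prop :=
  ∃ i, 0 < u (B i) ∧ ∃ v ∈ B i, pos v = t ∧ ∀ x ∈ B i, pos x ≠ par t

section OfAllocation

variable {B : Fin n → Finset (Fin m)} (hr : IsRooting G pos par) (hB : IsConnectedAllocation G B)
include hr hB

omit [IsOrderedAddMonoid R] in
-- By disjointness, a cut at a vertex of the bundle stems from this bundle, and then the parent lies
-- outside it. So no edge inside the bundle is cut, and along a walk in the bundle the location does
-- not change.
theorem location_eq_of_mem {i : Fin n} {v x : Fin m} (hv : v ∈ B i) (hx : x ∈ B i) :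
    location m par (allocationCuts pos par u B) m (pos v) =
      location m par (allocationCuts pos par u B) m (pos x) := by
  have key : ∀ v x, v ∈ B i → x ∈ B i → par (pos v) = pos x →
      location m par (allocationCuts pos par u B) m (pos v) =
        location m par (allocationCuts pos par u B) m (pos x) := by
    intro v x hv hx h
    have := hr.one_le v
    rw [location_of_notMem hr.isParent le_rfl (by omega) (hr.le v), h]
    rintro ⟨j, -, y, hy, hyv, hy'⟩
    obtain rfl := hr.inj hyv
    obtain rfl : i = j := by
      by_contra hij
      exact Finset.disjoint_left.1 (hB.2.1 i j hij) hv hy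
    exact hy' x hx h.symm
  obtain ⟨p⟩ := hB.2.2 i ⟨v, hv⟩ ⟨x, hx⟩
  have (a b : (B i : Set (Fin m))) (p : (G.induce (B i : Set (Fin m))).Walk a b) :
      location m par (allocationCuts pos par u B) m (pos a) =
        location m par (allocationCuts pos par u B) m (pos b) := by
    induction p with
    | nil => rfl
    | cons h _ ih =>
      rename_i a b c _
      rw [← ih]
      rcases (hr.adj_iff _ _).1 (SimpleGraph.induce_adj.1 h) with h | h
      exacts [key _ _ a.2 b.2 h, (key _ _ b.2 a.2 h).symm]
  exact this _ _ p

omit hB [IsOrderedAddMonoid R] in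
-- The vertex with the smallest number is in the bundle while its parent is not.
theorem exists_allocationCuts {i : Fin n} (hi : 0 < u (B i)) (hw : IsWeight pos u w) :
    ∃ v ∈ B i, allocationCuts pos par u B (pos v) := by
  have hne : (B i).Nonempty := by
    rw [Finset.nonempty_iff_ne_empty]
    intro h
    rw [h, hw.isAdditive] at hi
    simp at hi
  obtain ⟨v, hv, hmin⟩ := (B i).exists_min_image pos hne
  refine ⟨v, hv, i, hi, v, hv, rfl, fun x hx h => ?_⟩
  have := hmin x hx
  have := hr.isParent _ (hr.one_le v) (hr.le v)
  omega

/-- The whole bundle ends up at its cut vertex. Vertices of worthless bundles, which are not cut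
off, may end up there too, so only a lower bound is claimed. -/
theorem le_collected_allocationCuts (hw : IsWeight pos u w) {i : Fin n} {v : Fin m} (hv : v ∈ B i)
    (hC : allocationCuts pos par u B (pos v)) :
    u (B i) ≤ collected m par w (allocationCuts pos par u B) m (pos v) := by
  rw [collected_eq_sum hr.isParent le_rfl (Or.inr hC) (hr.le v), hw.eq_sum hr, ← Finset.sum_filter]
  refine Finset.sum_le_sum_of_subset_of_nonneg (fun t ht => ?_) fun t _ _ => hw.nonneg t
  obtain ⟨x, hx, rfl⟩ := Finset.mem_image.1 ht
  have := hr.le x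
  rw [Finset.mem_filter, Finset.mem_range]
  exact ⟨by omega, by rw [location_eq_of_mem hr hB hx hv, location_of_mem hC]⟩

/-- The table bounds the number of the bundles of positive value in an allocation. -/
theorem IsTable.card_le {μ : R} {L l : ℕ} {g : ℕ → ℕ → ℕ → ℕ × R} {X Y K : ℕ → ℕ → ℕ}
    (hg : IsTable m par w μ L g X Y K) (hw : IsWeight pos u w)
    (hμ : ∀ i, 0 < u (B i) → μ ≤ u (B i)) (hl : l < L)
    (hle : (Finset.univ.filter fun i => 0 < u (B i) ∧ u (B i) ≤ μ).card ≤ l) :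
    (Finset.univ.filter fun i => 0 < u (B i)).card ≤ (g m 0 l).1 := by
  classical
  set C := allocationCuts pos par u B with hCdef
  have huniq : ∀ {i j v}, v ∈ B i → v ∈ B j → i = j := by
    intro i j v hi hj
    by_contra hij
    exact Finset.disjoint_left.1 (hB.2.1 i j hij) hi hj
  have htop : ∀ {i v x}, v ∈ B i → x ∈ B i → C (pos v) → C (pos x) → pos v = pos x := by
    intro i v x hv hx hCv hCx
    rw [← location_of_mem (m := m) (par := par) hCv m, location_eq_of_mem hr hB hv hx,
      location_of_mem hCx]
  have hcut : ∀ t, C t → ∃ i v, v ∈ B i ∧ pos v = t ∧ 0 < u (B i) := by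
    rintro t ⟨i, hi, v, hv, hvt, -⟩
    exact ⟨i, v, hv, hvt, hi⟩
  have : ∀ i, ∃ t, 0 < u (B i) → ∃ v ∈ B i, pos v = t ∧ C t := by
    intro i
    by_cases hi : 0 < u (B i)
    · obtain ⟨v, hv, hC⟩ := exists_allocationCuts hr hi hw
      exact ⟨pos v, fun _ => ⟨v, hv, rfl, hC⟩⟩
    · exact ⟨0, fun h => (hi h).elim⟩
  choose f hf using this
  -- A loser cut collects at most `μ`, so it stems from a bundle worth at most `μ`; `f` sends that
  -- bundle to the cut, since a bundle contains only one cut vertex.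
  have hloser : below m par (indic (LoserCut m par w μ C)) m 0 ≤ l := by
    rw [below_root hr.isParent, sum_indic]
    refine (Finset.card_le_card_of_surjOn f fun t ht => ?_).trans hle
    obtain ⟨-, ht, ht'⟩ := Finset.mem_filter.1 (Finset.mem_coe.1 ht)
    obtain ⟨i, v, hv, rfl, hpos⟩ := hcut t ht
    obtain ⟨x, hx, hx', hC⟩ := hf i hpos
    refine ⟨i, Finset.mem_coe.2 (Finset.mem_filter.2 ⟨Finset.mem_univ _, hpos, ?_⟩), ?_⟩
    · exact (le_collected_allocationCuts hr hB hw hv ht).trans (not_lt.1 ht')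
    · rw [← hx'] at hC ⊢
      exact htop hx hv hC ht
  have hcount : (Finset.univ.filter fun i => 0 < u (B i)).card ≤ below m par (indic C) m 0 := by
    rw [below_root hr.isParent, sum_indic]
    refine Finset.card_le_card_of_injOn f (fun i hi => ?_) fun i hi j hj h => ?_
    · obtain ⟨v, -, hv, hC⟩ := hf i (Finset.mem_filter.1 (Finset.mem_coe.1 hi)).2
      rw [← hv] at hC ⊢
      exact Finset.mem_coe.2 (Finset.mem_filter.2
        ⟨Finset.mem_Icc.2 ⟨hr.one_le v, hr.le v⟩, hC⟩)
    · obtain ⟨v, hv, hv', -⟩ := hf i (Finset.mem_filter.1 (Finset.mem_coe.1 hi)).2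
      obtain ⟨x, hx, hx', -⟩ := hf j (Finset.mem_filter.1 (Finset.mem_coe.1 hj)).2
      obtain rfl : v = x := hr.inj (by rw [hv', hx', h])
      exact huniq hv hx
  refine hcount.trans (LexLe.fst_le (hg.lexLe hr.isParent hw.nonneg (fun t _ _ ht => ?_) le_rfl
    (by omega) hl hloser))
  obtain ⟨i, v, hv, rfl, hpos⟩ := hcut t ht
  exact (hμ i hpos).trans (le_collected_allocationCuts hr hB hw hv ht)

end OfAllocation

/-- The agents receive the parts in the order of their top vertices. The parts that exceed the
number of agents, and the rest at the root, are merged with other parts. `c t` is the number of the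
agents that have received a part with a top vertex smaller than `t`. -/
structure IsAssignment (m n : ℕ) (par : ℕ → ℕ) (C : ℕ → Prop) (agent c : ℕ → ℕ) : Prop where
  agent_zero : agent 0 = 0
  c_one : c 1 = 0
  cut : ∀ t, 1 ≤ t → t ≤ m → C t → c t < n → agent t = c t ∧ c (t + 1) = c t + 1
  keep : ∀ t, 1 ≤ t → t ≤ m → ¬ (C t ∧ c t < n) → agent t = agent (par t) ∧ c (t + 1) = c t

namespace IsAssignment

variable {agent c : ℕ → ℕ}

theorem c_eq (h : IsAssignment m n par C agent c) {t : ℕ} (ht : t ≤ m) :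
    c (t + 1) = min n (∑ s ∈ Finset.Icc 1 t, indic C s) := by
  induction t with
  | zero => simp [h.c_one]
  | succ t ih =>
    rw [Finset.sum_Icc_succ_top (by omega)]
    have ih := ih (by omega)
    by_cases hC : C (t + 1)
    · by_cases hn : c (t + 1) < n
      · rw [(h.cut _ (by omega) ht hC hn).2, indic, if_pos hC]
        omega
      · rw [(h.keep _ (by omega) ht fun h' => hn h'.2).2, indic, if_pos hC]
        omega
    · rw [(h.keep _ (by omega) ht fun h' => hC h'.1).2, indic, if_neg hC]
      omega

/-- The vertices before the first cut have agent `0`, although no agent counts as served yet; hence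
the `max 1`. -/
theorem agent_lt (h : IsAssignment m n par C agent c) (hpar : IsParent m par) {t : ℕ} (ht : t ≤ m) :
    ∀ s ≤ t, agent s < max 1 (c (t + 1)) := by
  induction t with
  | zero =>
    intro s hs
    obtain rfl : s = 0 := by omega
    simp [h.agent_zero]
  | succ t ih =>
    have ih := ih (by omega)
    intro s hs
    have hp := hpar (t + 1) (by omega) ht
    have h1 : ∀ s ≤ t, agent s < max 1 (c (t + 1)) → agent s < max 1 (c (t + 1 + 1)) := by
      intro s _ hs'
      rw [h.c_eq ht]
      rw [h.c_eq (by omega)] at hs'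
      rw [Finset.sum_Icc_succ_top (by omega)]
      omega
    rcases Nat.lt_or_ge s (t + 1) with hs' | hs'
    · exact h1 s (by omega) (ih s (by omega))
    · obtain rfl : s = t + 1 := by omega
      by_cases hC : C (t + 1) ∧ c (t + 1) < n
      · obtain ⟨h2, h3⟩ := h.cut _ (by omega) ht hC.1 hC.2
        omega
      · obtain ⟨h2, h3⟩ := h.keep _ (by omega) ht hC
        have := ih (par (t + 1)) (by omega)
        omega

theorem agent_lt_card (h : IsAssignment m n par C agent c) (hpar : IsParent m par) (hn : 1 ≤ n)
    {t : ℕ} (ht : t ≤ m) : agent t < n := by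
  have h1 := h.agent_lt hpar le_rfl t ht
  have h2 := h.c_eq le_rfl
  omega

/-- This makes the bundles connected. A vertex that opens a new agent is the first one with that
agent, except at the first cut: it goes to agent `0`, who already has everything before it, the
parent included. -/
theorem parent_or_min (h : IsAssignment m n par C agent c) (hr : IsRooting G pos par) {t : ℕ}
    (ht : 1 ≤ t) (htm : t ≤ m) :
    (1 ≤ par t ∧ agent (par t) = agent t) ∨ ∀ s, 1 ≤ s → s < t → agent s ≠ agent t := by
  rcases eq_or_ne t 1 with rfl | ht1
  · right; intro s hs hs'; omega
  have hp := hr.isParent t ht htm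
  have hpp := hr.par_pos t (by omega) htm
  by_cases hC : C t ∧ c t < n
  · obtain ⟨h1, -⟩ := h.cut t ht htm hC.1 hC.2
    have h2 := h.agent_lt hr.isParent (t := t - 1) (by omega)
    rw [Nat.sub_add_cancel ht] at h2
    rcases Nat.eq_zero_or_pos (c t) with h0 | h0
    · have := h2 (par t) (by omega)
      left; omega
    · right
      intro s hs hst
      have := h2 s (by omega)
      omega
  · exact Or.inl ⟨hpp, (h.keep t ht htm hC).1.symm⟩

theorem exists_cut (h : IsAssignment m n par C agent c) {t : ℕ} (ht : t ≤ m) {i : ℕ}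
    (hi : i < c (t + 1)) : ∃ s, 1 ≤ s ∧ s ≤ t ∧ C s ∧ c s < n ∧ agent s = i := by
  induction t with
  | zero => rw [h.c_one] at hi; omega
  | succ t ih =>
    have hle : i < c (t + 1) → ∃ s, 1 ≤ s ∧ s ≤ t + 1 ∧ C s ∧ c s < n ∧ agent s = i := by
      intro h'
      obtain ⟨s, hs, hs', hs''⟩ := ih (by omega) h'
      exact ⟨s, hs, by omega, hs''⟩
    by_cases hC : C (t + 1) ∧ c (t + 1) < n
    · obtain ⟨h1, h2⟩ := h.cut _ (by omega) ht hC.1 hC.2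
      rcases Nat.lt_or_ge i (c (t + 1)) with h3 | h3
      · exact hle h3
      · exact ⟨t + 1, by omega, le_rfl, hC.1, hC.2, by omega⟩
    · rw [(h.keep _ (by omega) ht hC).2] at hi
      exact hle hi

/-- An uncut vertex takes over both the location and the agent of its parent. The virtual vertex `0`
is excluded as a location by `1 ≤ t`. -/
theorem agent_eq_of_location (h : IsAssignment m n par C agent c) (hpar : IsParent m par) {t : ℕ}
    (ht : 1 ≤ t) {i : ℕ} (hi : i ≤ m) (hit : location m par C m i = t) :
    agent i = agent t := by
  induction i using Nat.strong_induction_on with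
  | _ i ih =>
    by_cases hC : C i
    · rw [location_of_mem hC] at hit
      rw [hit]
    · rcases Nat.eq_zero_or_pos i with rfl | h0
      · rw [location_of_le le_rfl (by omega)] at hit
        omega
      · have hp := hpar i h0 hi
        rw [location_of_notMem hpar le_rfl (by omega) hi hC] at hit
        rw [(h.keep i h0 hi fun h' => hC h'.1).1, ih _ hp (by omega) hit]

/-- Within a bundle, the steps to parents with the same agent lead from every vertex to the one with
the smallest number. -/
theorem isConnectedAllocation (h : IsAssignment m n par C agent c) (hr : IsRooting G pos par)
    (hn : 1 ≤ n) : IsConnectedAllocation G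
      fun i : Fin n => Finset.univ.filter fun v : Fin m => agent (pos v) = i := by
  refine ⟨fun v => ?_, fun i j hij => ?_, fun i => ?_⟩
  · exact ⟨⟨agent (pos v), h.agent_lt_card hr.isParent hn (hr.le v)⟩, by simp⟩
  · refine Finset.disjoint_filter.2 fun v _ h1 h2 => hij (Fin.ext ?_)
    rw [← h1, h2]
  · set S := Finset.univ.filter fun v : Fin m => agent (pos v) = i with hS
    change (G.induce (S : Set (Fin m))).Preconnected
    have hmem : ∀ v, v ∈ S ↔ agent (pos v) = i := fun v => by simp [hS]
    rcases S.eq_empty_or_nonempty with hne | hne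
    · rintro ⟨a, ha⟩
      rw [hne] at ha
      simp at ha
    obtain ⟨v₀, hv₀, hmin⟩ := S.exists_min_image pos hne
    have key : ∀ t, ∀ v (hv : v ∈ S), pos v = t →
        (G.induce (S : Set (Fin m))).Reachable ⟨v, hv⟩ ⟨v₀, hv₀⟩ := by
      intro t
      induction t using Nat.strong_induction_on with
      | _ t ih =>
        rintro v hv rfl
        rcases h.parent_or_min hr (hr.one_le v) (hr.le v) with ⟨h1, h2⟩ | h1
        · have hp := hr.isParent _ (hr.one_le v) (hr.le v)
          obtain ⟨x, hx⟩ := exists_pos_eq hr.inj hr.one_le hr.le h1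
            (hp.le.trans (hr.le v))
          have hxS : x ∈ S := (hmem x).2 (by rw [hx, h2, (hmem v).1 hv])
          have hadj : (G.induce (S : Set (Fin m))).Adj ⟨v, hv⟩ ⟨x, hxS⟩ :=
            SimpleGraph.induce_adj.2 ((hr.adj_iff v x).2 (Or.inl hx.symm))
          exact hadj.reachable.trans (ih _ (by omega) x hxS rfl)
        · have h2 : pos v₀ = pos v := by
            by_contra hne
            have := hmin v hv
            exact h1 (pos v₀) (hr.one_le v₀) (by omega) (by rw [(hmem v).1 hv, (hmem v₀).1 hv₀])
          obtain rfl := hr.inj h2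
          exact SimpleGraph.Reachable.refl _
    rintro ⟨a, ha⟩ ⟨b, hb⟩
    exact (key _ a ha rfl).trans (key _ b hb rfl).symm

/-- The agent served at a cut receives everything collected there. Surplus parts and the rest at the
root can only add to the bundle. -/
theorem exists_collected_le (h : IsAssignment m n par C agent c) (hr : IsRooting G pos par)
    (hw : IsWeight pos u w) (i : Fin n) (hi : (i : ℕ) < ∑ t ∈ Finset.Icc 1 m, indic C t) :
    ∃ t, 1 ≤ t ∧ t ≤ m ∧ C t ∧ agent t = i ∧
      collected m par w C m t ≤ u (Finset.univ.filter fun v : Fin m => agent (pos v) = i) := by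
  have hc := h.c_eq le_rfl
  obtain ⟨t, ht, htm, hC, -, hti⟩ := h.exists_cut le_rfl (i := i) (by omega)
  refine ⟨t, ht, htm, hC, hti, ?_⟩
  rw [collected_eq_sum hr.isParent le_rfl (Or.inr hC) htm, hw.eq_sum hr, ← Finset.sum_filter]
  refine Finset.sum_le_sum_of_subset_of_nonneg (fun s hs => ?_) fun s _ _ => hw.nonneg s
  rw [Finset.mem_filter, Finset.mem_range] at hs
  have hs0 : 1 ≤ s := by
    by_contra h0
    obtain rfl : s = 0 := by omega
    rw [location_of_le le_rfl (by omega)] at hs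
    omega
  obtain ⟨v, rfl⟩ := exists_pos_eq hr.inj hr.one_le hr.le hs0 (by omega)
  refine Finset.mem_image.2 ⟨v, Finset.mem_filter.2 ⟨Finset.mem_univ _, ?_⟩, rfl⟩
  rw [h.agent_eq_of_location hr.isParent ht (hr.le v) hs.2, hti]

/-- The number of the agents that have received a part with a top vertex smaller than `t`. -/
noncomputable def served (n : ℕ) (C : ℕ → Prop) (t : ℕ) : ℕ :=
  min n (∑ s ∈ Finset.Icc 1 (t - 1), indic C s)

theorem served_one (n : ℕ) (C : ℕ → Prop) : served n C 1 = 0 := by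
  simp [served]

theorem served_of_cut {t : ℕ} (ht : 1 ≤ t) (hC : C t) (hn : served n C t < n) :
    served n C (t + 1) = served n C t + 1 := by
  obtain ⟨t, rfl⟩ := Nat.exists_eq_add_of_le' ht
  simp only [served, Nat.add_sub_cancel] at hn ⊢
  rw [Finset.sum_Icc_succ_top (by omega), indic, if_pos hC]
  omega

theorem served_of_keep {t : ℕ} (ht : 1 ≤ t) (h : ¬ (C t ∧ served n C t < n)) :
    served n C (t + 1) = served n C t := by
  obtain ⟨t, rfl⟩ := Nat.exists_eq_add_of_le' ht
  simp only [served, Nat.add_sub_cancel] at h ⊢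
  rw [Finset.sum_Icc_succ_top (by omega), indic]
  split_ifs with hC
  · have : ¬ min n (∑ s ∈ Finset.Icc 1 t, indic C s) < n := fun h' => h ⟨hC, h'⟩
    omega
  · omega

open Classical in
/-- The agents of the vertices. -/
noncomputable def agentOf (n : ℕ) (par : ℕ → ℕ) (C : ℕ → Prop) (t : ℕ) : ℕ :=
  -- The condition `par t < t` serves termination only; on the vertices it holds by `IsParent`.
  if _h : par t < t ∧ ¬ (C t ∧ served n C t < n) then agentOf n par C (par t)
  else if t = 0 then 0 else served n C t
termination_by t
decreasing_by exact _h.1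

theorem isAssignment_agentOf (n : ℕ) (hpar : IsParent m par) (C : ℕ → Prop) :
    IsAssignment m n par C (agentOf n par C) (served n C) := by
  refine ⟨?_, served_one n C, fun t ht htm hC hn => ⟨?_, served_of_cut ht hC hn⟩,
    fun t ht htm h => ⟨?_, served_of_keep ht h⟩⟩
  · rw [agentOf]; simp
  · rw [agentOf, dif_neg fun h => h.2 ⟨hC, hn⟩, if_neg (by omega)]
  · rw [agentOf, dif_pos ⟨hpar t ht htm, h⟩]

end IsAssignment

end Allocation

section Optimality

variable {R : Type} [AddCommGroup R] [LinearOrder R] [IsOrderedAddMonoid R]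
  {m n : ℕ} {G : SimpleGraph (Fin m)} {pos : Fin m → ℕ} {par : ℕ → ℕ} {u : Finset (Fin m) → R}
  {w : ℕ → R} {C : ℕ → Prop} {μ : R} {L : ℕ} {g : ℕ → ℕ → ℕ → ℕ × R} {X Y K : ℕ → ℕ → ℕ}

/-! ### The table computes a strongly maximin share allocation -/

/-- If all bundles are worth at least `μ`, at most the losers are worth at most `μ`. -/
theorem le_of_forall_le (hr : IsRooting G pos par) (hw : IsWeight pos u w)
    (hg : IsTable m par w μ L g X Y K) (hμ : 0 < μ) {B : Fin n → Finset (Fin m)}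
    (hB : IsConnectedAllocation G B) (hle : ∀ i, μ ≤ u (B i)) (hL : loserCount u μ B < L) :
    n ≤ (g m 0 (loserCount u μ B)).1 := by
  have := hg.card_le hr hB hw (fun i _ => hle i) hL (Finset.card_le_card fun i hi => by
    rw [Finset.mem_filter] at hi ⊢
    exact ⟨hi.1, le_antisymm hi.2.2 (hle i)⟩)
  rwa [Finset.filter_true_of_mem fun i _ => hμ.trans_le (hle i), Finset.card_univ,
    Fintype.card_fin] at this

/-- The number of bundles that are worth more than `μ` is bounded by the table if all other bundles
are worth nothing. -/
theorem card_lt_le (hr : IsRooting G pos par) (hw : IsWeight pos u w)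
    (hg : IsTable m par w μ L g X Y K) (hμ : 0 ≤ μ) {B : Fin n → Finset (Fin m)}
    (hB : IsConnectedAllocation G B) (hlt : ∀ i, 0 < u (B i) → μ < u (B i)) (hL : 0 < L) :
    (Finset.univ.filter fun i => μ < u (B i)).card ≤ (g m 0 0).1 := by
  refine le_trans (Finset.card_le_card fun i hi => ?_)
    (hg.card_le hr hB hw (fun i hi => (hlt i hi).le) hL (Nat.le_zero.2 ?_))
  · rw [Finset.mem_filter] at hi ⊢
    exact ⟨hi.1, hμ.trans_lt hi.2⟩
  · exact Finset.card_eq_zero.2 (Finset.filter_eq_empty_iff.2 fun i _ h =>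
      h.2.not_gt (hlt i h.1))

/-- If the table has fewer than `n` parts that are worth more than `μ`, no allocation gives more
than `μ` to all agents. -/
theorem exists_le_of_table (hr : IsRooting G pos par) (hw : IsWeight pos u w)
    (hg : IsTable m par w μ L g X Y K) (hμ : 0 ≤ μ) (hn : (g m 0 0).1 < n) (hL : 0 < L)
    {B : Fin n → Finset (Fin m)} (hB : IsConnectedAllocation G B) : ∃ i, u (B i) ≤ μ := by
  by_contra! h
  have := card_lt_le hr hw hg hμ hB (fun i _ => h i) hL
  rw [Finset.filter_true_of_mem fun i _ => h i, Finset.card_univ, Fintype.card_fin] at this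
  omega

/-- Fewer than `n` parts above `μ` means that no allocation gives more than `μ` to everyone, and
this one gives at least `μ` to everyone, so `μ` is the maximin share. If `μ > 0`, different losers
come from different loser cuts, so there are at most `rem m 0` of them, and an allocation with fewer
would give `n` parts for a smaller budget. If `μ = 0`, the losers are the worthless bundles, and the
table without losers maximises the number of the others. -/
theorem isSMMS_of_table (hr : IsRooting G pos par) (hw : IsWeight pos u w)
    (hg : IsTable m par w μ L g X Y K) (hμ : 0 ≤ μ) (hn : 1 ≤ n) (hnL : n < L)
    (hlt : (g m 0 0).1 < n) {rem : ℕ → ℕ → ℕ} (hC : IsTraceback m par L X Y K rem C)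
    (hpos : 0 < μ → n ≤ (g m 0 (rem m 0)).1 ∧ ∀ l < rem m 0, (g m 0 l).1 < n)
    (hzero : ¬ 0 < μ → rem m 0 = 0) {agent c : ℕ → ℕ} (hA : IsAssignment m n par C agent c) :
    IsSMMS G u fun i : Fin n => Finset.univ.filter fun v : Fin m => agent (pos v) = i := by
  classical
  set A : Fin n → Finset (Fin m) :=
    fun i => Finset.univ.filter fun v : Fin m => agent (pos v) = i with hAdef
  have hAc : IsConnectedAllocation G A := hA.isConnectedAllocation hr hn
  obtain ⟨htab, hlos⟩ := hC.eq_table hg hr.isParent (k := m) (j := 0) le_rfl (by omega)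
  have hcount : (g m 0 (rem m 0)).1 = ∑ t ∈ Finset.Icc 1 m, indic C t := by
    rw [htab, below_root hr.isParent]
  rw [below_root hr.isParent, sum_indic] at hlos
  have hAle : ∀ i, μ ≤ u (A i) := by
    intro i
    by_cases h0 : 0 < μ
    · obtain ⟨t, ht, htm, hCt, -, hle⟩ := hA.exists_collected_le hr hw i (by
        have := (hpos h0).1
        omega)
      exact (hC.le_collected hg hr.isParent ht htm hCt).trans hle
    · exact (not_lt.1 h0).trans (hw.utility_nonneg _)
  refine ⟨μ, ⟨⟨A, hAc, ?_, ?_⟩, ?_⟩, hAc, hAle, ?_⟩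
  · obtain ⟨i, hi⟩ := exists_le_of_table hr hw hg hμ hlt (by omega) hAc
    exact ⟨i, le_antisymm hi (hAle i)⟩
  · rintro _ ⟨i, rfl⟩
    exact hAle i
  · rintro x ⟨B, hB, hx⟩
    obtain ⟨i, hi⟩ := exists_le_of_table hr hw hg hμ hlt (by omega) hB
    exact (hx.2 ⟨i, rfl⟩).trans hi
  · intro B hB hBle
    by_cases h0 : 0 < μ
    · have h1 : loserCount u μ A ≤ rem m 0 := by
        refine le_trans ?_ hlos
        have : ∀ i : Fin n, ∃ t, 1 ≤ t ∧ t ≤ m ∧ C t ∧ agent t = i ∧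
            collected m par w C m t ≤ u (A i) := fun i =>
          hA.exists_collected_le hr hw i (by have := (hpos h0).1; omega)
        choose f hf using this
        refine Finset.card_le_card_of_injOn f (fun i hi => ?_) fun i _ j _ h => ?_
        · obtain ⟨ht, htm, hCt, -, hle⟩ := hf i
          have hi := (Finset.mem_filter.1 (Finset.mem_coe.1 hi)).2
          exact Finset.mem_coe.2 (Finset.mem_filter.2
            ⟨Finset.mem_Icc.2 ⟨ht, htm⟩, hCt, not_lt.2 (hle.trans hi.le)⟩)
        · apply Fin.ext
          rw [← (hf i).2.2.2.1, ← (hf j).2.2.2.1, h]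
      refine h1.trans ?_
      by_contra! h2
      have h3 : loserCount u μ B ≤ n := by
        simpa [loserCount] using Finset.card_filter_le (Finset.univ : Finset (Fin n)) fun i => u (B i) = μ
      have := le_of_forall_le hr hw hg h0 hB hBle (by omega)
      have := (hpos h0).2 _ h2
      omega
    · obtain rfl : μ = 0 := le_antisymm (not_lt.1 h0) hμ
      rw [hzero h0] at hcount hlos
      have hsplit : ∀ D : Fin n → Finset (Fin m), loserCount u 0 D +
          (Finset.univ.filter fun i => 0 < u (D i)).card = n := by
        intro D
        have := Finset.card_filter_add_card_filter_not (s := (Finset.univ : Finset (Fin n)))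
          fun i => u (D i) = 0
        rw [Finset.card_univ, Fintype.card_fin] at this
        conv_rhs => rw [← this]
        unfold loserCount
        congr 2
        ext i
        simp only [Finset.mem_filter, Finset.mem_univ, true_and]
        exact ⟨fun h => h.ne', fun h => lt_of_le_of_ne (hw.utility_nonneg _) (Ne.symm h)⟩
      have h1 := card_lt_le hr hw hg le_rfl hB (fun i hi => hi) (by omega)
      have h2 : (g m 0 0).1 ≤ (Finset.univ.filter fun i => 0 < u (A i)).card := by
        rw [← Fintype.card_fin (g m 0 0).1]
        refine Finset.card_le_card_of_injOn (s := Finset.univ)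
          (fun i => (⟨i, by omega⟩ : Fin n)) (fun i _ => ?_) fun i _ j _ h => ?_
        · refine Finset.mem_coe.2 (Finset.mem_filter.2 ⟨Finset.mem_univ _, ?_⟩)
          obtain ⟨t, ht, htm, hCt, -, hle⟩ :=
            hA.exists_collected_le hr hw ⟨i, by omega⟩ (by rw [← hcount]; exact i.2)
          refine lt_of_lt_of_le ?_ hle
          -- A part worth no more than `0` would be a loser cut, but the budget is `0`.
          by_contra h
          have : t ∈ (Finset.Icc 1 m).filter (LoserCut m par w 0 C) :=
            Finset.mem_filter.2 ⟨Finset.mem_Icc.2 ⟨ht, htm⟩, hCt, h⟩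
          have := Finset.card_pos.2 ⟨t, this⟩
          omega
        · exact Fin.ext (by simpa using h)
      have h3 := hsplit A
      have h4 := hsplit B
      omega

/-! ### Raising the threshold -/

omit [IsOrderedAddMonoid R] in
theorem IsTable.isTraceback_zero (hg : IsTable m par w μ L g X Y K) (hL : 0 < L) :
    IsTraceback m par L X Y K (fun _ _ => 0) fun t => K t 0 = 1 := by
  refine ⟨hL, fun k hk => ?_, fun k hk => ?_, fun _ _ _ _ _ => rfl, fun _ _ => Iff.rfl⟩
  · have := hg.le k hk 0 hL
    omega
  · simp

/-- The parts of the table without losers, if they are at least `n`, form an allocation. -/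
theorem IsTable.exists_allocation (hr : IsRooting G pos par) (hw : IsWeight pos u w)
    (hg : IsTable m par w μ L g X Y K) (hL : 0 < L) (hn : 1 ≤ n) (hle : n ≤ (g m 0 0).1) {ν : R}
    (hν : ∀ t, 1 ≤ t → t ≤ m → μ < (g (m - t) t 0).2 → ν ≤ (g (m - t) t 0).2) :
    ∃ B : Fin n → Finset (Fin m), IsConnectedAllocation G B ∧ ∀ i, ν ≤ u (B i) := by
  have hA := IsAssignment.isAssignment_agentOf n hr.isParent fun t => K t 0 = 1
  have hT := hg.isTraceback_zero hL
  obtain ⟨h1, h2⟩ := hT.eq_table hg hr.isParent (k := m) (j := 0) le_rfl (by omega)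
  rw [below_root hr.isParent] at h1
  refine ⟨_, hA.isConnectedAllocation hr hn, fun i => ?_⟩
  obtain ⟨t, ht, htm, hC, -, hi⟩ := hA.exists_collected_le hr hw i (by
    rw [h1] at hle
    exact i.2.trans_le hle)
  refine le_trans ?_ hi
  have h3 := (hT.eq_table hg hr.isParent (k := m - t) (j := t) (by omega) (by omega)).1
  have hk : m - (m - t) = t := by omega
  have h4 := (hg.cut (m - t) (by omega) 0 hL).1 (by rwa [hk])
  have h5 := hg.le (m - t) (by omega) 0 hL
  rw [hk] at h4 h5
  -- With budget `0`, `X + Y ≤ 0` leaves only cuts of weight strictly above `μ`.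
  rw [show X t 0 = 0 by omega, show Y t 0 = 0 by omega] at h4
  have h6 := hν t ht htm (h4.elim id fun h => by omega)
  rw [h3] at h6
  exact h6.trans (collected_eq_of_le hr.isParent htm le_rfl (by omega)).le

omit [IsOrderedAddMonoid R] in
/-- The rows of the table do not change after they have been processed. -/
theorem IsTable.eq_last (hg : IsTable m par w μ L g X Y K) (hpar : IsParent m par) {t l : ℕ}
    (ht : t ≤ m) (hl : l < L) : g (m - t) t l = g m t l := by
  have (d : ℕ) (hd : m - t + d ≤ m) : g (m - t + d) t l = g (m - t) t l := by
    induction d with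
    | zero => rfl
    | succ d ih =>
      have := hpar (m - (m - t + d)) (by omega) (by omega)
      rw [← add_assoc, hg.frame _ (by omega) t ht (by omega) l hl, ih (by omega)]
  obtain ⟨e, he⟩ := Nat.exists_eq_add_of_le (show m - t ≤ m by omega)
  have h2 := this e he.symm.le
  rw [← he] at h2
  rw [h2]

/-- The table without losers, computed greedily. -/
noncomputable def greedy (m : ℕ) (par : ℕ → ℕ) (w : ℕ → R) (μ : R) : ℕ → ℕ → ℕ × R
  | 0, j => (0, w j)
  | k + 1, j =>
    if j = par (m - k) then merge μ 0 (greedy m par w μ k j) (greedy m par w μ k (m - k))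
    else greedy m par w μ k j

omit [IsOrderedAddMonoid R] in
theorem IsTable.eq_greedy (hg : IsTable m par w μ L g X Y K) (hpar : IsParent m par) (hL : 0 < L)
    {k : ℕ} (hk : k ≤ m) {j : ℕ} (hj : j ≤ m) : g k j 0 = greedy m par w μ k j := by
  induction k generalizing j with
  | zero => exact hg.init j hj 0 hL
  | succ k ih =>
    have hp := hpar (m - k) (by omega) (by omega)
    rw [greedy]
    split_ifs with hjp
    · subst hjp
      have := hg.le k hk 0 hL
      have hatt := hg.attained k hk 0 hL
      rw [show X (m - k) 0 = 0 by omega, show Y (m - k) 0 = 0 by omega] at hatt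
      rw [hatt, ih (by omega) (by omega), ih (by omega) (by omega)]
    · rw [hg.frame k hk j hj hjp 0 hL, ih (by omega) hj]

open Classical in
/-- The number of parts that are finished when `t` has been processed, at `t` and below. -/
noncomputable def partCount (m : ℕ) (par : ℕ → ℕ) (w : ℕ → R) (μ : R) (t : ℕ) : ℕ :=
  (greedy m par w μ (m - t) t).1 + if μ < (greedy m par w μ (m - t) t).2 then 1 else 0

/-- The sum of all `partCount`s. It decreases when the threshold is raised. -/
noncomputable def potential (m : ℕ) (par : ℕ → ℕ) (w : ℕ → R) (μ : R) : ℕ :=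
  ∑ t ∈ Finset.Icc 1 m, partCount m par w μ t

omit [AddCommGroup R] [IsOrderedAddMonoid R] in
theorem cutTest_zero {r : R} : CutTest μ 0 r ↔ μ < r := by
  simp [CutTest]

theorem greedy_nonneg (hw : ∀ i, 0 ≤ w i) (k j : ℕ) : 0 ≤ (greedy m par w μ k j).2 := by
  induction k generalizing j with
  | zero => exact hw j
  | succ k ih =>
    rw [greedy, merge]
    split_ifs
    exacts [ih _, add_nonneg (ih _) (ih _), ih _]

omit [IsOrderedAddMonoid R] in
theorem greedy_fst {k : ℕ} (hk : k ≤ m) (j : ℕ) : (greedy m par w μ k j).1 =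
    below m par (indic fun t => μ < (greedy m par w μ (m - t) t).2) k j := by
  induction k generalizing j with
  | zero => rfl
  | succ k ih =>
    rw [greedy, below]
    split_ifs
    · rw [← ih (by omega), ← ih (by omega), indic, Nat.sub_sub_self (by omega), merge]
      simp only [cutTest_zero]
      split_ifs <;> rfl
    · exact ih (by omega) j

omit [IsOrderedAddMonoid R] in
theorem partCount_le (hpar : IsParent m par) {t : ℕ} (ht : 1 ≤ t) (htm : t ≤ m) :
    partCount m par w μ t ≤ m := by
  have h1 := Finset.single_le_sum
    (f := below m par (indic fun t => μ < (greedy m par w μ (m - t) t).2) (m - t))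
    (fun _ _ => Nat.zero_le _) (Finset.mem_range.2 (show t < m - (m - t) + 1 by omega))
  rw [sum_below hpar _ (by omega), ← greedy_fst (by omega)] at h1
  have h2 := Finset.sum_le_card_nsmul (Finset.Ioc (m - (m - t)) m)
    (indic fun t => μ < (greedy m par w μ (m - t) t).2) 1
    (fun t _ => by unfold indic; split_ifs <;> omega)
  rw [Nat.card_Ioc, smul_eq_mul] at h2
  have h3 := h1.trans h2
  unfold partCount
  split_ifs <;> omega

omit [IsOrderedAddMonoid R] in
theorem potential_le (hpar : IsParent m par) : potential m par w μ ≤ m * m := by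
  have := Finset.sum_le_card_nsmul (Finset.Icc 1 m) (partCount m par w μ) m fun t ht =>
    partCount_le hpar (Finset.mem_Icc.1 ht).1 (Finset.mem_Icc.1 ht).2
  simpa [potential] using this

/-- Where only the lower threshold cuts, it gains a finished part, and the lexicographic order
prefers this to any collected weight. -/
theorem greedy_antitone (hw : ∀ i, 0 ≤ w i) {ν : R} (h : μ ≤ ν) (k j : ℕ) :
    LexLe (greedy m par w ν k j) (greedy m par w μ k j) := by
  induction k generalizing j with
  | zero => exact LexLe.refl _
  | succ k ih =>
    rw [greedy, greedy]
    split_ifs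
    · refine LexLe.trans ?_ (merge_lexLe_merge (μ := μ) (y := 0) (ih j) (ih (m - k))
        (greedy_nonneg hw _ _))
      simp only [merge, cutTest_zero]
      split_ifs with h1 h2 h2
      · exact LexLe.refl _
      · exact absurd (h.trans_lt h1) h2
      · left; simp only; omega
      · exact LexLe.refl _
    · exact ih j

theorem partCount_antitone (hw : ∀ i, 0 ≤ w i) {ν : R} (h : μ ≤ ν) (t : ℕ) :
    partCount m par w ν t ≤ partCount m par w μ t := by
  unfold partCount
  rcases greedy_antitone (m := m) (par := par) hw h (m - t) t with h1 | ⟨h1, h2⟩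
  · split_ifs <;> omega
  · split_ifs with h3 h4
    · omega
    · exact absurd (h.trans_lt (h3.trans_le h2)) h4
    · omega
    · omega

/-- The potential decreases when the threshold is raised to the weight of a finished part. -/
theorem potential_lt (hw : ∀ i, 0 ≤ w i) {ν : R} (h : μ < ν) {t : ℕ} (ht : 1 ≤ t) (htm : t ≤ m)
    (hν : ν = (greedy m par w μ (m - t) t).2) :
    potential m par w ν < potential m par w μ := by
  by_contra! hle
  -- If the potential did not fall, termwise monotonicity would make all `partCount`s equal. Then
  -- both thresholds cut at the same vertices and the two tables coincide; but the weight `ν` at `t`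
  -- exceeds `μ` and does not exceed `ν`.
  have heq : ∀ t ∈ Finset.Icc 1 m, partCount m par w ν t = partCount m par w μ t := by
    refine (Finset.sum_eq_sum_iff_of_le fun t _ => partCount_antitone hw h.le t).1
      (le_antisymm (Finset.sum_le_sum fun t _ => partCount_antitone hw h.le t) hle)
  have hind : ∀ {a b : ℕ × R}, a = b →
      a.1 + (if ν < a.2 then 1 else 0) = b.1 + (if μ < b.2 then 1 else 0) →
      (ν < a.2 ↔ μ < b.2) := by
    rintro a _ rfl h'
    by_cases h1 : ν < a.2 <;> by_cases h2 : μ < a.2 <;> simp [h1, h2] at h' ⊢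
  have hgreedy : ∀ k, k ≤ m → ∀ j, greedy m par w ν k j = greedy m par w μ k j := by
    intro k hk
    induction k with
    | zero => exact fun j => rfl
    | succ k ih =>
      intro j
      have hmk : m - (m - k) = k := by omega
      have h1 := heq (m - k) (Finset.mem_Icc.2 ⟨by omega, by omega⟩)
      simp only [partCount, hmk] at h1
      have h2 := hind (ih (by omega) (m - k)) h1
      rw [greedy, greedy, ih (by omega) j]
      split_ifs
      · simp only [merge, cutTest_zero, ih (by omega) (m - k)]
        rw [ih (by omega) (m - k)] at h2
        simp only [h2]
      · rfl
  have h1 := heq t (Finset.mem_Icc.2 ⟨ht, htm⟩)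
  have h2 := hind (hgreedy (m - t) (by omega) t) h1
  rw [hgreedy (m - t) (by omega) t, ← hν] at h2
  exact lt_irrefl _ (h2.2 h)

end Optimality

/-! ### The program

Arrays of natural numbers: `0` is `m, n`, `1` the adjacency matrix, `2` the output, `3` the number
`M = m + n + 1` of iterations, `4` the multiples of `m`, `5` the multiples of `M`. The vertex `v` has
the number `6[v]`; the vertex with number `t` is `7[t]`, its parent has the number `8[t]`; `9` counts
the numbered vertices. The arrays `10` to `13` are tables with rows of length `M`: the number of
parts, and the choices `X`, `Y`, `K`. The arrays `14` to `17` hold the best choice so far, and `18`,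
`19` a candidate. `20` is the current vertex, `21` the current number of losers, `22` the losers that
remain below each vertex, `23` the number of losers, `24` the agents of the numbered vertices, `25`
the number of agents that have received a part, `26` an auxiliary number. The arrays from `30` on are
counters.

Arrays of utilities: `0` is the input, `1` the weights of the numbered vertices, `2` the table of the
collected weights, `3` and `4` the collected weights of the best choice and the candidate, `5` the
threshold, `6` the next threshold. -/

namespace LoopProg

/-- The entry `0` of an array. -/
def cell (a : ℕ) : NatExp := .read a (.const 0)

/-- The address of an entry of a table. -/
def addr (j l : NatExp) : NatExp := .add (.read 5 j) l

/-- `e < f` for natural numbers. -/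
def natLt (e f : NatExp) : Test := .natLe (.add e (.const 1)) f

/-- Tables of the multiples of `m` and of `M`. -/
def multiples : LoopProg :=
  .loop 30 (.seq
    (.setNat 4 (.add (cell 30) (.const 1)) (.add (.read 4 (cell 30)) (cell 0)))
    (.setNat 5 (.add (cell 30) (.const 1)) (.add (.read 5 (cell 30)) (cell 3))))

/-- Give the next number to the vertex `33[0]`, as a child of the vertex `32[0]`. -/
def addVertex : LoopProg :=
  .seq (.setNat 9 (.const 0) (.add (cell 9) (.const 1)))
    (.seq (.setNat 6 (cell 33) (cell 9))
      (.seq (.setNat 7 (cell 9) (cell 33))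
        (.seq (.setNat 8 (cell 9) (.read 6 (cell 32)))
          (.setVal 1 (cell 9) (.read 0 (cell 33))))))

/-- The vertex `32[0]` is numbered, and `33[0]` is a neighbour of it that is not. -/
def newEdge : Test :=
  .and (.and (natLt (cell 32) (cell 0)) (natLt (cell 33) (cell 0)))
    (.and (.natLe (.const 1) (.read 1 (.add (.read 4 (cell 32)) (cell 33))))
      (.and (.natLe (.const 1) (.read 6 (cell 32))) (.natLe (.read 6 (cell 33)) (.const 0))))

/-- Add neighbours of numbered vertices. -/
def sweep : LoopProg := .loop 32 (.loop 33 (.when newEdge addVertex))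

/-- Number the vertices. -/
def numbering : LoopProg :=
  .seq (.setNat 6 (.const 0) (.const 1))
    (.seq (.setNat 9 (.const 0) (.const 1))
      (.seq (.setVal 1 (.const 1) (.read 0 (.const 0))) (.loop 31 sweep)))

/-- The table when no vertex has been processed. -/
def initTable : LoopProg :=
  .loop 34 (.loop 35 (.seq
    (.setNat 10 (addr (cell 34) (cell 35)) (.const 0))
    (.setVal 2 (addr (cell 34) (cell 35)) (.read 1 (cell 34)))))

/-- The number of the parent of the current vertex. -/
def parent : NatExp := .read 8 (cell 20)

/-- The number of losers that are left for the parent, if there are `38[0]` losers below the current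
vertex and `y` at it. -/
def rest (y : ℕ) : NatExp := .sub (.sub (cell 21) (cell 38)) (.const y)

/-- The candidate is not better than the best choice so far. -/
def notBetter : Test :=
  .and (.natLe (cell 18) (cell 14))
    (.not (.and (.natLe (cell 14) (cell 18))
      (.not (.valLe (.read 4 (.const 0)) (.read 3 (.const 0))))))

/-- Compute the candidate for `38[0]` losers below the current vertex and `y` at it; the current
vertex is cut if `b`. -/
def computeCandidate (y : ℕ) (b : Test) : LoopProg :=
  .seq (.setNat 19 (.const 0) (.const 0))
    (.seq (.setNat 18 (.const 0)
        (.add (.read 10 (addr parent (rest y))) (.read 10 (addr (cell 20) (cell 38)))))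
      (.seq (.setVal 4 (.const 0)
          (.add (.read 2 (addr parent (rest y))) (.read 2 (addr (cell 20) (cell 38)))))
        (.when b
          (.seq (.setNat 19 (.const 0) (.const 1))
            (.seq (.setNat 18 (.const 0) (.add (cell 18) (.const 1)))
              (.setVal 4 (.const 0) (.read 2 (addr parent (rest y)))))))))

/-- Replace the best choice by the candidate. -/
def acceptCandidate (y : ℕ) : LoopProg :=
  .seq (.setNat 14 (.const 0) (cell 18))
    (.seq (.setNat 15 (.const 0) (cell 38))
      (.seq (.setNat 16 (.const 0) (.const y))
        (.seq (.setNat 17 (.const 0) (cell 19))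
          (.setVal 3 (.const 0) (.read 4 (.const 0))))))

/-- Consider the candidate for `38[0]` losers below the current vertex and `y` at it. -/
def tryCandidate (y : ℕ) (b : Test) : LoopProg :=
  .when (.natLe (.add (cell 38) (.const y)) (cell 21))
    (.seq (computeCandidate y b)
      -- The first candidate, with no losers at all, is accepted without comparison, because the
      -- cells of the best choice still hold old values.
      (.when (.not (.and (.natLe (.const 1) (.add (cell 38) (.const y))) notBetter))
        (acceptCandidate y)))

/-- The collected weight at the current vertex exceeds the threshold. -/
def exceeds : Test := .not (.valLe (.read 2 (addr (cell 20) (cell 38))) (.read 5 (.const 0)))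

/-- The collected weight at the current vertex reaches the threshold. -/
def reaches : Test := .valLe (.read 5 (.const 0)) (.read 2 (addr (cell 20) (cell 38)))

/-- Find the best choice for the current vertex and the current number of losers. -/
def bestChoice : LoopProg :=
  .loop 38 (.seq (tryCandidate 0 exceeds) (tryCandidate 1 reaches))

/-- Write the best choice into the tables. -/
def writeChoice : LoopProg :=
  .seq (.setNat 10 (addr parent (cell 21)) (cell 14))
    (.seq (.setVal 2 (addr parent (cell 21)) (.read 3 (.const 0)))
      (.seq (.setNat 11 (addr (cell 20) (cell 21)) (cell 15))
        (.seq (.setNat 12 (addr (cell 20) (cell 21)) (cell 16))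
          (.setNat 13 (addr (cell 20) (cell 21)) (cell 17)))))

/-- Process the current vertex. -/
def processVertex : LoopProg :=
  -- The budget `21[0]` runs downwards from `M - 1`: the row of the parent is overwritten in place,
  -- and its new entry `l` depends only on old entries up to `l`.
  .loop 37 (.seq (.setNat 21 (.const 0) (.sub (.sub (cell 3) (.const 1)) (cell 37)))
    (.seq bestChoice writeChoice))

/-- Process all vertices. -/
def fillTable : LoopProg :=
  .seq initTable
    -- `20[0]` runs through `M - 1, …, 0`; values outside `1, …, m` are skipped.
    (.loop 36 (.seq (.setNat 20 (.const 0) (.sub (.sub (cell 3) (.const 1)) (cell 36)))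
      (.when (.and (.natLe (.const 1) (cell 20)) (.natLe (cell 20) (cell 0))) processVertex)))

/-- The least weight above the threshold of a part that is finished without losers. -/
def nextThreshold : LoopProg :=
  .seq (.setVal 6 (.const 0) (.read 5 (.const 0)))
    (.loop 39 (.when
      (.and (.and (.natLe (.const 1) (cell 39)) (.natLe (cell 39) (cell 0)))
        -- `2[5[t]]` is the weight in the table entry of `t` with budget `0`. As long as `6[0]` does
        -- not exceed the threshold, no weight has been found yet.
        (.and (.not (.valLe (.read 2 (.read 5 (cell 39))) (.read 5 (.const 0))))
          (.not (.and (.not (.valLe (.read 6 (.const 0)) (.read 5 (.const 0))))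
            (.valLe (.read 6 (.const 0)) (.read 2 (.read 5 (cell 39))))))))
      (.setVal 6 (.const 0) (.read 2 (.read 5 (cell 39))))))

/-- Raise the threshold if all agents can get more. -/
def raiseThreshold : LoopProg :=
  .seq fillTable
    (.when (.natLe (.read 0 (.const 1)) (.read 10 (.const 0)))
      (.seq nextThreshold (.setVal 5 (.const 0) (.read 6 (.const 0)))))

/-- The least number of losers with which all agents can reach the threshold. -/
def findLosers : LoopProg :=
  .seq (.setNat 23 (.const 0) (.const 0))
    (.when (.not (.valLe (.read 5 (.const 0)) .zero))
      (.loop 42 (.when (natLt (.read 10 (cell 23)) (.read 0 (.const 1)))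
        (.setNat 23 (.const 0) (.add (cell 23) (.const 1))))))

/-- Follow the table back at the current vertex, and determine the agent of this vertex. -/
def assignVertex : LoopProg :=
  -- `26[0]` saves the budget of the parent, which is overwritten next but still selects the table
  -- entries.
  .seq (.setNat 26 (.const 0) (.read 22 parent))
    (.seq (.setNat 22 parent (.sub (.sub (cell 26) (.read 11 (addr (cell 20) (cell 26))))
        (.read 12 (addr (cell 20) (cell 26)))))
      (.seq (.setNat 22 (cell 20) (.read 11 (addr (cell 20) (cell 26))))
        (.seq (.setNat 24 (cell 20) (.read 24 parent))
          (.seq (.when (.and (.and (.natLe (.const 1) (.read 13 (addr (cell 20) (cell 26))))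
                (.natLe (.read 13 (addr (cell 20) (cell 26))) (.const 1)))
              (natLt (cell 25) (.read 0 (.const 1))))
              (.seq (.setNat 24 (cell 20) (cell 25))
                (.setNat 25 (.const 0) (.add (cell 25) (.const 1)))))
            (.setNat 2 (.read 7 (cell 20)) (.read 24 (cell 20)))))))

/-- Follow the table back, and determine the agents of all vertices. -/
def assign : LoopProg :=
  .seq (.setNat 22 (.const 0) (cell 23))
    (.loop 43 (.seq (.setNat 20 (.const 0) (.add (cell 43) (.const 1)))
      (.when (.natLe (cell 20) (cell 0)) assignVertex)))

/-- The algorithm. -/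
def main : LoopProg :=
  -- At most `m * m` raises of the threshold are possible, so `M * M` attempts suffice. The table is
  -- then filled for the final threshold.
  .seq multiples (.seq numbering (.seq (.loop 40 (.loop 41 raiseThreshold))
    (.seq fillTable (.seq findLosers assign))))

end LoopProg

/-- The while-program of the algorithm. -/
def smmsProgram : Prog :=
  .seq (.setNat 3 (.const 0)
    (.add (.add (.read 0 (.const 0)) (.read 0 (.const 1))) (.const 1))) LoopProg.main.compile

theorem LoopProg.main_wellFormed : LoopProg.main.WellFormed := by
  simp [LoopProg.main, multiples, numbering, sweep, addVertex, raiseThreshold, fillTable, initTable,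
    processVertex, bestChoice, tryCandidate, computeCandidate, acceptCandidate, writeChoice,
    nextThreshold, findLosers, assign, assignVertex, WellFormed, natWrites]

/-! ### Evaluation rules for expressions, tests and programs -/

section SimpLemmas

variable {R : Type} (s : Memory R)

@[simp] theorem NatExp.eval_const (c : ℕ) : (NatExp.const c).eval s = c := rfl

@[simp] theorem NatExp.eval_read (a : ℕ) (e : NatExp) :
    (NatExp.read a e).eval s = s.nat a (e.eval s) := rfl

@[simp] theorem NatExp.eval_add (e f : NatExp) : (NatExp.add e f).eval s = e.eval s + f.eval s := rfl

@[simp] theorem NatExp.eval_sub (e f : NatExp) : (NatExp.sub e f).eval s = e.eval s - f.eval s := rfl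

@[simp] theorem LoopProg.eval_cell (a : ℕ) : (LoopProg.cell a).eval s = s.nat a 0 := rfl

@[simp] theorem LoopProg.eval_addr (e f : NatExp) :
    (LoopProg.addr e f).eval s = s.nat 5 (e.eval s) + f.eval s := rfl

@[simp] theorem LoopProg.eval_parent : LoopProg.parent.eval s = s.nat 8 (s.nat 20 0) := rfl

@[simp] theorem LoopProg.eval_rest (y : ℕ) :
    (LoopProg.rest y).eval s = s.nat 21 0 - s.nat 38 0 - y := rfl

variable [Zero R] [Add R] [Sub R]

@[simp] theorem ValExp.eval_zero : ValExp.zero.eval s = 0 := rfl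

@[simp] theorem ValExp.eval_read (a : ℕ) (e : NatExp) :
    (ValExp.read a e).eval s = s.val a (e.eval s) := rfl

@[simp] theorem ValExp.eval_add (e f : ValExp) : (ValExp.add e f).eval s = e.eval s + f.eval s := rfl

variable [LE R]

@[simp] theorem Test.holds_natLe (e f : NatExp) :
    (Test.natLe e f).holds s ↔ e.eval s ≤ f.eval s := Iff.rfl

@[simp] theorem Test.holds_valLe (e f : ValExp) :
    (Test.valLe e f).holds s ↔ e.eval s ≤ f.eval s := Iff.rfl

@[simp] theorem Test.holds_not (b : Test) : (Test.not b).holds s ↔ ¬ b.holds s := Iff.rfl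

@[simp] theorem Test.holds_and (b c : Test) : (Test.and b c).holds s ↔ b.holds s ∧ c.holds s :=
  Iff.rfl

@[simp] theorem LoopProg.holds_natLt (e f : NatExp) :
    (LoopProg.natLt e f).holds s ↔ e.eval s < f.eval s := Iff.rfl

namespace LoopProg

@[simp] theorem run_setNat (a : ℕ) (idx e : NatExp) :
    (setNat a idx e).run s = s.setNat a (idx.eval s) (e.eval s) := rfl

@[simp] theorem run_setVal (a : ℕ) (idx : NatExp) (e : ValExp) :
    (setVal a idx e).run s = s.setVal a (idx.eval s) (e.eval s) := rfl

@[simp] theorem run_seq (P Q : LoopProg) : (seq P Q).run s = Q.run (P.run s) := rfl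

variable {s} in
theorem run_when_pos {b : Test} (h : b.holds s) (P : LoopProg) : (when b P).run s = P.run s :=
  if_pos h

variable {s} in
theorem run_when_neg {b : Test} (h : ¬ b.holds s) (P : LoopProg) : (when b P).run s = s :=
  if_neg h

end LoopProg

end SimpLemmas

/-! ### Correctness of one step of the dynamic program -/

namespace LoopProg

section Verification

variable {R : Type} [AddCommGroup R] [LinearOrder R]

/-- An entry of the table in memory. -/
def table (M : ℕ) (s : Memory R) (j l : ℕ) : ℕ × R := (s.nat 10 (j * M + l), s.val 2 (j * M + l))

/-- The best choice in memory. -/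
def best (s : Memory R) : ℕ × R := (s.nat 14 0, s.val 3 0)

theorem add_mul_inj {M j l j' l' : ℕ} (hl : l < M) (hl' : l' < M) :
    j * M + l = j' * M + l' ↔ j = j' ∧ l = l' := by
  refine ⟨fun h => ?_, fun h => by rw [h.1, h.2]⟩
  have h1 : (j * M + l) / M = j := by
    rw [mul_comm, Nat.mul_add_div (by omega), Nat.div_eq_of_lt hl, add_zero]
  have h2 : (j' * M + l') / M = j' := by
    rw [mul_comm, Nat.mul_add_div (by omega), Nat.div_eq_of_lt hl', add_zero]
  have h3 : j = j' := by rw [← h1, h, h2]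
  subst h3
  exact ⟨rfl, by omega⟩

/-- A test of the weight collected at the current vertex. -/
def IsCutTest (y : ℕ) (b : Test) : Prop := y = 0 ∧ b = exceeds ∨ y = 1 ∧ b = reaches

/-- The value of the candidate for `x` losers below the current vertex and `y` at it. -/
noncomputable def candidate (M : ℕ) (s : Memory R) (x y : ℕ) : ℕ × R :=
  merge (s.val 5 0) y (table M s (s.nat 8 (s.nat 20 0)) (s.nat 21 0 - x - y))
    (table M s (s.nat 20 0) x)

theorem computeCandidate_spec {M y : ℕ} {b : Test} {s : Memory R} (hb : IsCutTest y b)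
    (hp : s.nat 5 (s.nat 8 (s.nat 20 0)) = s.nat 8 (s.nat 20 0) * M)
    (ht : s.nat 5 (s.nat 20 0) = s.nat 20 0 * M) :
    (((computeCandidate y b).run s).nat 18 0, ((computeCandidate y b).run s).val 4 0) =
      candidate M s (s.nat 38 0) y ∧
    (((computeCandidate y b).run s).nat 19 0 = 1 ↔
      CutTest (s.val 5 0) y (table M s (s.nat 20 0) (s.nat 38 0)).2) := by
  simp only [computeCandidate, run_seq]
  generalize hs : LoopProg.run (R := R) (.setVal 4 _ _) _ = s'
  have hh : b.holds s' ↔ CutTest (s.val 5 0) y (table M s (s.nat 20 0) (s.nat 38 0)).2 := by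
    rw [← hs]
    rcases hb with ⟨rfl, rfl⟩ | ⟨rfl, rfl⟩
    · simp [exceeds, CutTest, table, ht]
    · simpa [reaches, CutTest, table, ht] using le_of_lt
  by_cases h : b.holds s'
  · rw [run_when_pos h, candidate, merge, if_pos (hh.1 h), ← hs]
    have hc := hh.1 h
    simp only [table] at hc
    simp [table, hp, ht, hc]
  · rw [run_when_neg h, candidate, merge, if_neg fun h' => h (hh.2 h'), ← hs]
    have hc := mt hh.2 h
    simp only [table] at hc
    simp [table, hp, ht, hc]

theorem notBetter_holds (s : Memory R) :
    notBetter.holds s ↔ LexLe (s.nat 18 0, s.val 4 0) (best s) := by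
  simp only [notBetter, LexLe, best, Test.holds_and, Test.holds_natLe, Test.holds_not,
    Test.holds_valLe, eval_cell, ValExp.eval_read, NatExp.eval_const]
  constructor
  · rintro ⟨h1, h2⟩
    by_cases h3 : s.nat 14 0 ≤ s.nat 18 0
    · exact Or.inr ⟨by omega, by tauto⟩
    · left; omega
  · rintro (h | ⟨h1, h2⟩)
    · exact ⟨h.le, fun h' => by omega⟩
    · exact ⟨h1.le, fun h' => h'.2 h2⟩

/-- The best choice so far is one of the candidates. -/
structure IsAttained (M : ℕ) (s : Memory R) : Prop where
  le : s.nat 15 0 + s.nat 16 0 ≤ s.nat 21 0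
  eq : best s = candidate M s (s.nat 15 0) (s.nat 16 0)
  cut : s.nat 17 0 = 1 ↔ CutTest (s.val 5 0) (s.nat 16 0) (table M s (s.nat 20 0) (s.nat 15 0)).2

theorem tryCandidate_of_lt {y : ℕ} {b : Test} {s : Memory R} (h : s.nat 21 0 < s.nat 38 0 + y) :
    (tryCandidate y b).run s = s :=
  run_when_neg (by simpa using h) _

/-- The best choice has to be meaningful beforehand only if the candidate is compared with it, that
is, unless it is the candidate with no losers. -/
theorem tryCandidate_spec {M y : ℕ} {b : Test} {s : Memory R} (hb : IsCutTest y b)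
    (hp : s.nat 5 (s.nat 8 (s.nat 20 0)) = s.nat 8 (s.nat 20 0) * M)
    (ht : s.nat 5 (s.nat 20 0) = s.nat 20 0 * M) (hle : s.nat 38 0 + y ≤ s.nat 21 0)
    (hs : 1 ≤ s.nat 38 0 + y → IsAttained M s) :
    IsAttained M ((tryCandidate y b).run s) ∧
      LexLe (candidate M s (s.nat 38 0) y) (best ((tryCandidate y b).run s)) ∧
      (1 ≤ s.nat 38 0 + y → LexLe (best s) (best ((tryCandidate y b).run s))) := by
  obtain ⟨h1, h2⟩ := computeCandidate_spec hb hp ht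
  have hn : ∀ a, a ∉ [18, 19] → ((computeCandidate y b).run s).nat a = s.nat a := fun a ha =>
    run_nat_of_notMem (by simp [computeCandidate, natWrites] at ha ⊢; tauto) s
  have hv : ∀ a, a ≠ 4 → ((computeCandidate y b).run s).val a = s.val a := fun a ha =>
    run_val_of_notMem (by simpa [computeCandidate, valWrites] using ha) s
  rw [tryCandidate, run_when_pos (by simpa using hle), run_seq]
  set s' := (computeCandidate y b).run s
  by_cases hacc : 1 ≤ s.nat 38 0 + y ∧ notBetter.holds s'
  · rw [run_when_neg (by simpa [hn] using hacc)]
    have := hs hacc.1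
    have hbest : best s' = best s := by simp [best, hn, hv]
    have hcand : ∀ x y, candidate M s' x y = candidate M s x y := fun x y => by
      simp [candidate, table, hn, hv]
    refine ⟨⟨?_, ?_, ?_⟩, ?_, ?_⟩
    · simpa [hn] using this.le
    · rw [hbest, hcand, this.eq]; simp [hn]
    · simpa [hn, hv, table] using this.cut
    · rw [← h1]
      exact (notBetter_holds s').1 hacc.2
    · intro _
      rw [hbest]
      exact LexLe.refl _
  · rw [run_when_pos (by simpa [hn] using hacc)]
    have hbest : best ((acceptCandidate y).run s') = (s'.nat 18 0, s'.val 4 0) := by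
      simp [acceptCandidate, best]
    have hcand : ∀ x y', candidate M ((acceptCandidate y).run s') x y' = candidate M s x y' :=
      fun x y' => by simp [candidate, table, hn, hv, acceptCandidate]
    refine ⟨⟨?_, ?_, ?_⟩, ?_, ?_⟩
    · simpa [acceptCandidate, hn] using hle
    · rw [hbest, hcand, h1]; simp [acceptCandidate, hn]
    · simpa [acceptCandidate, table, hn, hv] using h2
    · rw [hbest, h1]
      exact LexLe.refl _
    · intro h
      rw [hbest]
      refine (LexLe.total _ _).resolve_right fun h' => hacc ⟨h, (notBetter_holds s').2 ?_⟩
      simpa [best, hn, hv] using h'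

theorem bestChoice_wellFormed : bestChoice.WellFormed := by
  simp [bestChoice, tryCandidate, computeCandidate, acceptCandidate, WellFormed, natWrites]

theorem bestChoice_nat (s : Memory R) {a : ℕ} (ha : a ∉ [38, 19, 18, 14, 15, 16, 17]) :
    (bestChoice.run s).nat a = s.nat a :=
  run_nat_of_notMem (by
    simp [bestChoice, tryCandidate, computeCandidate, acceptCandidate, natWrites] at ha ⊢
    tauto) s

theorem bestChoice_val (s : Memory R) {a : ℕ} (ha : a ∉ [3, 4]) :
    (bestChoice.run s).val a = s.val a :=
  run_val_of_notMem (by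
    simp [bestChoice, tryCandidate, computeCandidate, acceptCandidate, valWrites] at ha ⊢
    tauto) s

theorem bestChoice_spec {M : ℕ} {s : Memory R} (hM : s.nat 3 0 = M)
    (hp : s.nat 5 (s.nat 8 (s.nat 20 0)) = s.nat 8 (s.nat 20 0) * M)
    (ht : s.nat 5 (s.nat 20 0) = s.nat 20 0 * M) (hl : s.nat 21 0 < M) :
    IsAttained M (bestChoice.run s) ∧
      ∀ x y, y ≤ 1 → x + y ≤ s.nat 21 0 → LexLe (candidate M s x y) (best (bestChoice.run s)) := by
  -- Before the first round the best choice is undefined, hence the condition `0 < k`.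
  have key := loop_induction (s := s) bestChoice_wellFormed
    (fun k s' => (0 < k → IsAttained M s') ∧ ∀ x y, x < k → y ≤ 1 → x + y ≤ s.nat 21 0 →
      LexLe (candidate M s x y) (best s')) ?_ ?_ ?_
  · rw [hM] at key
    exact ⟨key.1 (by omega), fun x y hy hxy => key.2 x y (by omega) hy hxy⟩
  · rintro k s' x ⟨h1, h2⟩
    refine ⟨fun hk => ⟨?_, ?_, ?_⟩, h2⟩
    · simpa using (h1 hk).le
    · simpa [best, candidate, table] using (h1 hk).eq
    · simpa [table] using (h1 hk).cut
  · simp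
  · rintro k s' hk hn hv hk' ⟨h1, h2⟩
    have hn : ∀ a, a ∉ [38, 19, 18, 14, 15, 16, 17] → s'.nat a = s.nat a := fun a ha => hn a (by
      simp [tryCandidate, computeCandidate, acceptCandidate, natWrites] at ha ⊢
      tauto)
    have hv : ∀ a, a ∉ [3, 4] → s'.val a = s.val a := fun a ha => hv a (by
      simp [tryCandidate, computeCandidate, acceptCandidate, valWrites] at ha ⊢
      tauto)
    rw [run_seq]
    set s₁ := (tryCandidate 0 exceeds).run s' with hs₁
    have hn₁ : ∀ a, a ∉ [19, 18, 14, 15, 16, 17] → s₁.nat a = s'.nat a := fun a ha =>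
      run_nat_of_notMem (by
        simp [tryCandidate, computeCandidate, acceptCandidate, natWrites] at ha ⊢
        tauto) s'
    have hv₁ : ∀ a, a ∉ [3, 4] → s₁.val a = s'.val a := fun a ha =>
      run_val_of_notMem (by
        simp [tryCandidate, computeCandidate, acceptCandidate, valWrites] at ha ⊢
        tauto) s'
    have hc' : ∀ x y, candidate M s' x y = candidate M s x y := fun x y => by
      simp [candidate, table, hn, hv]
    have hc₁ : ∀ x y, candidate M s₁ x y = candidate M s x y := fun x y => by
      simp [candidate, table, hn, hv, hn₁, hv₁]
    have h21 : s'.nat 21 0 = s.nat 21 0 := by simp [hn]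
    have h21' : s₁.nat 21 0 = s.nat 21 0 := by simp [hn, hn₁]
    have h38 : s₁.nat 38 0 = k := by simp [hn₁, hk']
    by_cases hk0 : k ≤ s.nat 21 0
    · obtain ⟨a1, a2, a3⟩ := tryCandidate_spec (M := M) (s := s') (Or.inl ⟨rfl, rfl⟩)
        (by simpa [hn] using hp) (by simpa [hn] using ht) (by omega) (fun h => h1 (by omega))
      rw [← hs₁, hk', hc'] at a2
      rw [← hs₁, hk'] at a3
      rw [← hs₁] at a1
      have hold : ∀ x y, x < k → y ≤ 1 → x + y ≤ s.nat 21 0 →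
          LexLe (candidate M s x y) (best s₁) := fun x y hx hy hxy =>
        (h2 x y hx hy hxy).trans (a3 (by omega))
      by_cases hk1 : k + 1 ≤ s.nat 21 0
      · obtain ⟨b1, b2, b3⟩ := tryCandidate_spec (M := M) (s := s₁) (Or.inr ⟨rfl, rfl⟩)
          (by simpa [hn, hn₁] using hp) (by simpa [hn, hn₁] using ht) (by omega) (fun _ => a1)
        rw [h38, hc₁] at b2
        have b3 := b3 (by omega)
        refine ⟨fun _ => b1, fun x y hx hy hxy => ?_⟩
        rcases Nat.lt_or_ge x k with hxk | hxk
        · exact (hold x y hxk hy hxy).trans b3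
        · obtain rfl : x = k := by omega
          rcases Nat.eq_zero_or_pos y with rfl | hy0
          · exact a2.trans b3
          · obtain rfl : y = 1 := by omega
            exact b2
      · rw [tryCandidate_of_lt (by omega)]
        refine ⟨fun _ => a1, fun x y hx hy hxy => ?_⟩
        rcases Nat.lt_or_ge x k with hxk | hxk
        · exact hold x y hxk hy hxy
        · obtain rfl : x = k := by omega
          obtain rfl : y = 0 := by omega
          exact a2
    · have : s₁ = s' := tryCandidate_of_lt (by omega)
      rw [tryCandidate_of_lt (by omega), this]
      exact ⟨fun _ => h1 (by omega), fun x y hx hy hxy => h2 x y (by omega) hy hxy⟩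

/-- `e` is the best state of the vertex `p` with `l` losers after it has taken over the child `t`,
and `x`, `y`, `c` describe how it is attained. -/
structure IsBest (μ : R) (T : ℕ → ℕ → ℕ × R) (p t l : ℕ) (e : ℕ × R) (x y c : ℕ) : Prop where
  le : x + y ≤ l
  attained : e = merge μ y (T p (l - x - y)) (T t x)
  cut : c = 1 ↔ CutTest μ y (T t x).2
  dominates : ∀ x' y', y' ≤ 1 → x' + y' ≤ l → LexLe (merge μ y' (T p (l - x' - y')) (T t x')) e

/-- The effect of processing the vertex `t` with parent `p`. -/
structure IsProcessed (M p t : ℕ) (s s' : Memory R) : Prop where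
  best : ∀ l, l < M → IsBest (s.val 5 0) (table M s) p t l (table M s' p l)
    (s'.nat 11 (t * M + l)) (s'.nat 12 (t * M + l)) (s'.nat 13 (t * M + l))
  frame : ∀ j l, l < M → j ≠ p → table M s' j l = table M s j l
  row : ∀ a ∈ [11, 12, 13], ∀ j l, l < M → j ≠ t → s'.nat a (j * M + l) = s.nat a (j * M + l)

theorem processVertex_wellFormed : processVertex.WellFormed := by
  simp [processVertex, writeChoice, bestChoice, tryCandidate, computeCandidate, acceptCandidate,
    WellFormed, natWrites]

theorem processVertex_natWrites {a : ℕ}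
    (ha : a ∉ [37, 21, 38, 19, 18, 14, 15, 16, 17, 10, 11, 12, 13]) :
    a ∉ processVertex.natWrites := by
  simp [processVertex, writeChoice, bestChoice, tryCandidate, computeCandidate, acceptCandidate,
    natWrites] at ha ⊢
  tauto

theorem processVertex_valWrites {a : ℕ} (ha : a ∉ [2, 3, 4]) : a ∉ processVertex.valWrites := by
  simp [processVertex, writeChoice, bestChoice, tryCandidate, computeCandidate, acceptCandidate,
    valWrites] at ha ⊢
  tauto

theorem processVertex_spec {M p t : ℕ} {s : Memory R} (hM : s.nat 3 0 = M)
    (h20 : s.nat 20 0 = t) (h8 : s.nat 8 t = p) (hpt : p < t) (hp : s.nat 5 p = p * M)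
    (ht : s.nat 5 t = t * M) : IsProcessed M p t s (processVertex.run s) := by
  -- After `k` rounds the entries of the parent from `M - k` on are new, and all other entries of
  -- the table are still those of `s`.
  have key := loop_induction (s := s) processVertex_wellFormed
    (fun k s' => (∀ l, l < M → M - k ≤ l → IsBest (s.val 5 0) (table M s) p t l (table M s' p l)
        (s'.nat 11 (t * M + l)) (s'.nat 12 (t * M + l)) (s'.nat 13 (t * M + l))) ∧
      (∀ j l, l < M → (j = p → l < M - k) → table M s' j l = table M s j l) ∧
      ∀ a ∈ [11, 12, 13], ∀ j l, l < M → j ≠ t →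
        s'.nat a (j * M + l) = s.nat a (j * M + l)) ?_ ?_ ?_
  · rw [hM] at key
    exact ⟨fun l hl => key.1 l hl (by omega), fun j l hl hj => key.2.1 j l hl (by omega), key.2.2⟩
  · rintro k s' x ⟨h1, h2, h3⟩
    refine ⟨fun l hl hkl => ?_, fun j l hl hj => ?_, fun a ha j l hl hj => ?_⟩
    · simpa [table] using h1 l hl hkl
    · simpa [table] using h2 j l hl hj
    · rw [← h3 a ha j l hl hj]
      simp only [List.mem_cons, List.not_mem_nil, or_false] at ha
      rcases ha with rfl | rfl | rfl <;> simp
  · refine ⟨fun l hl hl' => by omega, fun j l _ _ => rfl, fun a ha j l _ _ => rfl⟩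
  · rintro k s' hk hn hv hk' ⟨h1, h2, h3⟩
    rw [hM] at hk
    have hn : ∀ a, a ∉ [37, 21, 38, 19, 18, 14, 15, 16, 17, 10, 11, 12, 13] →
        s'.nat a = s.nat a := fun a ha => hn a (processVertex_natWrites ha)
    have hv : ∀ a, a ∉ [2, 3, 4] → s'.val a = s.val a := fun a ha =>
      hv a (processVertex_valWrites ha)
    set l₀ := M - 1 - k with hl₀
    simp only [run_seq, run_setNat]
    have hs₁ : s'.setNat 21 (NatExp.eval s' (.const 0))
        (NatExp.eval s' (((cell 3).sub (.const 1)).sub (cell 37))) = s'.setNat 21 0 l₀ := by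
      simp [hn, hM, hk', hl₀]
    rw [hs₁]
    set s₁ := s'.setNat 21 0 l₀ with hs₁def
    have ht₁ : table M s₁ = table M s' := by
      funext j l; simp [table, hs₁def]
    have h20₁ : s₁.nat 20 0 = t := by simp [hs₁def, hn, h20]
    have h8₁ : s₁.nat 8 t = p := by simp [hs₁def, hn, h8]
    have h21₁ : s₁.nat 21 0 = l₀ := by simp [hs₁def]
    have h5₁ : s₁.nat 5 = s.nat 5 := by
      rw [hs₁def, Memory.setNat_nat_of_ne _ _ _ (by omega), hn _ (by simp)]
    have hμ₁ : s₁.val 5 0 = s.val 5 0 := by simp [hs₁def, hv]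
    obtain ⟨b1, b2⟩ := bestChoice_spec (M := M) (s := s₁) (by simp [hs₁def, hn, hM])
      (by rw [h20₁, h8₁, h5₁, hp]) (by rw [h20₁, h5₁, ht]) (by omega)
    have hn₂ : ∀ a, a ∉ [38, 19, 18, 14, 15, 16, 17] →
        (bestChoice.run s₁).nat a = s₁.nat a := fun a ha => bestChoice_nat s₁ ha
    have hv₂ : ∀ a, a ∉ [3, 4] → (bestChoice.run s₁).val a = s₁.val a := fun a ha =>
      bestChoice_val s₁ ha
    set s₂ := bestChoice.run s₁ with hs₂def
    have ht₂ : table M s₂ = table M s' := by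
      rw [← ht₁]; funext j l; simp [table, hn₂, hv₂]
    have h20₂ : s₂.nat 20 0 = t := by rw [hn₂ _ (by simp), h20₁]
    have h8₂ : s₂.nat 8 t = p := by rw [hn₂ _ (by simp), h8₁]
    have h21₂ : s₂.nat 21 0 = l₀ := by rw [hn₂ _ (by simp), h21₁]
    have h5₂ : s₂.nat 5 = s.nat 5 := by rw [hn₂ _ (by simp), h5₁]
    have hμ₂ : s₂.val 5 0 = s.val 5 0 := by rw [hv₂ _ (by simp), hμ₁]
    -- The candidates for `l₀` read entries of the parent up to `l₀` and the row of `t ≠ p`; all of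
    -- these are still old.
    have hcand : ∀ x y, x + y ≤ l₀ →
        merge (s.val 5 0) y (table M s' p (l₀ - x - y)) (table M s' t x) =
        merge (s.val 5 0) y (table M s p (l₀ - x - y)) (table M s t x) := by
      intro x y hxy
      rw [h2 p (l₀ - x - y) (by omega) (by omega), h2 t x (by omega) (by omega)]
    have hbest : IsBest (s.val 5 0) (table M s) p t l₀ (best s₂) (s₂.nat 15 0) (s₂.nat 16 0)
        (s₂.nat 17 0) := by
      obtain ⟨c1, c2, c3⟩ := b1
      simp only [candidate, h20₂, h8₂, h21₂, hμ₂, ht₂] at c1 c2 c3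
      simp only [candidate, h20₁, h8₁, h21₁, hμ₁, ht₁] at b2
      refine ⟨c1, ?_, ?_, fun x y hy hxy => ?_⟩
      · rw [c2, hcand _ _ c1]
      · rw [c3, h2 t _ (by omega) (by omega)]
      · rw [← hcand _ _ hxy]
        exact b2 x y hy hxy
    have htab : ∀ j l, l < M → table M (writeChoice.run s₂) j l =
        if j = p ∧ l = l₀ then best s₂ else table M s' j l := by
      intro j l hl
      rw [← ht₂]
      have := add_mul_inj (M := M) (j := j) (l := l) (j' := p) (l' := l₀) hl (by omega)
      simp only [writeChoice, table, run_seq, run_setNat, run_setVal]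
      simp [h20₂, h8₂, h21₂, h5₂, hp, this]
      split_ifs <;> simp [best]
    have hrow : ∀ a b, (a, b) ∈ [(11, 15), (12, 16), (13, 17)] → ∀ j l, l < M →
        (writeChoice.run s₂).nat a (j * M + l) =
          if j = t ∧ l = l₀ then s₂.nat b 0 else s'.nat a (j * M + l) := by
      intro a b hab j l hl
      have := add_mul_inj (M := M) (j := j) (l := l) (j' := t) (l' := l₀) hl (by omega)
      simp only [List.mem_cons, List.not_mem_nil, or_false, Prod.mk.injEq] at hab
      rcases hab with ⟨rfl, rfl⟩ | ⟨rfl, rfl⟩ | ⟨rfl, rfl⟩ <;>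
        simp [writeChoice, h20₂, h21₂, h5₂, ht, this, hn₂, hs₁def]
    refine ⟨fun l hl hkl => ?_, fun j l hl hj => ?_, fun a ha j l hl hj => ?_⟩
    · rw [htab p l hl, hrow 11 15 (by simp) t l hl, hrow 12 16 (by simp) t l hl,
        hrow 13 17 (by simp) t l hl]
      by_cases hll : l = l₀
      · simpa [hll] using hbest
      · simpa [hll] using h1 l hl (by omega)
    · rw [htab j l hl, if_neg (by omega), h2 j l hl (by omega)]
    · rw [← h3 a ha j l hl hj]
      simp only [List.mem_cons, List.not_mem_nil, or_false] at ha
      rcases ha with rfl | rfl | rfl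
      · rw [hrow 11 15 (by simp) j l hl, if_neg (by tauto)]
      · rw [hrow 12 16 (by simp) j l hl, if_neg (by tauto)]
      · rw [hrow 13 17 (by simp) j l hl, if_neg (by tauto)]

end Verification

/-! ### Correctness of the filling of the table -/

section Verification

variable {R : Type} [AddCommGroup R] [LinearOrder R]

theorem initTable_wellFormed : initTable.WellFormed := by
  simp [initTable, WellFormed, natWrites]

theorem initTable_spec {M : ℕ} {s : Memory R} (hM : s.nat 3 0 = M)
    (hoff : ∀ j, j < M → s.nat 5 j = j * M) :
    ∀ j l, j < M → l < M → table M (initTable.run s) j l = (0, s.val 1 j) := by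
  have key := loop_induction (s := s) initTable_wellFormed
    (fun k s' => ∀ j l, j < k → l < M → table M s' j l = (0, s.val 1 j)) ?_ ?_ ?_
  · rw [hM] at key
    exact key
  · intro k s' x h j l hj hl
    simpa [table] using h j l hj hl
  · intro j l hj
    omega
  · intro k s' hk hn hv hk' h
    rw [hM] at hk
    have key := loop_induction (s := s') initTable_wellFormed.2.2
      (fun i s'' => (∀ j l, j < k → l < M → table M s'' j l = (0, s.val 1 j)) ∧
        ∀ l, l < i → l < M → table M s'' k l = (0, s.val 1 k)) ?_ ?_ ?_
    · rw [hn 3 (by simp [natWrites]), hM] at key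
      intro j l hj hl
      rcases Nat.lt_or_ge j k with hjk | hjk
      · exact key.1 j l hjk hl
      · obtain rfl : j = k := by omega
        exact key.2 l hl hl
    · rintro i s'' x ⟨h1, h2⟩
      exact ⟨fun j l hj hl => by simpa [table] using h1 j l hj hl,
        fun l hl hl' => by simpa [table] using h2 l hl hl'⟩
    · exact ⟨h, fun l hl => by omega⟩
    · rintro i s'' hi hn' hv' hi' ⟨h1, h2⟩
      rw [hn 3 (by simp [natWrites]), hM] at hi
      have h34 : s''.nat 34 0 = k := by rw [hn' 34 (by simp [natWrites]), hk']
      have h5 : s''.nat 5 k = k * M := by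
        rw [hn' 5 (by simp [natWrites]), hn 5 (by simp [natWrites]), hoff k hk]
      have h1v : s''.val 1 = s.val 1 := by
        rw [hv' 1 (by simp [valWrites]), hv 1 (by simp [valWrites])]
      have htab : ∀ j l, l < M → table M ((seq
          (.setNat 10 (addr (cell 34) (cell 35)) (.const 0))
          (.setVal 2 (addr (cell 34) (cell 35)) (.read 1 (cell 34)))).run s'') j l =
          if j = k ∧ l = i then (0, s.val 1 k) else table M s'' j l := by
        intro j l hl
        have := add_mul_inj (j := j) (j' := k) hl hi
        simp [table, h34, hi', h5, this, h1v]
        split_ifs <;> rfl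
      refine ⟨fun j l hj hl => ?_, fun l hl hl' => ?_⟩
      · rw [htab j l hl, if_neg (by omega)]
        exact h1 j l hj hl
      · rw [htab k l hl']
        split_ifs with hli
        · rfl
        · exact h2 l (by omega) hl'

theorem fillTable_wellFormed : fillTable.WellFormed := by
  simp [fillTable, initTable, processVertex, writeChoice, bestChoice, tryCandidate,
    computeCandidate, acceptCandidate, WellFormed, natWrites]

theorem fillTable_natWrites {a : ℕ}
    (ha : a ∉ [34, 35, 36, 20, 37, 21, 38, 19, 18, 14, 15, 16, 17, 10, 11, 12, 13]) :
    a ∉ fillTable.natWrites := by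
  simp [fillTable, initTable, processVertex, writeChoice, bestChoice, tryCandidate,
    computeCandidate, acceptCandidate, natWrites] at ha ⊢
  tauto

theorem fillTable_valWrites {a : ℕ} (ha : a ∉ [2, 3, 4]) : a ∉ fillTable.valWrites := by
  simp [fillTable, initTable, processVertex, writeChoice, bestChoice, tryCandidate,
    computeCandidate, acceptCandidate, valWrites] at ha ⊢
  tauto

/-- Memory holds only the current state of the table, whereas `IsTable` speaks of all states; so the
history `g` is built up along the loop. The choices for `t` are written only when `t` is processed
and can therefore be read off at the end. -/
theorem fillTable_spec {m M : ℕ} {s : Memory R} (hM : s.nat 3 0 = M) (hm : s.nat 0 0 = m)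
    (hmM : m < M) (hoff : ∀ j, j < M → s.nat 5 j = j * M) (hpar : IsParent m (s.nat 8)) :
    ∃ g, IsTable m (s.nat 8) (s.val 1) (s.val 5 0) M g
        (fun t l => (fillTable.run s).nat 11 (t * M + l))
        (fun t l => (fillTable.run s).nat 12 (t * M + l))
        (fun t l => (fillTable.run s).nat 13 (t * M + l)) ∧
      ∀ j l, l < M → g m j l = table M (fillTable.run s) j l := by
  set s₀ := initTable.run s with hs₀
  have hn₀ : ∀ a, a ∉ [34, 35, 10] → s₀.nat a = s.nat a := fun a ha =>
    run_nat_of_notMem (by simpa [initTable, natWrites] using ha) s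
  have hv₀ : ∀ a, a ≠ 2 → s₀.val a = s.val a := fun a ha =>
    run_val_of_notMem (by simpa [initTable, valWrites] using ha) s
  have htab₀ := initTable_spec hM hoff
  rw [← hs₀] at htab₀
  -- After `k` rounds, `min m (k - (M - 1 - m))` vertices have been processed: the first `M - 1 - m`
  -- rounds meet numbers above `m`, and the last round meets `0`.
  have key := loop_induction (s := s₀) fillTable_wellFormed.2
    (fun k s' => ∃ g : ℕ → ℕ → ℕ → ℕ × R,
      (∀ j l, j ≤ m → l < M → g 0 j l = (0, s.val 1 j)) ∧
      (∀ i, i < min m (k - (M - 1 - m)) → ∀ l, l < M →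
        IsBest (s.val 5 0) (g i) (s.nat 8 (m - i)) (m - i) l (g (i + 1) (s.nat 8 (m - i)) l)
          (s'.nat 11 ((m - i) * M + l)) (s'.nat 12 ((m - i) * M + l))
          (s'.nat 13 ((m - i) * M + l))) ∧
      (∀ i, i < min m (k - (M - 1 - m)) → ∀ j l, l < M → j ≠ s.nat 8 (m - i) →
        g (i + 1) j l = g i j l) ∧
      ∀ j l, l < M → g (min m (k - (M - 1 - m))) j l = table M s' j l) ?_ ?_ ?_
  · rw [hn₀ 3 (by simp), hM, show min m (M - (M - 1 - m)) = m by omega] at key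
    obtain ⟨g, h1, h2, h3, h4⟩ := key
    refine ⟨g, ⟨fun j hj l hl => h1 j l hj hl, fun k hk j _ hjp l hl => h3 k hk j l hl hjp,
      fun k hk l hl => (h2 k hk l hl).le, fun k hk l hl => (h2 k hk l hl).attained,
      fun k hk l hl => (h2 k hk l hl).cut,
      fun k hk l hl x y hy hxy => (h2 k hk l hl).dominates x y hy hxy⟩, h4⟩
  · rintro k s' x ⟨g, h1, h2, h3, h4⟩
    refine ⟨g, h1, fun i hi l hl => ?_, h3, fun j l hl => ?_⟩
    · simpa using h2 i hi l hl
    · simpa [table] using h4 j l hl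
  · refine ⟨fun _ j l => table M s₀ j l, fun j l hj hl => htab₀ j l (by omega) hl,
      fun i hi => by omega, fun i hi => by omega, fun j l _ => rfl⟩
  · rintro k s' hk hn hv hk' ⟨g, h1, h2, h3, h4⟩
    rw [hn₀ 3 (by simp), hM] at hk
    have hn : ∀ a, a ∉ [36, 20, 37, 21, 38, 19, 18, 14, 15, 16, 17, 10, 11, 12, 13, 34, 35] →
        s'.nat a = s.nat a := fun a ha => by
      simp only [List.mem_cons, List.not_mem_nil, or_false, not_or] at ha
      rw [hn a, hn₀ a (by simp; omega)]
      simp only [natWrites, List.mem_cons, List.mem_append, not_or]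
      exact ⟨ha.1, by simp; omega, processVertex_natWrites (by simp; omega)⟩
    have hv : ∀ a, a ∉ [2, 3, 4] → s'.val a = s.val a := fun a ha => by
      rw [hv a, hv₀ a]
      · simp at ha; omega
      · simp only [valWrites, List.nil_append]
        exact processVertex_valWrites ha
    set t := M - 1 - k with ht
    have hs₁ : LoopProg.run (.setNat 20 (.const 0) (.sub (.sub (cell 3) (.const 1)) (cell 36))) s' =
        s'.setNat 20 0 t := by
      simp [hn, hM, hk', ht]
    rw [run_seq, hs₁]
    set s₁ := s'.setNat 20 0 t with hs₁def
    by_cases htm : 1 ≤ t ∧ t ≤ m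
    · rw [run_when_pos (by simpa [hs₁def, hn, hm] using htm)]
      have hpt := hpar t htm.1 htm.2
      obtain ⟨p1, p2, p3⟩ := processVertex_spec (M := M) (p := s.nat 8 t) (t := t) (s := s₁)
        (by simp [hs₁def, hn, hM]) (by simp [hs₁def]) (by simp [hs₁def, hn]) hpt
        (by simp [hs₁def, hn]; exact hoff _ (by omega)) (by simp [hs₁def, hn]; exact hoff _ (by omega))
      have hq : min m (k - (M - 1 - m)) = m - t := by omega
      have hq' : min m (k + 1 - (M - 1 - m)) = m - t + 1 := by omega
      have hmt : m - (m - t) = t := by omega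
      rw [hq] at h2 h3 h4
      rw [hq']
      have htab : ∀ j l, l < M → table M s₁ j l = g (m - t) j l := fun j l hl => by
        rw [h4 j l hl]; simp [hs₁def, table]
      have hμ₁ : s₁.val 5 0 = s.val 5 0 := by simp [hs₁def, hv]
      -- The old history, continued by the table after this step.
      refine ⟨fun i => if i ≤ m - t then g i else table M (processVertex.run s₁),
        ?_, ?_, ?_, ?_⟩
      · simpa using h1
      · intro i hi l hl
        rcases Nat.lt_or_ge i (m - t) with hi' | hi'
        · have h11 : ∀ a ∈ [11, 12, 13], (processVertex.run s₁).nat a ((m - i) * M + l) =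
              s'.nat a ((m - i) * M + l) := fun a ha => by
            rw [p3 a ha _ _ hl (by omega)]
            simp only [List.mem_cons, List.not_mem_nil, or_false] at ha
            rcases ha with rfl | rfl | rfl <;> simp [hs₁def]
          rw [h11 11 (by simp), h11 12 (by simp), h11 13 (by simp)]
          simpa [hi'.le, hi'] using h2 i hi' l hl
        · obtain rfl : i = m - t := by omega
          have := p1 l hl
          rw [hμ₁] at this
          simp only [le_refl, if_true, hmt, Nat.not_succ_le_self, if_false]
          obtain ⟨b1, b2, b3, b4⟩ := this
          rw [htab _ _ (by omega), htab _ _ (by omega)] at b2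
          rw [htab _ _ (by omega)] at b3
          refine ⟨b1, b2, b3, fun x y hy hxy => ?_⟩
          have := b4 x y hy hxy
          rwa [htab _ _ (by omega), htab _ _ (by omega)] at this
      · intro i hi j l hl hj
        rcases Nat.lt_or_ge i (m - t) with hi' | hi'
        · simpa [hi'.le, Nat.succ_le_iff.2 hi'] using h3 i hi' j l hl hj
        · obtain rfl : i = m - t := by omega
          rw [hmt] at hj
          simp only [le_refl, if_true, Nat.not_succ_le_self, if_false]
          rw [p2 j l hl hj, htab j l hl]
      · intro j l hl
        simp
    · rw [run_when_neg (by simpa [hs₁def, hn, hm] using htm)]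
      have hq : min m (k + 1 - (M - 1 - m)) = min m (k - (M - 1 - m)) := by omega
      rw [hq]
      refine ⟨g, h1, fun i hi l hl => ?_, h3, fun j l hl => ?_⟩
      · simpa [hs₁def] using h2 i hi l hl
      · simpa [hs₁def, table] using h4 j l hl

end Verification

/-! ### Correctness of the search for the maximin share -/

section Verification

variable {R : Type} [AddCommGroup R] [LinearOrder R]

theorem nextThreshold_wellFormed : nextThreshold.WellFormed := by
  simp [nextThreshold, WellFormed, natWrites]

/-- The next threshold is the least weight above the threshold. -/
theorem nextThreshold_spec {m M : ℕ} {s : Memory R} (hM : s.nat 3 0 = M) (hm : s.nat 0 0 = m)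
    (hmM : m < M) (hoff : ∀ j, j < M → s.nat 5 j = j * M) :
    (∀ t, 1 ≤ t → t ≤ m → s.val 5 0 < (table M s t 0).2 →
      (nextThreshold.run s).val 6 0 ≤ (table M s t 0).2) ∧
    ((∃ t, 1 ≤ t ∧ t ≤ m ∧ s.val 5 0 < (table M s t 0).2) →
      s.val 5 0 < (nextThreshold.run s).val 6 0 ∧
      ∃ t, 1 ≤ t ∧ t ≤ m ∧ (nextThreshold.run s).val 6 0 = (table M s t 0).2) := by
  set μ := s.val 5 0 with hμ
  set r : ℕ → R := fun t => (table M s t 0).2 with hr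
  set s₀ := (LoopProg.setVal 6 (.const 0) (.read 5 (.const 0))).run s with hs₀
  have key := loop_induction (s := s₀) nextThreshold_wellFormed.2
    (fun k s' => (s'.val 6 0 = μ ∧ ∀ t, 1 ≤ t → t ≤ m → t < k → ¬ μ < r t) ∨
      (μ < s'.val 6 0 ∧ (∃ t, 1 ≤ t ∧ t ≤ m ∧ s'.val 6 0 = r t) ∧
        ∀ t, 1 ≤ t → t ≤ m → t < k → μ < r t → s'.val 6 0 ≤ r t)) ?_ ?_ ?_
  · rw [show s₀.nat 3 0 = M by simp [hs₀, hM]] at key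
    change (∀ t, 1 ≤ t → t ≤ m → μ < r t → (nextThreshold.run s).val 6 0 ≤ r t) ∧
      ((∃ t, 1 ≤ t ∧ t ≤ m ∧ μ < r t) → μ < (nextThreshold.run s).val 6 0 ∧
        ∃ t, 1 ≤ t ∧ t ≤ m ∧ (nextThreshold.run s).val 6 0 = r t)
    rw [nextThreshold, run_seq, ← hs₀]
    rcases key with ⟨-, h2⟩ | ⟨h1, h2, h3⟩
    · exact ⟨fun t ht htm h => (h2 t ht htm (by omega) h).elim,
        fun ⟨t, ht, htm, h⟩ => (h2 t ht htm (by omega) h).elim⟩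
    · exact ⟨fun t ht htm h => h3 t ht htm (by omega) h, fun _ => ⟨h1, h2⟩⟩
  · intro k s' x h
    exact h
  · left
    exact ⟨by simp [hs₀, hμ], fun t _ _ h => by omega⟩
  · intro k s' hk hn hv hk' h
    rw [show s₀.nat 3 0 = M by simp [hs₀, hM]] at hk
    have hn : ∀ a, a ≠ 39 → s'.nat a = s.nat a := fun a ha => hn a (by simpa [natWrites] using ha)
    have hv : ∀ a, a ≠ 6 → s'.val a = s.val a := fun a ha => by
      rw [hv a (by simpa [valWrites] using ha), hs₀, run_setVal, Memory.setVal_val_of_ne _ _ _ ha]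
    have hrk : s'.val 2 (s'.nat 5 k) = r k := by
      simp [hn, hv, hoff k hk, hr, table]
    have hμ' : s'.val 5 0 = μ := by rw [hv 5 (by simp)]
    have hm' : s'.nat 0 0 = m := by rw [hn 0 (by simp), hm]
    by_cases hb : ((1 ≤ k ∧ k ≤ m) ∧ μ < r k ∧ ¬ (μ < s'.val 6 0 ∧ s'.val 6 0 ≤ r k))
    · rw [run_when_pos (by simpa [hk', hm', hrk, hμ'] using hb)]
      have h6 : (LoopProg.run (.setVal 6 (.const 0) (.read 2 (.read 5 (cell 39)))) s').val 6 0 =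
          r k := by
        simp [hk', hrk]
      rw [h6]
      right
      refine ⟨hb.2.1, ⟨k, hb.1.1, hb.1.2, rfl⟩, fun t ht htm htk hlt => ?_⟩
      rcases Nat.lt_or_ge t k with htk' | htk'
      · rcases h with ⟨-, h2⟩ | ⟨h1, -, h3⟩
        · exact (h2 t ht htm htk' hlt).elim
        · exact (not_le.1 fun h' => hb.2.2 ⟨h1, h'⟩).le.trans (h3 t ht htm htk' hlt)
      · obtain rfl : t = k := by omega
        exact le_rfl
    · rw [run_when_neg (by simpa [hk', hm', hrk, hμ'] using hb)]
      rcases h with ⟨h1, h2⟩ | ⟨h1, h2, h3⟩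
      · left
        refine ⟨h1, fun t ht htm htk hlt => ?_⟩
        rcases Nat.lt_or_ge t k with htk' | htk'
        · exact h2 t ht htm htk' hlt
        · obtain rfl : t = k := by omega
          exact hb ⟨⟨ht, htm⟩, hlt, fun h => (h1 ▸ h.1).false⟩
      · right
        refine ⟨h1, h2, fun t ht htm htk hlt => ?_⟩
        rcases Nat.lt_or_ge t k with htk' | htk'
        · exact h3 t ht htm htk' hlt
        · obtain rfl : t = k := by omega
          by_contra h'
          exact hb ⟨⟨ht, htm⟩, hlt, fun h => h' h.2⟩

/-- The vertices of the tree have been numbered. -/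
structure IsReady {m : ℕ} (n : ℕ) (G : SimpleGraph (Fin m)) (u : Finset (Fin m) → R)
    (s : Memory R) : Prop where
  vertices : s.nat 0 0 = m
  agents : s.nat 0 1 = n
  bound : s.nat 3 0 = m + n + 1
  offset : ∀ j, j < m + n + 1 → s.nat 5 j = j * (m + n + 1)
  rooting : IsRooting G (fun v => s.nat 6 v) (s.nat 8)
  weight : IsWeight (fun v => s.nat 6 v) u (s.val 1)
  inverse : ∀ v : Fin m, s.nat 7 (s.nat 6 v) = v

theorem IsReady.congr {m n : ℕ} {G : SimpleGraph (Fin m)} {u : Finset (Fin m) → R}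
    {s s' : Memory R} (h : IsReady n G u s)
    (hn : ∀ a ∈ [0, 3, 5, 6, 7, 8], s'.nat a = s.nat a) (hv : s'.val 1 = s.val 1) :
    IsReady n G u s' := by
  have h0 := hn 0 (by simp)
  have h3 := hn 3 (by simp)
  have h5 := hn 5 (by simp)
  have h6 := hn 6 (by simp)
  have h7 := hn 7 (by simp)
  have h8 := hn 8 (by simp)
  refine ⟨?_, ?_, ?_, ?_, ?_, ?_, ?_⟩
  · rw [h0, h.vertices]
  · rw [h0, h.agents]
  · rw [h3, h.bound]
  · rw [h5]; exact h.offset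
  · rw [h6, h8]; exact h.rooting
  · rw [h6, hv]; exact h.weight
  · rw [h6, h7]; exact h.inverse

theorem IsReady.fillTable {m n : ℕ} {G : SimpleGraph (Fin m)} {u : Finset (Fin m) → R}
    {s : Memory R} (h : IsReady n G u s) : IsReady n G u (fillTable.run s) :=
  h.congr (fun a ha => run_nat_of_notMem (fillTable_natWrites (by
    simp only [List.mem_cons, List.not_mem_nil, or_false] at ha ⊢
    omega)) s) (run_val_of_notMem (fillTable_valWrites (by simp)) s)

theorem raiseThreshold_wellFormed : raiseThreshold.WellFormed :=
  ⟨fillTable_wellFormed, nextThreshold_wellFormed, trivial⟩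

theorem raiseThreshold_natWrites {a : ℕ} (ha : a ∈ [0, 3, 5, 6, 7, 8, 24, 25, 40, 41]) :
    a ∉ raiseThreshold.natWrites := by
  simp only [raiseThreshold, natWrites, List.mem_append, not_or]
  refine ⟨fillTable_natWrites ?_, ?_⟩
  · simp only [List.mem_cons, List.not_mem_nil, or_false] at ha ⊢
    omega
  · simp [nextThreshold, natWrites] at ha ⊢
    omega

theorem raiseThreshold_valWrites : 1 ∉ raiseThreshold.valWrites := by
  simp only [raiseThreshold, valWrites, List.mem_append, not_or]
  exact ⟨fillTable_valWrites (by simp), by simp [nextThreshold, valWrites], by simp⟩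

theorem IsReady.raiseThreshold {m n : ℕ} {G : SimpleGraph (Fin m)} {u : Finset (Fin m) → R}
    {s : Memory R} (h : IsReady n G u s) : IsReady n G u (raiseThreshold.run s) :=
  h.congr (fun a ha => run_nat_of_notMem (raiseThreshold_natWrites (by
    simp only [List.mem_cons, List.not_mem_nil, or_false] at ha ⊢
    omega)) s) (run_val_of_notMem raiseThreshold_valWrites s)

variable [IsOrderedAddMonoid R]

/-- Some connected allocation gives at least `μ` to all agents. -/
def IsFeasible {m : ℕ} (n : ℕ) (G : SimpleGraph (Fin m)) (u : Finset (Fin m) → R) (μ : R) : Prop :=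
  ∃ B : Fin n → Finset (Fin m), IsConnectedAllocation G B ∧ ∀ i, μ ≤ u (B i)

/-- If at least `n ≥ 1` parts are finished, some weight exceeds the threshold, so there is a next
one. It is at most the weight of each finished part, hence feasible, and it is the weight of one of
them, hence the potential falls. -/
theorem raiseThreshold_spec {m n : ℕ} {G : SimpleGraph (Fin m)} {u : Finset (Fin m) → R}
    {s : Memory R} (h : IsReady n G u s) (hn : 1 ≤ n) (hμ : 0 ≤ s.val 5 0)
    (hf : IsFeasible n G u (s.val 5 0)) :
    0 ≤ (raiseThreshold.run s).val 5 0 ∧ IsFeasible n G u ((raiseThreshold.run s).val 5 0) ∧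
      ((greedy m (s.nat 8) (s.val 1) (s.val 5 0) m 0).1 < n →
        (raiseThreshold.run s).val 5 0 = s.val 5 0) ∧
      (n ≤ (greedy m (s.nat 8) (s.val 1) (s.val 5 0) m 0).1 →
        potential m (s.nat 8) (s.val 1) ((raiseThreshold.run s).val 5 0) <
          potential m (s.nat 8) (s.val 1) (s.val 5 0)) := by
  obtain ⟨g, hg, hgs⟩ := fillTable_spec h.bound h.vertices (by omega) h.offset h.rooting.isParent
  have hM : 0 < m + n + 1 := by omega
  have hr' := h.fillTable
  have h5 : (fillTable.run s).val 5 = s.val 5 := run_val_of_notMem (fillTable_valWrites (by simp)) s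
  obtain ⟨n1, n2⟩ := nextThreshold_spec hr'.bound hr'.vertices (by omega) hr'.offset
  set s' := fillTable.run s with hs'
  have hrow : ∀ t, t ≤ m → (table (m + n + 1) s' t 0).2 = (g (m - t) t 0).2 := fun t ht => by
    rw [hg.eq_last h.rooting.isParent ht hM, hgs t 0 hM]
  have hgr : g m 0 0 = greedy m (s.nat 8) (s.val 1) (s.val 5 0) m 0 :=
    hg.eq_greedy h.rooting.isParent hM le_rfl (by omega)
  have hA : s'.nat 10 0 = (greedy m (s.nat 8) (s.val 1) (s.val 5 0) m 0).1 := by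
    rw [← hgr, hgs 0 0 hM]
    simp [table]
  rw [raiseThreshold, run_seq, ← hs']
  by_cases hle : n ≤ (greedy m (s.nat 8) (s.val 1) (s.val 5 0) m 0).1
  · rw [run_when_pos (by simpa [hr'.agents, hA] using hle)]
    have hres : (LoopProg.run (.seq nextThreshold (.setVal 5 (.const 0) (.read 6 (.const 0))))
        s').val 5 0 = (nextThreshold.run s').val 6 0 := by simp
    rw [hres]
    rw [h5] at n1 n2
    have hex : ∃ t, 1 ≤ t ∧ t ≤ m ∧ s.val 5 0 < (table (m + n + 1) s' t 0).2 := by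
      have h1 := greedy_fst (m := m) (par := s.nat 8) (w := s.val 1) (μ := s.val 5 0) le_rfl 0
      rw [below_root h.rooting.isParent] at h1
      obtain ⟨t, ht, ht'⟩ := Finset.exists_ne_zero_of_sum_ne_zero
        (show ∑ t ∈ Finset.Icc 1 m, indic (fun t => s.val 5 0 <
          (greedy m (s.nat 8) (s.val 1) (s.val 5 0) (m - t) t).2) t ≠ 0 by omega)
      rw [Finset.mem_Icc] at ht
      refine ⟨t, ht.1, ht.2, ?_⟩
      rw [hrow t ht.2, hg.eq_greedy h.rooting.isParent hM (by omega) ht.2]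
      by_contra hlt
      rw [indic, if_neg hlt] at ht'
      exact ht' rfl
    obtain ⟨h1, t, ht, htm, h2⟩ := n2 hex
    refine ⟨(hμ.trans_lt h1).le, ?_, fun hlt => by omega, fun _ => ?_⟩
    · refine hg.exists_allocation h.rooting h.weight hM hn (by rw [hgr]; exact hle)
        fun t ht htm hlt => ?_
      rw [← hrow t htm] at hlt ⊢
      exact n1 t ht htm hlt
    · refine potential_lt h.weight.nonneg h1 ht htm ?_
      rw [h2, hrow t htm, hg.eq_greedy h.rooting.isParent hM (by omega) htm]
  · rw [run_when_neg (by simpa [hr'.agents, hA] using hle), h5]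
    exact ⟨hμ, hf, fun _ => rfl, fun h => (hle h).elim⟩

/-- The potential is at most `m * m` and falls with every raise, while the two loops make `(m + n +
1) * (m + n + 1)` attempts. So eventually fewer than `n` parts are found, and from then on the
threshold stays. -/
theorem rounds_spec {m n : ℕ} {G : SimpleGraph (Fin m)} {u : Finset (Fin m) → R}
    {s : Memory R} (h : IsReady n G u s) (hn : 1 ≤ n) (hμ : 0 ≤ s.val 5 0)
    (hf : IsFeasible n G u (s.val 5 0)) {s' : Memory R}
    (hs' : s' = LoopProg.run (.loop 40 (.loop 41 raiseThreshold)) s) :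
    IsReady n G u s' ∧ 0 ≤ s'.val 5 0 ∧ IsFeasible n G u (s'.val 5 0) ∧
      (greedy m (s'.nat 8) (s'.val 1) (s'.val 5 0) m 0).1 < n := by
  have hwf : (LoopProg.loop 40 (.loop 41 raiseThreshold)).WellFormed := by
    refine ⟨by omega, ?_, by omega, raiseThreshold_natWrites (by simp), raiseThreshold_wellFormed⟩
    simp only [natWrites, List.mem_cons, not_or]
    exact ⟨by omega, raiseThreshold_natWrites (by simp)⟩
  let I : ℕ → Memory R → Prop := fun k s' => IsReady n G u s' ∧ 0 ≤ s'.val 5 0 ∧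
    IsFeasible n G u (s'.val 5 0) ∧
    ((greedy m (s'.nat 8) (s'.val 1) (s'.val 5 0) m 0).1 < n ∨
      potential m (s'.nat 8) (s'.val 1) (s'.val 5 0) + k ≤ m * m)
  have hI : ∀ a ∈ [40, 41], ∀ k s' x, I k s' → I k (s'.setNat a 0 x) := by
    rintro a ha k s' x ⟨h1, h2, h3, h4⟩
    simp only [List.mem_cons, List.not_mem_nil, or_false] at ha
    refine ⟨h1.congr (fun b hb => ?_) rfl, h2, h3, ?_⟩
    · simp only [List.mem_cons, List.not_mem_nil, or_false] at hb
      exact Memory.setNat_nat_of_ne _ _ _ (by omega)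
    · rwa [Memory.setNat_nat_of_ne _ _ _ (by omega)]
  have hstep : ∀ k s', I k s' → I (k + 1) (raiseThreshold.run s') := by
    rintro k s' ⟨h1, h2, h3, h4⟩
    obtain ⟨r1, r2, r3, r4⟩ := raiseThreshold_spec h1 hn h2 h3
    refine ⟨h1.raiseThreshold, r1, r2, ?_⟩
    rw [run_nat_of_notMem (raiseThreshold_natWrites (by simp)),
      run_val_of_notMem raiseThreshold_valWrites]
    rcases Nat.lt_or_ge (greedy m (s'.nat 8) (s'.val 1) (s'.val 5 0) m 0).1 n with h5 | h5
    · rw [r3 h5]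
      exact Or.inl h5
    · have := r4 h5
      right
      omega
  have key := loop_induction (s := s) hwf (fun k s' => I (k * (m + n + 1)) s')
    (fun k s' x => hI 40 (by simp) _ s' x) ?_ ?_
  · rw [h.bound, ← hs'] at key
    obtain ⟨h1, h2, h3, h4⟩ := key
    refine ⟨h1, h2, h3, h4.resolve_right fun h5 => ?_⟩
    have := Nat.mul_lt_mul'' (show m < m + n + 1 by omega) (show m < m + n + 1 by omega)
    omega
  · refine ⟨h, hμ, hf, Or.inr ?_⟩
    simpa using potential_le h.rooting.isParent
  · intro k s' _ _ _ _ hIk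
    have hb := hIk.1.bound
    have key := loop_induction (s := s') hwf.2.2 (fun i s'' => I (k * (m + n + 1) + i) s'')
      (fun i s'' x => hI 41 (by simp) _ s'' x) hIk
      (fun i s'' _ _ _ _ hi => hstep _ _ hi)
    rw [hb] at key
    simpa [add_mul] using key

end Verification

/-! ### The least number of losers, and the traceback -/

section Verification

variable {R : Type} [AddCommGroup R] [LinearOrder R]

theorem findLosers_natWrites {a : ℕ} (ha : a ∉ [23, 42]) : a ∉ findLosers.natWrites := by
  simp [findLosers, natWrites] at ha ⊢
  omega

theorem findLosers_val (s : Memory R) : (findLosers.run s).val = s.val := by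
  funext a
  exact run_val_of_notMem (by simp [findLosers, valWrites]) s

/-- By `hex` the least sufficient budget is at most `n < M`, so the search reaches it within the `M`
rounds of the loop. -/
theorem findLosers_spec {n M : ℕ} {s : Memory R} (hM : s.nat 3 0 = M) (hn : s.nat 0 1 = n)
    (hnM : n < M) (hex : 0 < s.val 5 0 → ∃ l ≤ n, n ≤ s.nat 10 l) :
    (findLosers.run s).nat 23 0 < M ∧
    (0 < s.val 5 0 → n ≤ s.nat 10 ((findLosers.run s).nat 23 0) ∧
      ∀ l < (findLosers.run s).nat 23 0, s.nat 10 l < n) ∧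
    (¬ 0 < s.val 5 0 → (findLosers.run s).nat 23 0 = 0) := by
  rw [findLosers, run_seq]
  set s₀ := (LoopProg.setNat 23 (.const 0) (.const 0)).run s with hs₀
  by_cases hμ : 0 < s.val 5 0
  · rw [run_when_pos (by simpa [hs₀] using hμ)]
    have key := loop_induction (s := s₀) (c := 42) (P := .when (natLt (.read 10 (cell 23))
      (.read 0 (.const 1))) (.setNat 23 (.const 0) (.add (cell 23) (.const 1))))
      (by simp [WellFormed, natWrites])
      (fun k s' => (∀ l < s'.nat 23 0, s.nat 10 l < n) ∧
        (n ≤ s.nat 10 (s'.nat 23 0) ∨ s'.nat 23 0 = k)) ?_ ?_ ?_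
    · rw [show s₀.nat 3 0 = M by simp [hs₀, hM]] at key
      set l := (LoopProg.run (.loop 42 (.when (natLt (.read 10 (cell 23))
        (.read 0 (.const 1))) (.setNat 23 (.const 0) (.add (cell 23) (.const 1))))) s₀).nat 23 0
      obtain ⟨h1, h2⟩ := key
      obtain ⟨l', hl', hl''⟩ := hex hμ
      have h3 : l ≤ l' := by
        by_contra! h
        have := h1 l' h
        omega
      exact ⟨by omega, fun _ => ⟨h2.resolve_right (by omega), h1⟩, fun h => (h hμ).elim⟩
    · intro k s' x h
      simpa using h
    · simp [hs₀]
    · rintro k s' hk hn' hv' hk' ⟨h1, h2⟩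
      have h10 : s'.nat 10 = s.nat 10 := by
        rw [hn' 10 (by simp [natWrites]), hs₀, run_setNat,
          Memory.setNat_nat_of_ne _ _ _ (by omega)]
      have h0 : s'.nat 0 1 = n := by
        rw [hn' 0 (by simp [natWrites]), hs₀, run_setNat,
          Memory.setNat_nat_of_ne _ _ _ (by omega), hn]
      by_cases hlt : s.nat 10 (s'.nat 23 0) < n
      · rw [run_when_pos (by simpa [h10, h0] using hlt)]
        have : (LoopProg.run (.setNat 23 (.const 0) (.add (cell 23) (.const 1))) s').nat 23 0 =
            s'.nat 23 0 + 1 := by simp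
        rw [this]
        refine ⟨fun l hl => ?_, Or.inr (by omega)⟩
        rcases Nat.lt_or_ge l (s'.nat 23 0) with h | h
        · exact h1 l h
        · rwa [show l = s'.nat 23 0 by omega]
      · rw [run_when_neg (by simpa [h10, h0] using hlt)]
        exact ⟨h1, Or.inl (not_lt.1 hlt)⟩
  · rw [run_when_neg (by simpa [hs₀] using hμ)]
    have : s₀.nat 23 0 = 0 := by simp [hs₀]
    rw [this]
    exact ⟨by omega, fun h => (hμ h).elim, fun _ => rfl⟩

/-- The numbers of losers that remain below the vertices after the table has been followed back at
the vertices `1, …, i`. -/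
def traceRem (par : ℕ → ℕ) (X Y : ℕ → ℕ → ℕ) (r : ℕ → ℕ) : ℕ → ℕ → ℕ
  | 0 => r
  | i + 1 =>
    Function.update
      (Function.update (traceRem par X Y r i) (par (i + 1))
        (traceRem par X Y r i (par (i + 1)) - X (i + 1) (traceRem par X Y r i (par (i + 1))) -
          Y (i + 1) (traceRem par X Y r i (par (i + 1)))))
      (i + 1) (X (i + 1) (traceRem par X Y r i (par (i + 1))))

/-- The traceback visits `1, …, m`, opposite to the filling, so the state after `k` steps of the
table corresponds to `m - k` visited vertices. At the visit of `t`, the budget of its parent is the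
one left by the visits before. -/
theorem isTraceback_traceRem {m L : ℕ} {par : ℕ → ℕ} {X Y : ℕ → ℕ → ℕ} (K : ℕ → ℕ → ℕ) {r : ℕ → ℕ}
    (hpar : IsParent m par) (hr : r 0 < L) :
    IsTraceback m par L X Y K (fun k => traceRem par X Y r (m - k))
      fun t => K t (traceRem par X Y r (t - 1) (par t)) = 1 := by
  have hk : ∀ k, k < m → m - k = m - (k + 1) + 1 := fun k hk => by omega
  refine ⟨by simpa [traceRem] using hr, fun k h => ?_, fun k h => ?_, fun k h j hj hjp => ?_,
    fun k h => ?_⟩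
  · have := hpar (m - k) (by omega) (by omega)
    rw [hk k h, traceRem]
    simp
  · have := hpar (m - k) (by omega) (by omega)
    rw [hk k h] at this ⊢
    rw [traceRem, Function.update_of_ne this.ne]
    simp
  · rw [hk k h] at hj hjp ⊢
    rw [traceRem, Function.update_of_ne hj.ne, Function.update_of_ne hjp]
  · rw [show m - k - 1 = m - (k + 1) by omega]

theorem assign_wellFormed : assign.WellFormed := by
  simp [assign, assignVertex, WellFormed, natWrites]

theorem assign_spec {m n : ℕ} {G : SimpleGraph (Fin m)} {u : Finset (Fin m) → R} {s : Memory R}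
    (h : IsReady n G u s) (h24 : s.nat 24 0 = 0) (h25 : s.nat 25 0 = 0)
    (h23 : s.nat 23 0 < m + n + 1) :
    ∃ rem C agent c, IsTraceback m (s.nat 8) (m + n + 1)
        (fun t l => s.nat 11 (t * (m + n + 1) + l)) (fun t l => s.nat 12 (t * (m + n + 1) + l))
        (fun t l => s.nat 13 (t * (m + n + 1) + l)) rem C ∧
      rem m 0 = s.nat 23 0 ∧ IsAssignment m n (s.nat 8) C agent c ∧
      ∀ v : Fin m, (assign.run s).nat 2 v = agent (s.nat 6 v) := by
  set M := m + n + 1 with hMdef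
  set s₀ := (LoopProg.setNat 22 (.const 0) (cell 23)).run s with hs₀
  set par := s.nat 8 with hpardef
  set X : ℕ → ℕ → ℕ := fun t l => s.nat 11 (t * M + l) with hX
  set Y : ℕ → ℕ → ℕ := fun t l => s.nat 12 (t * M + l) with hY
  set K : ℕ → ℕ → ℕ := fun t l => s.nat 13 (t * M + l) with hK
  have h3M : s₀.nat 3 0 = M := by simp [hs₀, h.bound, hMdef]
  have hr0 : s₀.nat 22 0 = s.nat 23 0 := by simp [hs₀]
  have htr := isTraceback_traceRem (X := X) (Y := Y) K (r := s₀.nat 22) (L := M)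
    h.rooting.isParent (by omega)
  set C : ℕ → Prop := fun t => K t (traceRem par X Y (s₀.nat 22) (t - 1) (par t)) = 1 with hC
  -- Only `m` of the `M` rounds visit a vertex, hence `min k m`. The agents can be described by the
  -- current array because the entries of visited vertices never change again.
  have key := loop_induction (s := s₀) assign_wellFormed.2
    (fun k s' => (∀ j, s'.nat 22 j = traceRem par X Y (s₀.nat 22) (min k m) j) ∧
      s'.nat 25 0 = IsAssignment.served n C (min k m + 1) ∧ s'.nat 24 0 = 0 ∧
      (∀ t, 1 ≤ t → t ≤ min k m →
        (C t ∧ IsAssignment.served n C t < n → s'.nat 24 t = IsAssignment.served n C t) ∧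
        (¬ (C t ∧ IsAssignment.served n C t < n) → s'.nat 24 t = s'.nat 24 (par t))) ∧
      ∀ v : Fin m, s.nat 6 v ≤ min k m → s'.nat 2 v = s'.nat 24 (s.nat 6 v)) ?_ ?_ ?_
  · rw [h3M, show min M m = m by omega] at key
    obtain ⟨-, h2, h3, h4, h5⟩ := key
    refine ⟨_, C, _, IsAssignment.served n C, htr, by simpa [traceRem] using hr0,
      ⟨h3, IsAssignment.served_one n C,
        fun t ht htm hCt hn => ⟨(h4 t ht htm).1 ⟨hCt, hn⟩, IsAssignment.served_of_cut ht hCt hn⟩,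
        fun t ht htm hCt => ⟨(h4 t ht htm).2 hCt, IsAssignment.served_of_keep ht hCt⟩⟩,
      fun v => h5 v (h.rooting.le v)⟩
  · intro k s' x hI
    simpa using hI
  · refine ⟨fun j => by simp [traceRem], ?_, ?_, fun t ht ht' => by omega, fun v hv => ?_⟩
    · simp [hs₀, h25, IsAssignment.served_one]
    · simp [hs₀, h24]
    · have : 1 ≤ s.nat 6 v := h.rooting.one_le v
      omega
  · rintro k s' hk hn hv hk' ⟨h1, h2, h3, h4, h5⟩
    rw [h3M] at hk
    have hn : ∀ a, a ∉ [43, 20, 26, 22, 24, 25, 2] → s'.nat a = s.nat a := fun a ha => by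
      simp only [List.mem_cons, List.not_mem_nil, or_false, not_or] at ha
      rw [hn a (by simp [assignVertex, natWrites]; tauto), hs₀, run_setNat,
        Memory.setNat_nat_of_ne _ _ _ (by omega)]
    have hs₁ : LoopProg.run (.setNat 20 (.const 0) (.add (cell 43) (.const 1))) s' =
        s'.setNat 20 0 (k + 1) := by
      simp [hk']
    rw [run_seq, hs₁]
    set s₁ := s'.setNat 20 0 (k + 1) with hs₁def
    by_cases hkm : k + 1 ≤ m
    · rw [run_when_pos (by simpa [hs₁def, hn, h.vertices] using hkm)]
      rw [show min k m = k by omega] at h1 h2 h4 h5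
      rw [show min (k + 1) m = k + 1 by omega]
      have hpt := h.rooting.isParent (k + 1) (by omega) hkm
      set p := par (k + 1) with hp
      set b := s'.nat 22 p with hb
      have h8 : s.nat 8 (k + 1) = p := rfl
      have h5off : s.nat 5 (k + 1) = (k + 1) * M := h.offset _ (by omega)
      have hCk : C (k + 1) ↔ s.nat 13 ((k + 1) * M + b) = 1 := by
        simp only [hC, hK, Nat.add_sub_cancel, ← h1, ← hp, ← hb]
      have hsn : s'.nat 25 0 = IsAssignment.served n C (k + 1) := h2
      have hfin : ∀ s₂ : Memory R, s₂ = assignVertex.run s₁ →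
          (∀ j, s₂.nat 22 j = if j = k + 1 then s.nat 11 ((k + 1) * M + b) else if j = p then
            b - s.nat 11 ((k + 1) * M + b) - s.nat 12 ((k + 1) * M + b) else s'.nat 22 j) ∧
          (C (k + 1) ∧ s'.nat 25 0 < n → s₂.nat 24 (k + 1) = s'.nat 25 0 ∧
            s₂.nat 25 0 = s'.nat 25 0 + 1) ∧
          (¬ (C (k + 1) ∧ s'.nat 25 0 < n) → s₂.nat 24 (k + 1) = s'.nat 24 p ∧
            s₂.nat 25 0 = s'.nat 25 0) ∧
          (∀ t, t ≠ k + 1 → s₂.nat 24 t = s'.nat 24 t) ∧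
          ∀ j, s₂.nat 2 j = if j = s.nat 7 (k + 1) then s₂.nat 24 (k + 1) else s'.nat 2 j := by
        rintro _ rfl
        simp only [assignVertex, run_seq]
        generalize hs₃ : LoopProg.run (R := R) (.setNat 24 (cell 20) (.read 24 parent)) _ = s₃
        have ht : s₃.nat 13 ((k + 1) * M + b) = s.nat 13 ((k + 1) * M + b) ∧
            s₃.nat 5 (k + 1) = (k + 1) * M ∧ s₃.nat 26 0 = b ∧ s₃.nat 20 0 = k + 1 ∧
            s₃.nat 0 1 = n ∧ s₃.nat 25 0 = s'.nat 25 0 ∧ s₃.nat 7 (k + 1) = s.nat 7 (k + 1) ∧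
            s₃.nat 24 (k + 1) = s'.nat 24 p ∧
            (∀ t, t ≠ k + 1 → s₃.nat 24 t = s'.nat 24 t) ∧ s₃.nat 2 = s'.nat 2 ∧
            ∀ j, s₃.nat 22 j = if j = k + 1 then s.nat 11 ((k + 1) * M + b) else if j = p then
              b - s.nat 11 ((k + 1) * M + b) - s.nat 12 ((k + 1) * M + b) else s'.nat 22 j := by
          rw [← hs₃]
          refine ⟨?_, ?_, ?_, ?_, ?_, ?_, ?_, ?_, ?_, ?_, ?_⟩
          · simp [hs₁def, hn]
          · simp [hs₁def, hn, h5off]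
          · simp [hs₁def, hn, h8, hb]
          · simp [hs₁def]
          · simp [hs₁def, hn, h.agents]
          · simp [hs₁def]
          · simp [hs₁def, hn]
          · simp [hs₁def, hn, h8]
          · intro t ht
            simp [hs₁def, ht]
          · simp [hs₁def, Memory.setNat]
          · intro j
            simp [hs₁def, hn, h8, ← hb, h5off]
        obtain ⟨e13, e5, e26, e20, e0, e25, e7, e24, e24', e2, e22⟩ := ht
        by_cases hcut : C (k + 1) ∧ s'.nat 25 0 < n
        · have hcut' := hcut
          rw [hCk] at hcut'
          rw [run_when_pos (by simp [e13, e5, e26, e20, e0, e25, hcut'])]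
          refine ⟨fun j => ?_, fun _ => ?_, fun h' => (h' hcut).elim, fun t ht => ?_, fun j => ?_⟩
          · simp [← e22]
          · simp [e20, e25]
          · simp [e20, ht, e24']
          · simp [e20, e7, e2]
        · have hcut' := hcut
          rw [hCk] at hcut'
          rw [run_when_neg (by
            simp only [Test.holds_and, Test.holds_natLe, holds_natLt, NatExp.eval_const,
              NatExp.eval_read, eval_addr, eval_cell, e13, e5, e26, e20, e0, e25]
            rintro ⟨⟨h6, h7⟩, h8⟩
            exact hcut' ⟨le_antisymm h7 h6, h8⟩)]
          refine ⟨fun j => ?_, fun h' => (hcut h').elim, fun _ => ?_, fun t ht => ?_, fun j => ?_⟩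
          · simp [← e22]
          · simp [e24, e25]
          · simp [ht, e24']
          · simp [e20, e7, e2]
      obtain ⟨f1, f2, f3, f4, f5⟩ := hfin _ rfl
      set s₂ := assignVertex.run s₁
      rw [hsn] at f2 f3
      refine ⟨fun j => ?_, ?_, ?_, fun t ht htk => ?_, fun v hvk => ?_⟩
      · rw [f1 j, traceRem, ← h1, ← hp, ← hb, Function.update_apply, Function.update_apply, ← h1]
      · by_cases hcut : C (k + 1) ∧ IsAssignment.served n C (k + 1) < n
        · rw [(f2 hcut).2, IsAssignment.served_of_cut (by omega) hcut.1 hcut.2]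
        · rw [(f3 hcut).2, IsAssignment.served_of_keep (by omega) hcut]
      · rw [f4 0 (by omega), h3]
      · have hpt' : par t < t := h.rooting.isParent t ht (by omega)
        rw [f4 (par t) (by omega)]
        rcases Nat.lt_or_ge t (k + 1) with hlt | hge
        · rw [f4 t (by omega)]
          exact h4 t ht (by omega)
        · obtain rfl : t = k + 1 := by omega
          exact ⟨fun hcut => (f2 hcut).1, fun hcut => (f3 hcut).1⟩
      · rw [f5]
        by_cases hvk' : s.nat 6 v = k + 1
        · rw [if_pos (by rw [← hvk', h.inverse]), hvk']
        · rw [if_neg, f4 _ hvk', h5 v (by omega)]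
          -- The output of another vertex is not overwritten: since the array `7` inverts the
          -- numbering, that vertex would have the number `k + 1` too.
          intro hv7
          obtain ⟨x, hx⟩ := exists_pos_eq h.rooting.inj h.rooting.one_le h.rooting.le
            (t := k + 1) (by omega) hkm
          have hx : s.nat 6 x = k + 1 := hx
          rw [← hx, h.inverse] at hv7
          exact hvk' (by rw [Fin.ext hv7, hx])
    · rw [run_when_neg (by simpa [hs₁def, hn, h.vertices] using hkm)]
      rw [show min (k + 1) m = min k m by omega]
      have e22 : s₁.nat 22 = s'.nat 22 := Memory.setNat_nat_of_ne _ _ _ (by omega)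
      have e24 : s₁.nat 24 = s'.nat 24 := Memory.setNat_nat_of_ne _ _ _ (by omega)
      have e25 : s₁.nat 25 = s'.nat 25 := Memory.setNat_nat_of_ne _ _ _ (by omega)
      have e2 : s₁.nat 2 = s'.nat 2 := Memory.setNat_nat_of_ne _ _ _ (by omega)
      rw [e22, e24, e25, e2]
      exact ⟨h1, h2, h3, h4, h5⟩

end Verification

/-! ### Numbering the vertices of the tree -/

section Verification

variable {R : Type} [AddCommGroup R] [LinearOrder R]

theorem multiples_wellFormed : multiples.WellFormed := by
  simp [multiples, WellFormed, natWrites]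

theorem multiples_spec {m M : ℕ} {s : Memory R} (hM : s.nat 3 0 = M) (hm : s.nat 0 0 = m)
    (h4 : s.nat 4 0 = 0) (h5 : s.nat 5 0 = 0) :
    ∀ j, j ≤ M → (multiples.run s).nat 4 j = j * m ∧ (multiples.run s).nat 5 j = j * M := by
  have key := loop_induction (s := s) multiples_wellFormed
    (fun k s' => ∀ j, j ≤ k → s'.nat 4 j = j * m ∧ s'.nat 5 j = j * M) ?_ ?_ ?_
  · rwa [hM] at key
  · intro k s' x h j hj
    simpa using h j hj
  · intro j hj
    obtain rfl : j = 0 := by omega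
    simp [h4, h5]
  · intro k s' _ hn _ hk' h j hj
    have h0 : s'.nat 0 0 = m := by rw [hn 0 (by simp [natWrites]), hm]
    have h3 : s'.nat 3 0 = M := by rw [hn 3 (by simp [natWrites]), hM]
    obtain ⟨h1, h2⟩ := h k le_rfl
    by_cases hjk : j = k + 1
    · subst hjk
      simp [hk', h0, h3, h1, h2, add_mul]
    · simpa [hk', hjk] using h j (by omega)

/-- Some of the vertices have been numbered. -/
structure IsNumbering {m : ℕ} (G : SimpleGraph (Fin m)) (u : Finset (Fin m) → R)
    (s : Memory R) : Prop where
  vertices : s.nat 0 0 = m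
  offset : ∀ i, i < m → s.nat 4 i = i * m
  adj : ∀ v w : Fin m, 1 ≤ s.nat 1 (v * m + w) ↔ G.Adj v w
  utility : ∀ v : Fin m, s.val 0 v = u {v}
  one_le : 1 ≤ s.nat 9 0
  le : ∀ v : Fin m, s.nat 6 v ≤ s.nat 9 0
  inverse : ∀ v : Fin m, 1 ≤ s.nat 6 v → s.nat 7 (s.nat 6 v) = v
  weight : ∀ t, 1 ≤ t → t ≤ s.nat 9 0 → ∃ v : Fin m, s.nat 6 v = t ∧ s.val 1 t = u {v}
  isParent : ∀ t, 1 ≤ t → t ≤ s.nat 9 0 → s.nat 8 t < t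
  parent_adj : ∀ t, 2 ≤ t → t ≤ s.nat 9 0 → ∃ v w : Fin m, s.nat 6 v = t ∧ s.nat 6 w = s.nat 8 t ∧
    1 ≤ s.nat 8 t ∧ G.Adj v w
  nonneg : ∀ i, 0 ≤ s.val 1 i

theorem IsNumbering.congr {m : ℕ} {G : SimpleGraph (Fin m)} {u : Finset (Fin m) → R}
    {s s' : Memory R} (h : IsNumbering G u s)
    (hn : ∀ a ∈ [0, 1, 4, 6, 7, 8, 9], s'.nat a = s.nat a) (hv : s'.val = s.val) :
    IsNumbering G u s' := by
  have h0 := hn 0 (by simp)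
  have h1 := hn 1 (by simp)
  have h4 := hn 4 (by simp)
  have h6 := hn 6 (by simp)
  have h7 := hn 7 (by simp)
  have h8 := hn 8 (by simp)
  have h9 := hn 9 (by simp)
  obtain ⟨a1, a2, a3, a4, a5, a6, a7, a8, a9, a10, a11⟩ := h
  constructor <;> simp only [h0, h1, h4, h6, h7, h8, h9, hv] <;> assumption

theorem IsNumbering.setNat {m : ℕ} {G : SimpleGraph (Fin m)} {u : Finset (Fin m) → R}
    {s : Memory R} (h : IsNumbering G u s) {a : ℕ} (ha : 10 ≤ a) (x : ℕ) :
    IsNumbering G u (s.setNat a 0 x) :=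
  h.congr (fun b hb => Memory.setNat_nat_of_ne _ _ _ (by
    simp only [List.mem_cons, List.not_mem_nil, or_false] at hb
    omega)) rfl

theorem isNumbering_addVertex {m : ℕ} {G : SimpleGraph (Fin m)} {u : Finset (Fin m) → R}
    (hu : ∀ X, 0 ≤ u X) {s : Memory R} (h : IsNumbering G u s) {i j : Fin m} (h32 : s.nat 32 0 = i)
    (h33 : s.nat 33 0 = j) (hij : G.Adj i j) (hi : 1 ≤ s.nat 6 i) (hj : s.nat 6 j = 0) :
    IsNumbering G u (addVertex.run s) ∧
      ∀ v : Fin m, (addVertex.run s).nat 6 v = if v = j then s.nat 9 0 + 1 else s.nat 6 v := by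
  have hne : (i : ℕ) ≠ j := fun h' => by
    rw [h'] at hi
    omega
  have e6 : ∀ v : Fin m, (addVertex.run s).nat 6 v =
      if v = j then s.nat 9 0 + 1 else s.nat 6 v := fun v => by
    simp [LoopProg.addVertex, h33, Fin.ext_iff]
  have e9 : (addVertex.run s).nat 9 0 = s.nat 9 0 + 1 := by simp [LoopProg.addVertex]
  have e7 : ∀ t, (addVertex.run s).nat 7 t = if t = s.nat 9 0 + 1 then (j : ℕ) else s.nat 7 t :=
    fun t => by simp [LoopProg.addVertex, h33]
  have e8 : ∀ t, (addVertex.run s).nat 8 t = if t = s.nat 9 0 + 1 then s.nat 6 i else s.nat 8 t :=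
    fun t => by simp [LoopProg.addVertex, h33, h32, hne]
  have v1 : ∀ t, (addVertex.run s).val 1 t = if t = s.nat 9 0 + 1 then u {j} else s.val 1 t :=
    fun t => by simp [LoopProg.addVertex, h33, h.utility]
  have hn : ∀ a ∈ [0, 1, 4], (addVertex.run s).nat a = s.nat a := fun a ha =>
    run_nat_of_notMem (by
      simp only [LoopProg.addVertex, natWrites, List.mem_cons, List.mem_append, List.not_mem_nil,
        or_false] at ha ⊢
      omega) s
  have hv : (addVertex.run s).val 0 = s.val 0 :=
    run_val_of_notMem (by simp [LoopProg.addVertex, valWrites]) s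
  have hlej := h.le
  refine ⟨⟨?_, ?_, ?_, ?_, ?_, ?_, ?_, ?_, ?_, ?_, ?_⟩, e6⟩
  · rw [hn 0 (by simp), h.vertices]
  · rw [hn 4 (by simp)]; exact h.offset
  · rw [hn 1 (by simp)]; exact h.adj
  · rw [hv]; exact h.utility
  · omega
  · intro v
    have := h.le v
    rw [e6, e9]
    split_ifs <;> omega
  · intro v hv
    rw [e6] at hv ⊢
    rw [e7]
    split_ifs at hv ⊢ with h1 h2 h2
    · rw [h1]
    · exact (h2 rfl).elim
    · have := h.le v
      omega
    · exact h.inverse v hv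
  · intro t ht htc
    rw [e9] at htc
    rw [v1]
    split_ifs with h1
    · exact ⟨j, by rw [e6, if_pos rfl, h1], rfl⟩
    · obtain ⟨v, hv, hv'⟩ := h.weight t ht (by omega)
      refine ⟨v, ?_, hv'⟩
      rw [e6, if_neg, hv]
      rintro rfl
      omega
  · intro t ht htc
    rw [e9] at htc
    rw [e8]
    have := h.le i
    split_ifs with h1
    · omega
    · exact h.isParent t ht (by omega)
  · intro t ht htc
    rw [e9] at htc
    rw [e8]
    split_ifs with h1
    · refine ⟨j, i, by rw [e6, if_pos rfl, h1], ?_, hi, hij.symm⟩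
      rw [e6, if_neg fun h' => hne (by rw [h'])]
    · obtain ⟨v, w, hv, hw, hpos, hvw⟩ := h.parent_adj t ht (by omega)
      refine ⟨v, w, ?_, ?_, hpos, hvw⟩
      · rw [e6, if_neg, hv]
        rintro rfl
        omega
      · rw [e6, if_neg, hw]
        rintro rfl
        omega
  · intro t
    rw [v1]
    split_ifs
    exacts [hu _, h.nonneg t]

/-- One step of a sweep. -/
theorem IsNumbering.step {m : ℕ} {G : SimpleGraph (Fin m)} {u : Finset (Fin m) → R}
    (hu : ∀ X, 0 ≤ u X) {s : Memory R} (h : IsNumbering G u s) {s' : Memory R}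
    (hs' : s' = (LoopProg.when newEdge addVertex).run s) :
    IsNumbering G u s' ∧ (∀ v : Fin m, 1 ≤ s.nat 6 v → 1 ≤ s'.nat 6 v) ∧
      ∀ v w : Fin m, s.nat 32 0 = v → s.nat 33 0 = w → G.Adj v w → 1 ≤ s.nat 6 v →
        1 ≤ s'.nat 6 w := by
  subst hs'
  by_cases hb : newEdge.holds s
  · rw [run_when_pos hb]
    simp only [newEdge, Test.holds_and, holds_natLt, Test.holds_natLe, NatExp.eval_const,
      NatExp.eval_read, NatExp.eval_add, eval_cell, h.vertices] at hb
    obtain ⟨⟨hi, hj⟩, hadj, h1, h2⟩ := hb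
    obtain ⟨i, hi⟩ : ∃ i : Fin m, s.nat 32 0 = i := ⟨⟨_, hi⟩, rfl⟩
    obtain ⟨j, hj⟩ : ∃ j : Fin m, s.nat 33 0 = j := ⟨⟨_, hj⟩, rfl⟩
    rw [hi, hj, h.offset i i.2, h.adj] at hadj
    rw [hi] at h1
    rw [hj] at h2
    obtain ⟨a1, a2⟩ := isNumbering_addVertex hu h hi hj hadj h1 (Nat.le_zero.1 h2)
    refine ⟨a1, fun v hv => ?_, fun v w hv hw _ _ => ?_⟩
    · rw [a2]
      split_ifs <;> omega
    · obtain rfl : w = j := Fin.ext (by rw [← hw, hj])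
      rw [a2, if_pos rfl]
      omega
  · rw [run_when_neg hb]
    refine ⟨h, fun v hv => hv, fun v w hv hw hvw h1 => ?_⟩
    by_contra h2
    refine hb ?_
    simp only [newEdge, Test.holds_and, holds_natLt, Test.holds_natLe, NatExp.eval_const,
      NatExp.eval_read, NatExp.eval_add, eval_cell, h.vertices, hv, hw, h.offset v v.2, h.adj]
    exact ⟨⟨v.2, w.2⟩, hvw, h1, by omega⟩

theorem numbering_wellFormed : numbering.WellFormed := by
  simp [numbering, sweep, addVertex, WellFormed, natWrites]

theorem sweep_wellFormed : sweep.WellFormed := numbering_wellFormed.2.2.2.2.2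

theorem sweep_natWrites {a : ℕ} (ha : a ∉ [32, 33, 9, 6, 7, 8]) : a ∉ sweep.natWrites := by
  simpa [sweep, addVertex, natWrites] using ha

/-- A sweep numbers all neighbours of the vertices that had been numbered before. -/
theorem isNumbering_sweep {m M : ℕ} {G : SimpleGraph (Fin m)} {u : Finset (Fin m) → R}
    (hu : ∀ X, 0 ≤ u X) {s : Memory R} (h : IsNumbering G u s) (hM : s.nat 3 0 = M) (hmM : m < M) :
    IsNumbering G u (sweep.run s) ∧ (∀ v : Fin m, 1 ≤ s.nat 6 v → 1 ≤ (sweep.run s).nat 6 v) ∧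
      ∀ v w : Fin m, G.Adj v w → 1 ≤ s.nat 6 v → 1 ≤ (sweep.run s).nat 6 w := by
  have key := loop_induction (s := s) sweep_wellFormed
    (fun k s' => IsNumbering G u s' ∧ (∀ v : Fin m, 1 ≤ s.nat 6 v → 1 ≤ s'.nat 6 v) ∧
      ∀ v w : Fin m, (v : ℕ) < k → G.Adj v w → 1 ≤ s.nat 6 v → 1 ≤ s'.nat 6 w) ?_ ?_ ?_
  · rw [hM] at key
    exact ⟨key.1, key.2.1, fun v w => key.2.2 v w (by omega)⟩
  · rintro k s' x ⟨h1, h2, h3⟩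
    exact ⟨h1.setNat (by omega) x, by simpa using h2, by simpa using h3⟩
  · exact ⟨h, fun v hv => hv, fun v w hv => by omega⟩
  · rintro k s' hk hn - hk' ⟨h1, h2, h3⟩
    have key := loop_induction (s := s') sweep_wellFormed.2.2
      (fun i s'' => IsNumbering G u s'' ∧ (∀ v : Fin m, 1 ≤ s'.nat 6 v → 1 ≤ s''.nat 6 v) ∧
        ∀ v w : Fin m, (v : ℕ) = k → (w : ℕ) < i → G.Adj v w → 1 ≤ s'.nat 6 v →
          1 ≤ s''.nat 6 w) ?_ ?_ ?_
    · rw [hn 3 (sweep_natWrites (by simp)), hM] at key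
      obtain ⟨k1, k2, k3⟩ := key
      refine ⟨k1, fun v hv => k2 v (h2 v hv), fun v w hvk hvw hv => ?_⟩
      rcases Nat.lt_or_ge v k with h' | h'
      · exact k2 w (h3 v w h' hvw hv)
      · exact k3 v w (by omega) (by omega) hvw (h2 v hv)
    · rintro i s'' x ⟨h1, h2, h3⟩
      exact ⟨h1.setNat (by omega) x, by simpa using h2, by simpa using h3⟩
    · exact ⟨h1, fun v hv => hv, fun v w _ hw => by omega⟩
    · rintro i s'' - hn' - hi' ⟨j1, j2, j3⟩
      obtain ⟨k1, k2, k3⟩ := j1.step hu rfl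
      refine ⟨k1, fun v hv => k2 v (j2 v hv), fun v w hv hw hvw hv1 => ?_⟩
      rcases Nat.lt_or_ge w i with h' | h'
      · exact k2 w (j3 v w hv h' hvw hv1)
      · refine k3 v w ?_ (by omega) hvw (j2 v hv1)
        rw [hn' 32 (by simp [addVertex, natWrites]), hk', hv]

/-- After `k` sweeps every vertex with a walk of length at most `k` from the root is numbered, and
paths are shorter than `m < M`, so all vertices are reached. The array `7` inverts the numbering,
which is therefore injective, and counting gives `9[0] = m`. -/
theorem numbering_spec {m M : ℕ} {G : SimpleGraph (Fin m)} {u : Finset (Fin m) → R}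
    (hG : G.IsTree) (hadd : IsAdditive u) (hu : ∀ X, 0 ≤ u X) {s : Memory R} (hM : s.nat 3 0 = M)
    (hmM : m < M) (hm : s.nat 0 0 = m) (hoff : ∀ i, i < m → s.nat 4 i = i * m)
    (hadj : ∀ v w : Fin m, 1 ≤ s.nat 1 (v * m + w) ↔ G.Adj v w)
    (hut : ∀ v : Fin m, s.val 0 v = u {v}) (h6 : ∀ i, s.nat 6 i = 0) (h7 : ∀ i, s.nat 7 i = 0)
    (h8 : ∀ i, s.nat 8 i = 0) (h1 : ∀ i, s.val 1 i = 0) :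
    IsRooting G (fun v => (numbering.run s).nat 6 v) ((numbering.run s).nat 8) ∧
      IsWeight (fun v => (numbering.run s).nat 6 v) u ((numbering.run s).val 1) ∧
      ∀ v : Fin m, (numbering.run s).nat 7 ((numbering.run s).nat 6 v) = v := by
  -- A tree has a vertex, so the vertex `0` exists and can serve as the root.
  obtain ⟨r⟩ := hG.connected.nonempty
  have hm0 : 0 < m := r.pos
  let root : Fin m := ⟨0, hm0⟩
  simp only [numbering, run_seq]
  generalize hs₀ : LoopProg.run (.setVal 1 (.const 1) (.read 0 (.const 0))) (_ : Memory R) = s₀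
  have e6 : ∀ v : Fin m, s₀.nat 6 v = if v = root then 1 else 0 := fun v => by
    simp [← hs₀, h6, root, Fin.ext_iff]
  have e9 : s₀.nat 9 0 = 1 := by simp [← hs₀]
  have e7 : ∀ t, s₀.nat 7 t = 0 := fun t => by simp [← hs₀, h7]
  have e8 : ∀ t, s₀.nat 8 t = 0 := fun t => by simp [← hs₀, h8]
  have v1 : ∀ t, s₀.val 1 t = if t = 1 then u {root} else 0 := fun t => by
    have := hut root
    simp only [root] at this
    simp [← hs₀, h1, this, root]
  have hnum₀ : IsNumbering G u s₀ := by
    refine ⟨?_, ?_, ?_, ?_, ?_, ?_, ?_, ?_, ?_, ?_, ?_⟩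
    · simp [← hs₀, hm]
    · intro i hi; simp [← hs₀, hoff i hi]
    · intro v w; simp [← hs₀, hadj v w]
    · intro v; simp [← hs₀, hut v]
    · omega
    · intro v; rw [e6, e9]; split_ifs <;> omega
    · intro v hv
      rw [e6] at hv
      rw [e7]
      split_ifs at hv with h
      · rw [h]
      · omega
    · intro t ht ht'
      obtain rfl : t = 1 := by omega
      exact ⟨root, by rw [e6, if_pos rfl], by rw [v1, if_pos rfl]⟩
    · intro t ht _
      rw [e8]
      omega
    · intro t ht ht'
      omega
    · intro t
      rw [v1]
      split_ifs
      exacts [hu _, le_rfl]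
  have key := loop_induction (s := s₀) numbering_wellFormed.2.2.2
    (fun k s' => IsNumbering G u s' ∧
      ∀ v, ∀ p : G.Walk root v, p.length ≤ k → 1 ≤ s'.nat 6 v) ?_ ?_ ?_
  · rw [show s₀.nat 3 0 = M by simp [← hs₀, hM]] at key
    obtain ⟨hnum, hwalk⟩ := key
    set s' := (LoopProg.loop 31 LoopProg.sweep).run s₀
    have hpos : ∀ v : Fin m, 1 ≤ s'.nat 6 v := fun v => by
      obtain ⟨p, hp⟩ := (hG.connected root v).exists_isPath
      have := hp.length_lt
      rw [Fintype.card_fin] at this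
      exact hwalk v p (by omega)
    have hinj : Function.Injective fun v : Fin m => s'.nat 6 v := fun v w h => by
      have h1 := hnum.inverse v (hpos v)
      have h2 := hnum.inverse w (hpos w)
      simp only at h
      rw [h, h2] at h1
      exact Fin.ext h1.symm
    have hc1 : m ≤ s'.nat 9 0 := by
      have := Finset.card_le_card_of_injOn (s := Finset.univ) (t := Finset.Icc 1 (s'.nat 9 0))
        (fun v : Fin m => s'.nat 6 v)
        (fun v _ => Finset.mem_coe.2 (Finset.mem_Icc.2 ⟨hpos v, hnum.le v⟩)) hinj.injOn
      simpa using this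
    have hc2 : s'.nat 9 0 ≤ m := by
      have := Finset.card_le_card_of_surjOn (s := Finset.univ) (t := Finset.Icc 1 (s'.nat 9 0))
        (fun v : Fin m => s'.nat 6 v) (fun t ht => by
          obtain ⟨ht, ht'⟩ := Finset.mem_Icc.1 (Finset.mem_coe.1 ht)
          obtain ⟨v, hv, -⟩ := hnum.weight t ht ht'
          exact ⟨v, by simp, hv⟩)
      simpa using this
    have hpp : ∀ t, 2 ≤ t → t ≤ m → 1 ≤ s'.nat 8 t := fun t ht htm => by
      obtain ⟨-, -, -, -, h, -⟩ := hnum.parent_adj t ht (by omega)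
      exact h
    refine ⟨IsRooting.of_isTree hG hinj hpos (fun v => (hnum.le v).trans hc2)
      (fun t ht htm => hnum.isParent t ht (by omega)) hpp fun v w hvw => ?_,
      ⟨hadd, hu, fun v => ?_, hnum.nonneg⟩, fun v => hnum.inverse v (hpos v)⟩
    -- The vertex with number `1` has the virtual parent `0`, which is the number of no vertex; so
    -- `v` is not the root.
    · have h2 : 2 ≤ s'.nat 6 v := by
        have h3 := hnum.isParent _ (hpos v) (hnum.le v)
        have h4 := hpos w
        omega
      obtain ⟨x, y, hx, hy, -, hxy⟩ := hnum.parent_adj _ h2 (hnum.le v)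
      rwa [hinj hx, hinj (hy.trans hvw)] at hxy
    · obtain ⟨x, hx, hx'⟩ := hnum.weight _ (hpos v) (hnum.le v)
      rw [hx', hinj hx]
  · rintro k s' x ⟨h1, h2⟩
    exact ⟨h1.setNat (by omega) x, by simpa using h2⟩
  · refine ⟨hnum₀, fun v p hp => ?_⟩
    obtain rfl := SimpleGraph.Walk.eq_of_length_eq_zero (Nat.le_zero.1 hp)
    rw [e6, if_pos rfl]
  · rintro k s' - hn - - ⟨h1, h2⟩
    obtain ⟨k1, k2, k3⟩ := isNumbering_sweep (M := M) hu h1 (by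
      rw [hn 3 (by simp [LoopProg.sweep, addVertex, natWrites]), ← hs₀]; simp [hM]) hmM
    refine ⟨k1, fun v p hp => ?_⟩
    by_cases hnil : p.Nil
    · obtain rfl := hnil.eq
      exact k2 _ (h2 _ SimpleGraph.Walk.nil (by simp))
    -- The walk without its last edge is covered by the earlier sweeps, the last edge by the new
    -- one.
    · refine k3 _ _ (p.adj_penultimate hnil) (h2 _ p.dropLast ?_)
      rw [SimpleGraph.Walk.length_dropLast]
      omega

end Verification

/-! ### Correctness of the whole program -/

section Verification

variable {R : Type} [AddCommGroup R] [LinearOrder R]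

omit [LinearOrder R] in
-- Quotient and remainder modulo `m` recover the row and the column from the address, so different
-- pairs do not collide.
theorem one_le_inputMemory_adj {m : ℕ} (G : SimpleGraph (Fin m)) (n : ℕ)
    (u : Finset (Fin m) → R) (v w : Fin m) :
    1 ≤ (inputMemory G n u).nat 1 (v * m + w) ↔ G.Adj v w := by
  have key : (∃ i j : Fin m, (v * m + w : ℕ) = i * m + j ∧ G.Adj i j) ↔ G.Adj v w := by
    refine ⟨fun ⟨i, j, h, hij⟩ => ?_, fun h => ⟨v, w, rfl, h⟩⟩
    have hm : 0 < m := v.pos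
    have h1 := congrArg (· / m) h
    have h2 := congrArg (· % m) h
    simp only [mul_comm _ m, Nat.mul_add_div hm, Nat.mul_add_mod, Nat.div_eq_of_lt w.2,
      Nat.div_eq_of_lt j.2, Nat.mod_eq_of_lt w.2,
      Nat.mod_eq_of_lt j.2, add_zero] at h1 h2
    rwa [Fin.ext h1, Fin.ext h2]
  simp only [inputMemory, one_ne_zero, if_false, if_true]
  split_ifs with h
  · simpa using key.1 h
  · simpa using fun h' => h (key.2 h')

theorem numbering_natWrites {a : ℕ} (ha : a ∉ [6, 7, 8, 9, 31, 32, 33]) :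
    a ∉ numbering.natWrites := by
  simp [numbering, sweep, addVertex, natWrites] at ha ⊢
  tauto

theorem isReady_numbering {m n : ℕ} {G : SimpleGraph (Fin m)} {u : Finset (Fin m) → R}
    (hG : G.IsTree) (hadd : IsAdditive u) (hu : ∀ X, 0 ≤ u X) {s : Memory R}
    (hs : s = (inputMemory G n u).setNat 3 0 (m + n + 1)) :
    IsReady n G u (numbering.run (multiples.run s)) := by
  have h3 : s.nat 3 0 = m + n + 1 := by simp [hs]
  have hn : ∀ a ≠ 3, s.nat a = (inputMemory G n u).nat a := fun a ha => by
    rw [hs, Memory.setNat_nat_of_ne _ _ _ ha]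
  have h00 : s.nat 0 0 = m := by rw [hn 0 (by simp)]; simp [inputMemory]
  have h01 : s.nat 0 1 = n := by rw [hn 0 (by simp)]; simp [inputMemory]
  have hz : ∀ a, 4 ≤ a → ∀ i, s.nat a i = 0 := fun a ha i => by
    rw [hn a (by omega)]
    simp [inputMemory, show a ≠ 0 by omega, show a ≠ 1 by omega]
  have hmul := multiples_spec h3 h00 (hz 4 le_rfl 0) (hz 5 (by omega) 0)
  have hnm : ∀ a ∉ [4, 5, 30], (multiples.run s).nat a = s.nat a := fun a ha =>
    run_nat_of_notMem (by simp [multiples, natWrites] at ha ⊢; tauto) s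
  have hvm : (multiples.run s).val = s.val := by
    funext a
    exact run_val_of_notMem (by simp [multiples, valWrites]) s
  obtain ⟨r1, r2, r3⟩ := numbering_spec (s := multiples.run s) (M := m + n + 1) hG hadd hu
    (by rw [hnm 3 (by simp), h3]) (by omega) (by rw [hnm 0 (by simp), h00])
    (fun i hi => (hmul i (by omega)).1)
    (fun v w => by rw [hnm 1 (by simp), hn 1 (by simp), one_le_inputMemory_adj])
    (fun v => by rw [hvm, hs]; simp [inputMemory, Memory.setNat])
    (fun i => by rw [hnm 6 (by simp), hz 6 (by omega)])
    (fun i => by rw [hnm 7 (by simp), hz 7 (by omega)])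
    (fun i => by rw [hnm 8 (by simp), hz 8 (by omega)])
    (fun i => by rw [hvm, hs]; simp [inputMemory, Memory.setNat])
  have hnn : ∀ a ∉ [6, 7, 8, 9, 31, 32, 33],
      (numbering.run (multiples.run s)).nat a = (multiples.run s).nat a := fun a ha =>
    run_nat_of_notMem (numbering_natWrites ha) _
  refine ⟨?_, ?_, ?_, fun j hj => ?_, r1, r2, r3⟩
  · rw [hnn 0 (by simp), hnm 0 (by simp), h00]
  · rw [hnn 0 (by simp), hnm 0 (by simp), h01]
  · rw [hnn 3 (by simp), hnm 3 (by simp), h3]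
  · rw [hnn 5 (by simp)]
    exact (hmul j (by omega)).2

variable [IsOrderedAddMonoid R]

theorem isSMMS_of_isReady {m n : ℕ} {G : SimpleGraph (Fin m)} {u : Finset (Fin m) → R}
    {s : Memory R} (h : IsReady n G u s) (hn : 1 ≤ n) (hμ : s.val 5 0 = 0)
    (h24 : s.nat 24 0 = 0) (h25 : s.nat 25 0 = 0) {s' : Memory R}
    (hs' : s' = run (.seq (.loop 40 (.loop 41 raiseThreshold)) (.seq fillTable
      (.seq findLosers assign))) s) :
    IsSMMS G u (outputAllocation m n s') := by
  simp only [run_seq] at hs'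
  -- The threshold `0` is feasible: without any cuts, agent `0` receives the whole tree.
  have hf : IsFeasible n G u (s.val 5 0) :=
    ⟨_, (IsAssignment.isAssignment_agentOf n h.rooting.isParent fun _ => False).isConnectedAllocation
      h.rooting hn, fun i => hμ ▸ h.weight.utility_nonneg _⟩
  obtain ⟨s₁, hs₁⟩ : ∃ s₁, s₁ = run (.loop 40 (.loop 41 raiseThreshold)) s := ⟨_, rfl⟩
  obtain ⟨r1, hμ1, hf1, hlt⟩ := rounds_spec h hn hμ.ge hf hs₁
  have hn₁ : ∀ a ∈ [24, 25], s₁.nat a = s.nat a := fun a ha => by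
    rw [hs₁]
    refine run_nat_of_notMem ?_ s
    simp only [natWrites, List.mem_cons, not_or, List.not_mem_nil, or_false] at ha ⊢
    exact ⟨by omega, by omega, raiseThreshold_natWrites (by
      simp only [List.mem_cons, List.not_mem_nil, or_false]; omega)⟩
  rw [← hs₁] at hs'
  obtain ⟨g, hg, hgs⟩ :=
    fillTable_spec r1.bound r1.vertices (by omega) r1.offset r1.rooting.isParent
  have r2 := r1.fillTable
  have hM : 0 < m + n + 1 := by omega
  have hn₂ : ∀ a ∉ [34, 35, 36, 20, 37, 21, 38, 19, 18, 14, 15, 16, 17, 10, 11, 12, 13],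
      (fillTable.run s₁).nat a = s₁.nat a := fun a ha =>
    run_nat_of_notMem (fillTable_natWrites ha) s₁
  have hv₂ : ∀ a ∉ [2, 3, 4], (fillTable.run s₁).val a = s₁.val a := fun a ha =>
    run_val_of_notMem (fillTable_valWrites ha) s₁
  set s₂ := fillTable.run s₁
  have h10 : ∀ l, l < m + n + 1 → s₂.nat 10 l = (g m 0 l).1 := fun l hl => by
    rw [hgs 0 l hl]
    simp [table]
  have hμ2 : s₂.val 5 0 = s₁.val 5 0 := by rw [hv₂ 5 (by simp)]
  have hn₃ : ∀ a ∉ [23, 42], (findLosers.run s₂).nat a = s₂.nat a := fun a ha =>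
    run_nat_of_notMem (findLosers_natWrites ha) s₂
  obtain ⟨f1, f2, f3⟩ := findLosers_spec r2.bound r2.agents (by omega) fun hpos => by
    obtain ⟨B, hB, hle⟩ := hf1
    have hcard : loserCount u (s₁.val 5 0) B ≤ n := by
      simpa [loserCount] using Finset.card_filter_le Finset.univ fun i => u (B i) = s₁.val 5 0
    refine ⟨_, hcard, ?_⟩
    rw [h10 _ (by omega)]
    exact le_of_forall_le r1.rooting r1.weight hg (hμ2 ▸ hpos) hB hle (by omega)
  have hv₃ := findLosers_val s₂
  set s₃ := findLosers.run s₂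
  have r3 : IsReady n G u s₃ := r2.congr (fun a ha => hn₃ a (by
    simp only [List.mem_cons, List.not_mem_nil, or_false] at ha ⊢
    omega)) (by rw [hv₃])
  obtain ⟨rem, C, agent, c, t1, t2, t3, t4⟩ := assign_spec r3
    (by rw [hn₃ 24 (by simp), hn₂ 24 (by simp), hn₁ 24 (by simp), h24])
    (by rw [hn₃ 25 (by simp), hn₂ 25 (by simp), hn₁ 25 (by simp), h25]) f1
  rw [hn₃ 8 (by simp), hn₂ 8 (by simp)] at t1 t3
  rw [hn₃ 11 (by simp), hn₃ 12 (by simp), hn₃ 13 (by simp)] at t1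
  rw [hn₃ 6 (by simp), hn₂ 6 (by simp), ← hs'] at t4
  rw [hμ2, ← t2] at f2 f3
  rw [← t2] at f1
  have hout : outputAllocation m n s' =
      fun i : Fin n => Finset.univ.filter fun v : Fin m => agent (s₁.nat 6 v) = i := by
    funext i
    simp only [outputAllocation, t4]
  rw [hout]
  refine isSMMS_of_table r1.rooting r1.weight hg hμ1 hn (by omega) ?_ t1 (fun hpos => ?_) f3 t3
  · rwa [hg.eq_greedy r1.rooting.isParent hM le_rfl (by omega)]
  · obtain ⟨k1, k2⟩ := f2 hpos
    refine ⟨by rwa [← h10 _ f1], fun l hl => ?_⟩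
    rw [← h10 l (hl.trans f1)]
    exact k2 l hl

theorem main_spec {m n : ℕ} {G : SimpleGraph (Fin m)} {u : Finset (Fin m) → R}
    (hn : 1 ≤ n) (hG : G.IsTree) (hadd : IsAdditive u) (hu : ∀ X, 0 ≤ u X) :
    IsSMMS G u (outputAllocation m n
      (main.run ((inputMemory G n u).setNat 3 0 (m + n + 1)))) := by
  have h := isReady_numbering (n := n) hG hadd hu rfl
  have hnat : ∀ a, 10 ≤ a → a < 30 → ∀ i,
      (numbering.run (multiples.run ((inputMemory G n u).setNat 3 0 (m + n + 1)))).nat a i = 0 :=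
    fun a h1 h2 i => by
      rw [run_nat_of_notMem (numbering_natWrites (by
          simp only [List.mem_cons, List.not_mem_nil, or_false]; omega)),
        run_nat_of_notMem (by simp [multiples, natWrites]; omega),
        Memory.setNat_nat_of_ne _ _ _ (by omega)]
      simp [inputMemory, show a ≠ 0 by omega, show a ≠ 1 by omega]
  refine isSMMS_of_isReady h hn ?_ (hnat 24 (by omega) (by omega) 0)
    (hnat 25 (by omega) (by omega) 0) ?_
  · rw [run_val_of_notMem (by simp [numbering, sweep, addVertex, valWrites]),
      run_val_of_notMem (by simp [multiples, valWrites])]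
    simp [inputMemory, Memory.setNat]
  · simp only [main, run_seq]

end Verification

end LoopProg

/-! ### Polynomial bounds for the two costs -/

section Cost

open Polynomial

variable {R : Type} [AddCommGroup R] [LinearOrder R] [IsOrderedAddMonoid R]

/-- The number of operations of the program, in terms of `m + n`. -/
noncomputable def unitCostPoly : ℕ[X] := C 9 + LoopProg.main.costPoly.comp (X + 1)

theorem exec_smmsProgram {m n : ℕ} {G : SimpleGraph (Fin m)} {u : Finset (Fin m) → R}
    (hn : 1 ≤ n) (hG : G.IsTree) (hu : ∀ X, 0 ≤ u X) (hadd : IsAdditive u) :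
    ∃ t s, Exec (unitCost R) smmsProgram (inputMemory G n u) t s ∧
      t ≤ unitCostPoly.eval (m + n) ∧ IsSMMS G u (outputAllocation m n s) := by
  have h0 := Exec.setNat (C := unitCost R) (inputMemory G n u) 3 (.const 0)
    (.add (.add (.read 0 (.const 0)) (.read 0 (.const 1))) (.const 1))
  have e : NatExp.eval (inputMemory G n u)
      (.add (.add (.read 0 (.const 0)) (.read 0 (.const 1))) (.const 1)) = m + n + 1 := by
    simp [inputMemory]
  rw [e] at h0
  obtain ⟨t, ht, hle⟩ := LoopProg.exec_compile LoopProg.main_wellFormed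
    ((inputMemory G n u).setNat 3 0 (m + n + 1))
  refine ⟨_, _, h0.seq ht, ?_, LoopProg.main_spec hn hG hadd hu⟩
  simp only [Memory.setNat_nat_apply] at hle
  -- The `9` in `unitCostPoly` is the cost of the initial assignment of `M`; the shift to `X + 1` is
  -- there because `M = m + n + 1`.
  simp [unitCostPoly, NatExp.cost, unitCost] at hle ⊢
  omega

omit [AddCommGroup R] [LinearOrder R] [IsOrderedAddMonoid R] in
theorem eval_mono_nat (p : ℕ[X]) {a b : ℕ} (h : a ≤ b) : p.eval a ≤ p.eval b := by
  rw [Polynomial.eval_eq_sum, Polynomial.eval_eq_sum]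
  exact Finset.sum_le_sum fun i _ => Nat.mul_le_mul_left _ (Nat.pow_le_pow_left h i)

theorem natAbs_num_le (x : ℚ) : x.num.natAbs ≤ 2 ^ ratBits x :=
  (Nat.size_le.1 le_rfl).le.trans (two_pow_le_two_pow (by unfold ratBits; omega))

theorem den_le (x : ℚ) : x.den ≤ 2 ^ ratBits x :=
  (Nat.size_le.1 le_rfl).le.trans (two_pow_le_two_pow (by unfold ratBits; omega))

theorem prod_den_le {ι : Type*} (s : Finset ι) (x : ι → ℚ) :
    ∏ i ∈ s, (x i).den ≤ 2 ^ ∑ i ∈ s, ratBits (x i) := by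
  rw [← Finset.prod_pow_eq_pow_sum]
  exact Finset.prod_le_prod' fun i _ => den_le (x i)

/-- The numbers of a family have a common denominator. -/
theorem boundedRat_prod_den {ι : Type*} [DecidableEq ι] (s : Finset ι) (x : ι → ℚ) {i : ι}
    (hi : i ∈ s) {k : ℕ} (hk : ∑ i ∈ s, ratBits (x i) < k) :
    BoundedRat (∏ i ∈ s, (x i).den) k (x i) := by
  refine ⟨(x i).num * ((∏ j ∈ s.erase i, (x j).den : ℕ) : ℤ), ?_, ?_⟩
  · rw [← Finset.mul_prod_erase s _ hi]
    push_cast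
    rw [← mul_assoc, Rat.mul_den_eq_num]
  · rw [Int.natAbs_mul, Int.natAbs_natCast]
    calc _ ≤ 2 ^ ratBits (x i) * 2 ^ ∑ j ∈ s.erase i, ratBits (x j) :=
          Nat.mul_le_mul (natAbs_num_le _) (prod_den_le _ _)
      _ = 2 ^ ∑ j ∈ s, ratBits (x j) := by
          rw [← pow_add, Finset.add_sum_erase s (fun j => ratBits (x j)) hi]
      _ < 2 ^ k := Nat.pow_lt_pow_right (by omega) hk

theorem inputMemory_bounded {m n : ℕ} (G : SimpleGraph (Fin m)) (u : Finset (Fin m) → ℚ) {k : ℕ}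
    (hk : m + n + ∑ v, ratBits (u {v}) < k) :
    (inputMemory G n u).Bounded (∏ v, (u {v}).den) k := by
  constructor
  · intro a i
    have hlt : k < 2 ^ k := Nat.lt_two_pow_self
    simp only [inputMemory]
    split_ifs <;> omega
  · intro a i
    simp only [inputMemory]
    split_ifs with _ h
    · exact boundedRat_prod_den Finset.univ (fun v => u {v}) (Finset.mem_univ (⟨i, h⟩ : Fin m))
        (by omega)
    · exact BoundedRat.zero _ _
    · exact BoundedRat.zero _ _

/-- The bit cost of the program, in terms of `m + n` and the binary length of the utilities. -/
noncomputable def bitCostPoly : ℕ[X] :=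
  unitCostPoly * (C 2 * (X + C (smmsProgram.constSum + 2) + unitCostPoly) + 1)

theorem exec_bitCost_smmsProgram {m n : ℕ} {G : SimpleGraph (Fin m)} {u : Finset (Fin m) → ℚ}
    (hn : 1 ≤ n) (hG : G.IsTree) (hu : ∀ X, 0 ≤ u X) (hadd : IsAdditive u) :
    ∃ t s, Exec bitCost smmsProgram (inputMemory G n u) t s ∧
      t ≤ bitCostPoly.eval (m + n + ∑ v, ratBits (u {v})) ∧
      IsSMMS G u (outputAllocation m n s) := by
  obtain ⟨t, s, ht, hle, hs⟩ := exec_smmsProgram hn hG hu hadd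
  set N := m + n + ∑ v, ratBits (u {v}) with hN
  -- `k` must exceed `N`, which bounds the input and the common denominator, and must also cover the
  -- constants of the program.
  obtain ⟨t', ht', hle', -⟩ := ht.bitCost_of_unitCost (D := ∏ v, (u {v}).den)
    (Finset.prod_pos fun v _ => (u {v}).den_pos) (k := N + 1 + smmsProgram.constSum)
    ((prod_den_le _ _).trans_lt (Nat.pow_lt_pow_right (by omega) (by omega)))
    (inputMemory_bounded G u (by omega)) (by omega)
  refine ⟨t', s, ht', hle'.trans ?_, hs⟩
  have hle := hle.trans (eval_mono_nat _ (show m + n ≤ N by omega))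
  simp only [bitCostPoly, Polynomial.eval_mul, Polynomial.eval_add, Polynomial.eval_C,
    Polynomial.eval_X, Polynomial.eval_one]
  refine Nat.mul_le_mul hle ?_
  unfold opBits
  omega

end Cost

end GraphFairDivision

theorem mainTheorem6 :
    ∃ (P : GraphFairDivision.Prog) (p q : Polynomial ℕ),
      (∀ (m n : ℕ) (G : SimpleGraph (Fin m)) (u : Finset (Fin m) → ℝ),
        1 ≤ n → G.IsTree → (∀ X, 0 ≤ u X) → GraphFairDivision.IsAdditive u →
        ∃ (t : ℕ) (s : GraphFairDivision.Memory ℝ),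
          GraphFairDivision.Exec (GraphFairDivision.unitCost ℝ) P
            (GraphFairDivision.inputMemory G n u) t s ∧
          t ≤ p.eval (m + n) ∧
          GraphFairDivision.IsSMMS G u (GraphFairDivision.outputAllocation m n s)) ∧
      (∀ (m n : ℕ) (G : SimpleGraph (Fin m)) (u : Finset (Fin m) → ℚ),
        1 ≤ n → G.IsTree → (∀ X, 0 ≤ u X) → GraphFairDivision.IsAdditive u →
        ∃ (t : ℕ) (s : GraphFairDivision.Memory ℚ),
          GraphFairDivision.Exec GraphFairDivision.bitCost P
            (GraphFairDivision.inputMemory G n u) t s ∧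
          t ≤ q.eval (m + n + ∑ v, GraphFairDivision.ratBits (u {v})) ∧
          GraphFairDivision.IsSMMS G u (GraphFairDivision.outputAllocation m n s)) := by
  refine ⟨GraphFairDivision.smmsProgram, GraphFairDivision.unitCostPoly,
    GraphFairDivision.bitCostPoly, fun m n G u hn hG hu hadd => ?_,
    fun m n G u hn hG hu hadd => ?_⟩
  · exact GraphFairDivision.exec_smmsProgram hn hG hu hadd
  · exact GraphFairDivision.exec_bitCost_smmsProgram hn hG hu hadd
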